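/- **Setting.** Let $\mathbf T$ be a finite triangulation (a finite pure $3$-dimensional simplicial complex) in which the link of every edge is a circle or an arc; every triangulated compact $3$-manifold, with or without boundary, is of this form. A triangle $t$ has a dual edge $e^*$, oriented from a tetrahedron $s(e^*)$ to a tetrahedron $t(e^*)$ if $t$ is interior, and outwards if $t$ is in the boundary. An edge $e$ has a dual face $f^*$, which runs through the $M_e$ tetrahedra around $e$ (a closed loop, $M_e\ge 3$, if $e$ is interior). The boundary graph of a tetrahedron $T$ has the four triangles of $T$ as nodes and its six edges as links $l$, each oriented from a source node $s(l)$ to a target node $t(l)$; the boundary of $\mathbf T$ has in the same way a graph $\Gamma$ with nodes the boundary triangles and oriented links the boundary edges. Each pair (link, end node) in each of these graphs carries a spinor: $z_l\in\mathbb C^2$ at the source and $\tilde z_l\in\mathbb C^2$ at the target. The spinors at interior triangles are integrated; those at boundary triangles are fixed and are at the same time the spinors of $\Gamma$. *Compatible orientations.* Run around each dual face. Count a disagreement whenever a dual edge is traversed against its orientation, and whenever a link of a tetrahedron is traversed from source to target; for a boundary edge, count one more if the link of $\Gamma$ points from the start to the end of the run. Assume that, after reversal of suitable dual edges, the number of disagreements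 along every dual face is even. *Notation.* $\langle w|z\rangle=\bar w^0z^0+\bar w^1z^1$, $|z]=(-\bar z^1,\bar z^0)$, $[z|=(-z^1,z^0)$, $d\mu(z)=\pi^{-2}e^{-\langle z|z\rangle}d^4z$; $dg$ is the normalized Haar measure of $\mathrm{SU}(2)$, $\chi^j$ the character of spin $j$, and, for $0<q<1$, $\delta_q=\sum_{j\in\mathbb N/2}q^{2j}(2j+1)\chi^j$. For an oriented graph, the coherent spin network function is $$s^{\rm cohe}(g)=\int\prod_n dh_n\; e^{\sum_l[\tilde z_l|h_{t(l)}^{-1}g_lh_{s(l)}|z_l\rangle}.$$ *Ponzano–Regge side.* For $q=(q_e)\in(0,1)^{\{\text{interior edges}\}}$ put $$Z_q=\int_{\mathrm{SU}(2)}\prod_{e^*}dg_{e^*}\ \prod_{e\ \text{interior}}\delta_{q_e}\Big(\overrightarrow{\prod_{e^*\in\partial f^*}}g_{e^*}\Big)\ s^{\rm cohe}_\Gamma\big((g_l)_{l\in\Gamma}\big),$$ where $g_{e^*}$ is replaced by its inverse if $e^*$ is traversed backwards, and $g_l$ is the ordered product of the $g_{e^*}$ along the dual face of the boundary edge dual to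 $l$ (flatness of that dual face). *Spinor side.* For $r=(r_e)\in(0,1)^{\{\text{interior edges}\}}$ put $$\mathcal A_r=\int[d\mu(z)]\prod_{f^*}\mathcal A_{f^*}\prod_{e^*}\mathcal A_{e^*}\prod_{v^*}\mathcal A_{v^*}.$$ The face product is over the interior edges, with $\mathcal A_{f^*}=\langle z^{f^*,T_1}|z^{f^*,T_1}\rangle-1$, where $z^{f^*,T_1}$ is the spinor at an arbitrarily chosen node of one tetrahedron $T_1$ on the link dual to the edge. The edge product is over the interior triangles (nodes) $n$, with $\mathcal A_{e^*}=e^{\sum_{l\in n}r_l\langle z_l^{s(e^*)}|z_l^{t(e^*)}]}$ ($r_l=r_e$ if the edge $e$ dual to $l$ is interior and $r_l=1$ otherwise; the edge amplitude proper has all $r_l=1$). The vertex product is over the tetrahedra, with $$\mathcal A_{v^*}=s^{\rm cohe}_{\rm tet}(\mathbb I)=\int_{\mathrm{SU}(2)^4}\prod_{n=1}^4dh_n\,e^{\sum_{l=1}^6[\tilde z_l|h_{t(l)}^{-1}h_{s(l)}|z_l\rangle}.$$ **Proposition.** The series for $\delta_q$ converges pointwise for $0<q<1$, and $\int\delta_q(g)F(g)\,dg\to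 F(\mathbb I)$ as $q\to1^-$ for every continuous $F:\mathrm{SU}(2)\to\mathbb C$. For all $r_e\in(0,1)$, both integrals below converge absolutely and $$Z_{(r_e^{M_e})_e}=\mathcal A_r .$$ Consequently the Ponzano–Regge partition function $Z=\int\prod dg_{e^*}\prod_{f^*}\delta(\overrightarrow{\prod}g_{e^*})\,s_\Gamma^{\rm cohe}$, understood as the limit of $Z_q$ when all $q_e\to1^-$ independently, exists if and only if the spinor state-integral $\mathcal A=\int[d\mu(z)]\prod_{f^*}\mathcal A_{f^*}\prod_{e^*}\mathcal A_{e^*}\prod_{v^*}\mathcal A_{v^*}$, understood as the limit of $\mathcal A_r$ when all $r_e\to1^-$ independently, exists, and then $Z=\mathcal A$. -/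

import Mathlib

open MeasureTheory Filter Topology

noncomputable section

namespace PonzanoRegge

/-! ### The group SU(2), its Haar measure and its delta distribution -/

/-- The group `SU(2)`. -/
abbrev SU2 : Type := ↥(Matrix.specialUnitaryGroup (Fin 2) ℂ)

instance : MeasurableSpace SU2 := borel SU2

instance : BorelSpace SU2 := ⟨rfl⟩

instance : IsTopologicalGroup SU2 where
  continuous_mul := by
    refine Continuous.subtype_mk ?_ _
    exact (continuous_subtype_val.comp continuous_fst).mul
      (continuous_subtype_val.comp continuous_snd)
  continuous_inv := by
    refine Continuous.subtype_mk (f := fun g : SU2 => star g.1) ?_ _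
    exact continuous_star.comp continuous_subtype_val

theorem isCompact_SU2 :
    IsCompact (Matrix.specialUnitaryGroup (Fin 2) ℂ : Set (Matrix (Fin 2) (Fin 2) ℂ)) := by
  have hK : IsCompact (Set.pi Set.univ fun _ : Fin 2 => Set.pi Set.univ fun _ : Fin 2 =>
      Metric.closedBall (0 : ℂ) 1) :=
    isCompact_univ_pi fun _ => isCompact_univ_pi fun _ => isCompact_closedBall _ _
  refine IsCompact.of_isClosed_subset hK ?_ ?_
  · have h : (Matrix.specialUnitaryGroup (Fin 2) ℂ : Set (Matrix (Fin 2) (Fin 2) ℂ))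
        = {A | A * star A = 1} ∩ {A | A.det = 1} := by
      ext A
      simp [Matrix.mem_specialUnitaryGroup_iff, Matrix.mem_unitaryGroup_iff]
    rw [h]
    exact (isClosed_eq (continuous_id.mul continuous_star) continuous_const).inter
      (isClosed_eq (Continuous.matrix_det continuous_id) continuous_const)
  · intro A hA i _ j _
    have := entry_norm_bound_of_unitary
      (Matrix.mem_specialUnitaryGroup_iff.1 (show A ∈ Matrix.specialUnitaryGroup (Fin 2) ℂ from hA)).1 i j
    simpa using this

instance : CompactSpace SU2 := isCompact_iff_compactSpace.1 isCompact_SU2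

/-- The Haar measure of `SU(2)` with total mass `1`. -/
def haar : Measure SU2 := Measure.haarMeasure ⊤

/-- The Wigner matrix of `g` in the representation of spin `j = n / 2`: the action of `g` on
homogeneous polynomials of degree `n` in two variables, in the basis of monomials `x ^ k * y ^ (n - k)`
(written with `y = 1`). -/
def wigner (n : ℕ) (g : SU2) : Matrix (Fin (n + 1)) (Fin (n + 1)) ℂ := fun k l =>
  ((Polynomial.C (g.1 0 0) * Polynomial.X + Polynomial.C (g.1 0 1)) ^ (l : ℕ) *
    (Polynomial.C (g.1 1 0) * Polynomial.X + Polynomial.C (g.1 1 1)) ^ (n - (l : ℕ))).coeff k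

/-- The character `χ^j(g) = Tr D^j(g)` with `n = 2j`. -/
def character (n : ℕ) (g : SU2) : ℂ := (wigner n g).trace

/-- The delta distribution on `SU(2)`, `δ = ∑_j (2j + 1) χ^j`, with its Peter-Weyl series Abel-damped
by `q`: the smooth function `δ_q = ∑_j q^{2j} (2j + 1) χ^j` (for `0 < q < 1`). -/
def deltaKernel (q : ℝ) (g : SU2) : ℂ :=
  ∑' n : ℕ, (q : ℂ) ^ n * ((n : ℂ) + 1) * character n g

/-! ### Spinors -/

/-- Spinors `|z⟩ = (z⁰, z¹)`. -/
abbrev Spinor : Type := Fin 2 → ℂ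

/-- The Gaussian measure `dμ(z) = π⁻² exp(-⟨z|z⟩) d⁴z`. -/
def spinorMeasure : Measure Spinor :=
  volume.withDensity fun z => ENNReal.ofReal (Real.exp (-(‖z 0‖ ^ 2 + ‖z 1‖ ^ 2)) / Real.pi ^ 2)

/-- `⟨w|z⟩`. -/
def braket (w z : Spinor) : ℂ := star (w 0) * z 0 + star (w 1) * z 1

/-- The dual spinor `|z] = |ςz⟩ = (-conj z¹, conj z⁰)`. -/
def dual (z : Spinor) : Spinor := ![-star (z 1), star (z 0)]

/-- `[w|g|z⟩`, where `[w| = ⟨ςw|`. -/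
def dualBraket (w : Spinor) (g : SU2) (z : Spinor) : ℂ := braket (dual w) (g.1.mulVec z)

/-- The coherent spin network function of an oriented graph with nodes `N` and links `L`,
evaluated on the holonomies `g l` (from the source to the target of `l`):
`s(g) = ∫ ∏ₙ dhₙ exp (∑ₗ [z̃ₗ| h_{t(l)}⁻¹ gₗ h_{s(l)} |zₗ⟩)`,
with `z` the spinors at the sources and `z'` the spinors at the targets. -/
def cohSpinNetwork {N L : Type*} [Fintype N] [Fintype L] (s t : L → N) (z z' : L → Spinor)
    (g : L → SU2) : ℂ :=
  ∫ h : N → SU2, Complex.exp (∑ l, dualBraket (z' l) ((h (t l))⁻¹ * g l * h (s l)) (z l))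
    ∂(Measure.pi fun _ => haar)

/-! ### Triangulations -/

section Triangulations

variable {V : Type*} [DecidableEq V]

/-- An enumeration of the tetrahedra around the edge `e`, i.e. a parametrisation of the dual face of
`e`: the link of `e` is the circle (`pt 0 = pt len`) or the arc (`pt 0 ≠ pt len`) with the consecutive
vertices `pt 0, …, pt len`. The `i`-th tetrahedron is `e ∪ {pt i, pt (i+1)}`; it is joined to the
next one along the triangle `e ∪ {pt (i+1)}`. -/
structure Fan (tets : Finset (Finset V)) (e : Finset V) where
  len : ℕ
  pt : ℕ → V
  mem_tets : ∀ i < len, insert (pt i) (insert (pt (i + 1)) e) ∈ tets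
  cover : ∀ T ∈ tets, e ⊆ T → ∃ i < len, T = insert (pt i) (insert (pt (i + 1)) e)
  simple : ∀ i j, i < j → j ≤ len → pt i = pt j → i = 0 ∧ j = len
  three_le : pt 0 = pt len → 3 ≤ len

/-- The `i`-th tetrahedron of the fan. -/
def Fan.tet {tets : Finset (Finset V)} {e : Finset V} (F : Fan tets e) (i : ℕ) : Finset V :=
  insert (F.pt i) (insert (F.pt (i + 1)) e)

/-- The `i`-th triangle of the fan. -/
def Fan.tri {tets : Finset (Finset V)} {e : Finset V} (F : Fan tets e) (i : ℕ) : Finset V :=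
  insert (F.pt i) e

/-- A finite triangulation, given by its tetrahedra (sets of four vertices; the simplices are the
subsets of the tetrahedra), such that the link of every edge is a circle or an arc. Each triangle then
lies in one or two tetrahedra. Every triangulated compact 3-manifold, with or without boundary, is of
this form. -/
structure Triangulation (V : Type*) [DecidableEq V] where
  tets : Finset (Finset V)
  card_tet : ∀ T ∈ tets, T.card = 4
  edge_link : ∀ T ∈ tets, ∀ e ∈ T.powersetCard 2, Nonempty (Fan tets e)

namespace Triangulation

variable (K : Triangulation V)

/-- Triangles; they are dual to the dual edges. -/
def triangles : Finset (Finset V) := K.tets.biUnion fun T => T.powersetCard 3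

/-- Edges; they are dual to the dual faces. -/
def edges : Finset (Finset V) := K.tets.biUnion fun T => T.powersetCard 2

/-- Triangles shared by two tetrahedra. -/
def bulkTriangles : Finset (Finset V) :=
  K.triangles.filter fun t => (K.tets.filter fun T => t ⊆ T).card = 2

/-- Triangles in only one tetrahedron: the nodes of the boundary graph `Γ`. -/
def bdTriangles : Finset (Finset V) :=
  K.triangles.filter fun t => (K.tets.filter fun T => t ⊆ T).card = 1

/-- Edges in the boundary: the links of the boundary graph `Γ`. -/
def bdEdges : Finset (Finset V) := K.edges.filter fun e => ∃ t ∈ K.bdTriangles, e ⊆ t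

/-- Edges in the interior. -/
def bulkEdges : Finset (Finset V) := K.edges.filter fun e => ¬ ∃ t ∈ K.bdTriangles, e ⊆ t

/-- The integrated spinors are labelled by the `(T, t, e)` with `e` an edge of the triangle `t`
and `t` a triangle shared by the tetrahedron `T` and another one: `(T, t, e)` labels the
spinor at the node `t` on the link `e` of the dual boundary graph of `T`. -/
def bulkFlags : Finset (Finset V × Finset V × Finset V) :=
  (K.tets ×ˢ K.bulkTriangles ×ˢ K.edges).filter fun p => p.2.1 ⊆ p.1 ∧ p.2.2 ⊆ p.2.1

/-- The choices made in writing down the amplitudes (values of the functions at arguments other than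
those in the conditions are irrelevant):
* `src t`, `tgt t`: the source and the target of the dual edge of the triangle `t`; the dual edge of
  a boundary triangle points outwards;
* `linkSrc T e`, `linkTgt T e`: the source and the target node (triangles) of the link dual to `e`
  in the boundary graph of the tetrahedron `T`;
* `bdSrc e`, `bdTgt e`: the source and the target node of the link dual to `e` in the boundary
  graph `Γ` of the triangulation;
* `fan e`: where to start and how to run around the dual face of `e`;
* `baseTet e`, `baseTri e`: the tetrahedron and the node on its boundary whose spinor enters the face
  amplitude of the interior edge `e`. -/
structure Choices where
  src : Finset V → Finset V
  tgt : Finset V → Finset V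
  src_mem : ∀ t ∈ K.triangles, src t ∈ K.tets ∧ t ⊆ src t
  tgt_mem : ∀ t ∈ K.bulkTriangles, tgt t ∈ K.tets ∧ t ⊆ tgt t ∧ tgt t ≠ src t
  linkSrc : Finset V → Finset V → Finset V
  linkTgt : Finset V → Finset V → Finset V
  linkSrc_mem : ∀ T ∈ K.tets, ∀ e ∈ T.powersetCard 2, linkSrc T e ∈ T.powersetCard 3
  linkTgt_mem : ∀ T ∈ K.tets, ∀ e ∈ T.powersetCard 2, linkTgt T e ∈ T.powersetCard 3
  link_sub : ∀ T ∈ K.tets, ∀ e ∈ T.powersetCard 2,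
    e ⊆ linkSrc T e ∧ e ⊆ linkTgt T e ∧ linkSrc T e ≠ linkTgt T e
  bdSrc : Finset V → Finset V
  bdTgt : Finset V → Finset V
  bdSrc_mem : ∀ e ∈ K.bdEdges, bdSrc e ∈ K.bdTriangles
  bdTgt_mem : ∀ e ∈ K.bdEdges, bdTgt e ∈ K.bdTriangles
  bd_sub : ∀ e ∈ K.bdEdges, e ⊆ bdSrc e ∧ e ⊆ bdTgt e ∧ bdSrc e ≠ bdTgt e
  fan : (e : ↥K.edges) → Fan K.tets e.1
  baseTet : Finset V → Finset V
  baseTri : Finset V → Finset V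
  base_mem : ∀ e ∈ K.bulkEdges, baseTet e ∈ K.tets ∧ baseTri e ∈ (baseTet e).powersetCard 3 ∧
    e ⊆ baseTri e

/-- An interior edge, as an edge. -/
def bulkEdge (e : ↥K.bulkEdges) : ↥K.edges := ⟨e.1, (Finset.mem_filter.1 e.2).1⟩

/-- A boundary edge, as an edge. -/
def bdEdge (e : ↥K.bdEdges) : ↥K.edges := ⟨e.1, (Finset.mem_filter.1 e.2).1⟩

variable {K}

namespace Choices

variable (D : K.Choices)

/-! #### The orientation sign of a dual face -/

/-- How often the orientations disagree along the dual face of `e`. When the face is traversed as in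
`fan e`, a dual edge should be traversed from its source to its target and a link of a
tetrahedron from its target to its source; for an edge in the boundary, the link of `Γ` should also
point from the end of the fan to its start. -/
def mismatch (e : ↥K.edges) : ℕ :=
  (∑ i ∈ Finset.range (D.fan e).len,
    ((if D.linkSrc ((D.fan e).tet i) e.1 = (D.fan e).tri i then 1 else 0) +
      (if D.src ((D.fan e).tri (i + 1)) = (D.fan e).tet i then 0 else 1))) +
  (if e.1 ∈ K.bdEdges ∧ D.bdSrc e.1 = (D.fan e).tri 0 then 1 else 0)

/-- The orientations fit together: after reversal of some dual edges (those with `η t = -1`),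
the number of disagreements along every dual face is even. -/
def Compatible : Prop :=
  ∃ η : Finset V → ℤˣ, ∀ e : ↥K.edges,
    (-1 : ℤˣ) ^ D.mismatch e = ∏ t ∈ K.triangles.filter (fun t => e.1 ⊆ t), η t

/-! #### The group integral -/

/-- The group element of a dual edge. -/
def dualEdgeElt (g : ↥K.triangles → SU2) (t : Finset V) : SU2 :=
  if h : t ∈ K.triangles then g ⟨t, h⟩ else 1

/-- The holonomy for leaving the tetrahedron `T` through the triangle `t`. -/
def crossing (g : ↥K.triangles → SU2) (T t : Finset V) : SU2 :=
  if D.src t = T then dualEdgeElt g t else (dualEdgeElt g t)⁻¹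

/-- The ordered product of the holonomies for leaving the successive tetrahedra around `e`. For an
interior edge, this is the ordered product of the group elements around its dual face. -/
def holonomy (g : ↥K.triangles → SU2) (e : ↥K.edges) : SU2 :=
  (List.ofFn fun i : Fin (D.fan e).len =>
    D.crossing g ((D.fan e).tet i) ((D.fan e).tri (i + 1))).prod

/-- The holonomy along the link of `Γ` dual to the boundary edge `e`, as determined by the flatness
of the dual face of `e`: the path enters the first tetrahedron through the first triangle and runs
to the last triangle. -/
def bdHolonomy (g : ↥K.triangles → SU2) (e : ↥K.edges) : SU2 :=
  if D.bdTgt e.1 = (D.fan e).tri 0 then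
    (D.crossing g ((D.fan e).tet 0) ((D.fan e).tri 0))⁻¹ * D.holonomy g e
  else
    ((D.crossing g ((D.fan e).tet 0) ((D.fan e).tri 0))⁻¹ * D.holonomy g e)⁻¹

/-- The coherent spin network state on the boundary graph `Γ` with the spinors `ζ n l` at the node
`n` on the link `l`. -/
def boundaryState (ζ : Finset V → Finset V → Spinor) (g : ↥K.bdEdges → SU2) : ℂ :=
  cohSpinNetwork (N := ↥K.bdTriangles) (L := ↥K.bdEdges)
    (fun l => ⟨D.bdSrc l.1, D.bdSrc_mem l.1 l.2⟩) (fun l => ⟨D.bdTgt l.1, D.bdTgt_mem l.1 l.2⟩)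
    (fun l => ζ (D.bdSrc l.1) l.1) (fun l => ζ (D.bdTgt l.1) l.1) g

/-- The integrand of the discretised BF path integral: the flatness deltas (damped by `q`) of the
interior dual faces, and the boundary state at the boundary holonomies. -/
def groupIntegrand (ζ : Finset V → Finset V → Spinor) (q : ↥K.bulkEdges → ℝ)
    (g : ↥K.triangles → SU2) : ℂ :=
  (∏ e : ↥K.bulkEdges, deltaKernel (q e) (D.holonomy g (K.bulkEdge e))) *
    D.boundaryState ζ fun e => D.bdHolonomy g (K.bdEdge e)

/-- The damped discretised BF path integral. -/
def groupIntegral (ζ : Finset V → Finset V → Spinor) (q : ↥K.bulkEdges → ℝ) : ℂ :=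
  ∫ g, D.groupIntegrand ζ q g ∂(Measure.pi fun _ : ↥K.triangles => haar)

/-! #### The spinor integral -/

/-- The spinor at the node `t` on the link `e` of the boundary graph of `T`: an integration variable
for `t` in the interior, a boundary datum for `t` in the boundary. -/
def spinorAt (ζ : Finset V → Finset V → Spinor) (z : ↥K.bulkFlags → Spinor)
    (T t e : Finset V) : Spinor :=
  if h : (T, t, e) ∈ K.bulkFlags then z ⟨(T, t, e), h⟩ else ζ t e

/-- The vertex amplitude: the coherent spin network of the boundary graph of the tetrahedron `T`
(nodes: its triangles, links: its edges) at the identity. -/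
def vertexAmplitude (w : Finset V → Finset V → Finset V → Spinor) (T : ↥K.tets) : ℂ :=
  cohSpinNetwork (N := ↥(T.1.powersetCard 3)) (L := ↥(T.1.powersetCard 2))
    (fun l => ⟨D.linkSrc T.1 l.1, D.linkSrc_mem T.1 T.2 l.1 l.2⟩)
    (fun l => ⟨D.linkTgt T.1 l.1, D.linkTgt_mem T.1 T.2 l.1 l.2⟩)
    (fun l => w T.1 (D.linkSrc T.1 l.1) l.1) (fun l => w T.1 (D.linkTgt T.1 l.1) l.1) 1

/-- The edge amplitude `exp (∑_{l ∈ n} ρ_l ⟨z_l^{s(e*)}|z_l^{t(e*)}])` of the triangle `t`, with damping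
factors `ρ`; the undamped amplitude is the one with `ρ = 1`. -/
def edgeAmplitude (w : Finset V → Finset V → Finset V → Spinor) (ρ : Finset V → ℝ)
    (t : Finset V) : ℂ :=
  Complex.exp (∑ e ∈ t.powersetCard 2,
    (ρ e : ℂ) * braket (w (D.src t) t e) (dual (w (D.tgt t) t e)))

/-- The face amplitude `⟨z|z⟩ - 1` of the interior edge `e`. -/
def faceAmplitude (w : Finset V → Finset V → Finset V → Spinor) (e : Finset V) : ℂ :=
  braket (w (D.baseTet e) (D.baseTri e) e) (w (D.baseTet e) (D.baseTri e) e) - 1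

/-- Damping factors for all edges: `r` for interior edges, none for the edges in the boundary. -/
def damping (r : ↥K.bulkEdges → ℝ) (e : Finset V) : ℝ :=
  if h : e ∈ K.bulkEdges then r ⟨e, h⟩ else 1

/-- The product of the face, edge and vertex amplitudes (with damping `r`). -/
def spinorIntegrand (ζ : Finset V → Finset V → Spinor) (r : ↥K.bulkEdges → ℝ)
    (z : ↥K.bulkFlags → Spinor) : ℂ :=
  (∏ e ∈ K.bulkEdges, D.faceAmplitude (spinorAt ζ z) e) *
    (∏ t ∈ K.bulkTriangles, D.edgeAmplitude (spinorAt ζ z) (damping r) t) *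
    ∏ T : ↥K.tets, D.vertexAmplitude (spinorAt ζ z) T

/-- The damped spinor integral. -/
def spinorIntegral (ζ : Finset V → Finset V → Spinor) (r : ↥K.bulkEdges → ℝ) : ℂ :=
  ∫ z, D.spinorIntegrand ζ r z ∂(Measure.pi fun _ : ↥K.bulkFlags => spinorMeasure)

/-! #### Removal of the damping -/

/-- The damping parameters tend to `1` from below, independently of each other. -/
def undamp (K : Triangulation V) : Filter (↥K.bulkEdges → ℝ) :=
  𝓝[{r | ∀ e, r e ∈ Set.Ioo (0 : ℝ) 1}] 1

/-- The Ponzano-Regge partition function `∫ ∏ dg ∏ δ(holonomy) · ψ` exists and is equal to `A`. -/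
def HasPartitionFunction (ζ : Finset V → Finset V → Spinor) (A : ℂ) : Prop :=
  Tendsto (D.groupIntegral ζ) (undamp K) (𝓝 A)

/-- The spinor state-integral `∫ [dμ(z)] ∏ A_f ∏ A_e ∏ A_v` exists and is equal to `A`. -/
def HasStateIntegral (ζ : Finset V → Finset V → Spinor) (A : ℂ) : Prop :=
  Tendsto (D.spinorIntegral ζ) (undamp K) (𝓝 A)

end Choices

end Triangulation

end Triangulations

end PonzanoRegge

end

/-!
Both integrals are shown to equal one integral over an element of `SU(2)` for each triangle.

On the spinor side, the vertex amplitudes are themselves integrals over group elements, one for each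
triangle of each tetrahedron. For fixed group elements, the Gaussian integral over the spinors factorises
over the dual faces: the spinors on the links dual to an edge `e` interact only along the dual face of `e`,
in a chain `[w|A|x⟩, ⟨x|w'], [w'|A'|x'⟩, …` which is closed if `e` is interior, and otherwise begins and
ends with boundary data. The edge amplitudes glue the links: by the reproducing property of coherent
states (`integral_exp_linear`), an open chain contracts to `exp [a|∏ A|b⟩` (`integral_exp_chainAction`).
For a closed chain one Gaussian integral remains, which with the face amplitude `⟨z|z⟩ - 1` is

  `∫ (⟨z|z⟩ - 1) exp (q ⟨z|g|z⟩) dμ(z) = (1 - q²) / (1 - q tr g + q²)²`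

(`integral_normSq_sub_one_mul_exp`, by diagonalising `g`), with `q` the product of the damping factors and
of the orientation signs along the face. The three-term recurrence of the characters shows that the right
side is `δ_q(g)` (`deltaKernel_eq`). In this closed form `δ_q` is visibly an approximate identity once its
total mass is known to be `1`, and that follows from the Gaussian formula, because `⟨z|g|z⟩ⁿ` has Haar
integral `0` for `n > 0`.

The use of Fubini's theorem is justified by a bound, uniform in the group elements, by a Gaussian of rate
less than `1`. Along an open chain this holds without damping, by eliminating the spinors one after the
other (`exists_norm_chainAction_le`); a closed chain needs the damping (`exists_norm_loop_le`).

The group elements `h` of the vertex amplitudes enter only through the elements `h_{s(t),t} h_{t(t),t}⁻¹` of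
the dual edges, one factor from each side of a triangle (`dualEdgeElts`), and the orientation signs along
all faces are absorbed by multiplying those of suitable dual edges by `-1`, which is what compatibility
of the orientations provides. By invariance of the Haar measure the elements of the dual edges are
independent and Haar distributed (`integral_comp_dualEdgeElts`). On the group side, the group elements at
the nodes of the boundary state are absorbed into those of the boundary triangles
(`groupIntegral_eq`). The same integrand remains on both sides.

Finally, `r ↦ (r_e ^ M_e)_e` and its inverse both preserve the limit in which all damping is removed.
-/

open scoped ComplexConjugate

namespace PonzanoRegge

/-! ### The group `SU(2)` -/

instance : SecondCountableTopology SU2 :=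
  have : SecondCountableTopology (Matrix (Fin 2) (Fin 2) ℂ) :=
    inferInstanceAs (SecondCountableTopology (Fin 2 → Fin 2 → ℂ))
  Topology.IsEmbedding.subtypeVal.secondCountableTopology

instance : haar.IsHaarMeasure :=
  inferInstanceAs (Measure.haarMeasure (⊤ : TopologicalSpace.PositiveCompacts SU2)).IsHaarMeasure

instance : IsProbabilityMeasure haar where
  measure_univ := by
    have := Measure.haarMeasure_self (K₀ := (⊤ : TopologicalSpace.PositiveCompacts SU2))
    simpa [haar] using this

/-- A compact group is unimodular: a right translate of `haar` is again a Haar probability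
measure. -/
instance : haar.IsMulRightInvariant where
  map_mul_right_eq_self g := by
    have : IsProbabilityMeasure (Measure.map (· * g) haar) :=
      Measure.isProbabilityMeasure_map (measurable_mul_const g).aemeasurable
    have : (Measure.map (· * g) haar).IsHaarMeasure :=
      { lt_top_of_isCompact := fun _ _ => measure_lt_top _ _
        map_mul_left_eq_self := fun h => map_mul_left_eq_self _ h
        open_pos := fun U hU hne => by
          rw [Measure.map_apply (measurable_mul_const g) hU.measurableSet]
          refine (hU.preimage (continuous_mul_const g)).measure_ne_zero _ ?_
          obtain ⟨x, hx⟩ := hne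
          exact ⟨x * g⁻¹, by simpa using hx⟩ }
    exact Measure.isHaarMeasure_eq_of_isProbabilityMeasure _ _

theorem SU2.coe_inv (g : SU2) : (g⁻¹).1 = star g.1 := rfl

theorem SU2.det_coe (g : SU2) : g.1.det = 1 := (Matrix.mem_specialUnitaryGroup_iff.1 g.2).2

theorem SU2.star_coe (g : SU2) : star g.1 = g.1.adjugate := by
  have h1 : star g.1 * g.1 = 1 :=
    (Matrix.mem_unitaryGroup_iff'.1 (Matrix.mem_specialUnitaryGroup_iff.1 g.2).1)
  have h2 : g.1 * g.1.adjugate = 1 := by rw [Matrix.mul_adjugate, SU2.det_coe, one_smul]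
  exact left_inv_eq_right_inv h1 h2

theorem SU2.apply_one_one (g : SU2) : g.1 1 1 = star (g.1 0 0) := by
  have := congrFun (congrFun g.star_coe 0) 0
  simpa [Matrix.adjugate_fin_two, Matrix.star_apply] using this.symm

theorem SU2.apply_zero_one (g : SU2) : g.1 0 1 = -star (g.1 1 0) := by
  have := congrFun (congrFun g.star_coe 0) 1
  rw [Matrix.star_apply, Matrix.adjugate_fin_two] at this
  simp only [Matrix.of_apply, Matrix.cons_val', Matrix.cons_val_zero, Matrix.cons_val_one] at this
  simpa using (congrArg Neg.neg this).symm

theorem SU2.normSq_add (g : SU2) : g.1 0 0 * star (g.1 0 0) + g.1 1 0 * star (g.1 1 0) = 1 := by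
  have := g.det_coe
  rw [Matrix.det_fin_two, g.apply_one_one, g.apply_zero_one] at this
  linear_combination this

/-- The element `((a, -conj b), (b, conj a))` of `SU(2)`. -/
noncomputable def SU2.mk (a b : ℂ) (h : a * star a + b * star b = 1) : SU2 :=
  ⟨!![a, -star b; b, star a], by
    rw [Matrix.mem_specialUnitaryGroup_iff, Matrix.mem_unitaryGroup_iff]
    constructor
    · ext i j
      fin_cases i <;> fin_cases j <;>
        simp [Matrix.mul_apply, Fin.sum_univ_two, Matrix.star_apply] <;> simp at h <;>
          first | linear_combination h | ring
    · rw [Matrix.det_fin_two_of]; simp at h ⊢; linear_combination h⟩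

theorem SU2.ext_col {g h : SU2} (h0 : g.1 0 0 = h.1 0 0) (h1 : g.1 1 0 = h.1 1 0) : g = h := by
  apply Subtype.ext
  ext i j
  fin_cases i <;> fin_cases j
  · exact h0
  · change g.1 0 1 = h.1 0 1
    rw [g.apply_zero_one, h.apply_zero_one, h1]
  · exact h1
  · change g.1 1 1 = h.1 1 1
    rw [g.apply_one_one, h.apply_one_one, h0]

/-- The central element `±1` of `SU(2)`. -/
noncomputable def signElt : ℤˣ →* SU2 where
  toFun s := ⟨((s : ℤ) : ℂ) • 1, by
    rw [Matrix.mem_specialUnitaryGroup_iff, Matrix.mem_unitaryGroup_iff]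
    rcases Int.units_eq_one_or s with rfl | rfl <;> simp [Matrix.det_neg]⟩
  map_one' := by apply Subtype.ext; simp
  map_mul' s t := by
    apply Subtype.ext
    change (((s * t : ℤˣ) : ℤ) : ℂ) • (1 : Matrix (Fin 2) (Fin 2) ℂ) = (((s : ℤ) : ℂ) • (1 : Matrix (Fin 2) (Fin 2) ℂ)) * (((t : ℤ) : ℂ) • 1)
    rw [smul_mul_assoc, one_mul, smul_smul]
    simp

theorem signElt_coe (s : ℤˣ) : (signElt s).1 = ((s : ℤ) : ℂ) • (1 : Matrix (Fin 2) (Fin 2) ℂ) := rfl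

theorem coe_signElt_mul (s : ℤˣ) (g : SU2) : (signElt s * g).1 = ((s : ℤ) : ℂ) • g.1 := by
  change (signElt s).1 * g.1 = _
  rw [signElt_coe, smul_mul_assoc, one_mul]

theorem signElt_comm (s : ℤˣ) (g : SU2) : signElt s * g = g * signElt s := by
  apply Subtype.ext
  change (signElt s).1 * g.1 = g.1 * (signElt s).1
  rw [signElt_coe, smul_mul_assoc, one_mul, mul_smul_comm, mul_one]

theorem signElt_inv (s : ℤˣ) : (signElt s)⁻¹ = signElt s := by
  rw [← map_inv, Int.units_inv_eq_self]

theorem continuous_coe_apply (i j : Fin 2) : Continuous fun g : SU2 => g.1 i j :=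
  (continuous_apply j).comp ((continuous_apply i).comp continuous_subtype_val)

/-! ### Spinor brackets -/

/-- The Hermitian norm `√⟨z|z⟩` of a spinor. -/
noncomputable def spinorNorm (z : Spinor) : ℝ := √(‖z 0‖ ^ 2 + ‖z 1‖ ^ 2)

theorem spinorNorm_nonneg (z : Spinor) : 0 ≤ spinorNorm z := Real.sqrt_nonneg _

theorem spinorNorm_sq (z : Spinor) : spinorNorm z ^ 2 = ‖z 0‖ ^ 2 + ‖z 1‖ ^ 2 :=
  Real.sq_sqrt (by positivity)

theorem braket_self (z : Spinor) : braket z z = ((spinorNorm z ^ 2 : ℝ) : ℂ) := by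
  rw [spinorNorm_sq, braket]
  push_cast
  rw [← Complex.conj_mul', ← Complex.conj_mul']; rfl

theorem norm_braket_le (w z : Spinor) : ‖braket w z‖ ≤ spinorNorm w * spinorNorm z := by
  refine abs_le_of_sq_le_sq' ?_ (mul_nonneg (spinorNorm_nonneg _) (spinorNorm_nonneg _)) |>.2
  rw [mul_pow, spinorNorm_sq, spinorNorm_sq]
  have h : ‖braket w z‖ ≤ ‖w 0‖ * ‖z 0‖ + ‖w 1‖ * ‖z 1‖ := by
    refine (norm_add_le _ _).trans (le_of_eq ?_)
    simp
  have h2 := pow_le_pow_left₀ (norm_nonneg _) h 2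
  nlinarith [sq_nonneg (‖w 0‖ * ‖z 1‖ - ‖w 1‖ * ‖z 0‖)]

theorem spinorNorm_dual (z : Spinor) : spinorNorm (dual z) = spinorNorm z := by
  simp [spinorNorm, dual, add_comm]

theorem spinorNorm_mulVec (g : SU2) (z : Spinor) : spinorNorm (g.1.mulVec z) = spinorNorm z := by
  have h : braket (g.1.mulVec z) (g.1.mulVec z) = braket z z := by
    have h1 := g.normSq_add
    simp only [braket, Matrix.mulVec, dotProduct, Fin.sum_univ_two, g.apply_one_one,
      g.apply_zero_one, star_add, star_mul', star_neg, star_star]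
    linear_combination (z 0 * star (z 0) + z 1 * star (z 1)) * h1
  rw [braket_self, braket_self, Complex.ofReal_inj] at h
  exact (pow_left_inj₀ (spinorNorm_nonneg _) (spinorNorm_nonneg _) two_ne_zero).1 h

theorem dualBraket_eq (w : Spinor) (g : SU2) (z : Spinor) :
    dualBraket w g z = -w 1 * (g.1.mulVec z) 0 + w 0 * (g.1.mulVec z) 1 := by
  simp [dualBraket, braket, dual]

theorem braket_dual_eq (w z : Spinor) :
    braket w (dual z) = -(star (w 0) * star (z 1)) + star (w 1) * star (z 0) := by
  simp [braket, dual]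

theorem braket_dual_swap (w z : Spinor) : braket w (dual z) = -braket z (dual w) := by
  rw [braket_dual_eq, braket_dual_eq]; ring

/-- Reversing the orientation of a link costs a sign, as the bilinear form `[w|z⟩` is antisymmetric and
invariant under `SU(2)`. -/
theorem dualBraket_swap (w : Spinor) (g : SU2) (z : Spinor) :
    dualBraket w g z = -dualBraket z g⁻¹ w := by
  rw [dualBraket_eq, dualBraket_eq, SU2.coe_inv]
  simp only [Matrix.mulVec, dotProduct, Fin.sum_univ_two, Matrix.star_apply, g.apply_one_one,
    g.apply_zero_one, star_neg, star_star]
  ring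

theorem norm_dualBraket_le (w : Spinor) (g : SU2) (z : Spinor) :
    ‖dualBraket w g z‖ ≤ spinorNorm w * spinorNorm z := by
  refine (norm_braket_le _ _).trans (le_of_eq ?_)
  rw [spinorNorm_dual, spinorNorm_mulVec]

theorem dualBraket_signElt_mul (s : ℤˣ) (w : Spinor) (g : SU2) (z : Spinor) :
    dualBraket w (signElt s * g) z = ((s : ℤ) : ℂ) * dualBraket w g z := by
  rw [dualBraket_eq, dualBraket_eq, coe_signElt_mul, Matrix.smul_mulVec]
  simp; ring

@[fun_prop]
theorem continuous_dual : Continuous dual := by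
  unfold dual
  refine continuous_pi fun i => ?_
  fin_cases i
  · exact (continuous_apply 1).star.neg
  · exact (continuous_apply 0).star

theorem _root_.Continuous.braket {X : Type*} [TopologicalSpace X] {f g : X → Spinor} (hf : Continuous f)
    (hg : Continuous g) : Continuous fun x => braket (f x) (g x) := by
  unfold PonzanoRegge.braket
  exact (((continuous_apply 0).comp hf).star.mul ((continuous_apply 0).comp hg)).add
    (((continuous_apply 1).comp hf).star.mul ((continuous_apply 1).comp hg))

theorem _root_.Continuous.dualBraket {X : Type*} [TopologicalSpace X] {f h : X → Spinor} {g : X → SU2}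
    (hf : Continuous f) (hg : Continuous g) (hh : Continuous h) :
    Continuous fun x => dualBraket (f x) (g x) (h x) :=
  (continuous_dual.comp hf).braket
    ((continuous_subtype_val.comp hg).matrix_mulVec hh)

/-! ### Diagonalisation in `SU(2)` -/

theorem star_mul_self_eq (a : ℂ) : a * star a = ((‖a‖ ^ 2 : ℝ) : ℂ) := by
  push_cast
  exact Complex.mul_conj' a

/-- Every unit spinor is the first column of an element of `SU(2)`. -/
theorem exists_SU2_col (v : Spinor) (hv : spinorNorm v = 1) :
    ∃ u : SU2, u.1 0 0 = v 0 ∧ u.1 1 0 = v 1 := by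
  have h : v 0 * star (v 0) + v 1 * star (v 1) = 1 := by
    have := spinorNorm_sq v
    rw [hv] at this
    rw [star_mul_self_eq, star_mul_self_eq, ← Complex.ofReal_add, ← this]; simp
  exact ⟨SU2.mk (v 0) (v 1) h, by simp [SU2.mk], by simp [SU2.mk]⟩

/-- Every element of `SU(2)` is conjugate, within `SU(2)`, to a diagonal one. -/
theorem SU2.exists_conj_diagonal (g : SU2) : ∃ u : SU2, (u⁻¹ * g * u).1 1 0 = 0 := by
  obtain ⟨c, hc⟩ := Module.End.exists_eigenvalue (K := ℂ) (V := Fin 2 → ℂ) (Matrix.toLin' g.1)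
  obtain ⟨v, hv⟩ := hc.exists_hasEigenvector
  have hv0 : spinorNorm v ≠ 0 := by
    intro h0
    have h1 := spinorNorm_sq v
    rw [h0] at h1
    apply hv.2
    have h2 : ‖v 0‖ ^ 2 = 0 := by nlinarith [sq_nonneg ‖v 0‖, sq_nonneg ‖v 1‖]
    have h3 : ‖v 1‖ ^ 2 = 0 := by nlinarith [sq_nonneg ‖v 0‖, sq_nonneg ‖v 1‖]
    ext i
    fin_cases i
    · simpa using h2
    · simpa using h3
  set w : Spinor := ((spinorNorm v : ℂ)⁻¹) • v with hw
  have hw1 : spinorNorm w = 1 := by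
    have h : spinorNorm w ^ 2 = 1 := by
      rw [spinorNorm_sq, hw]
      simp only [Pi.smul_apply, smul_eq_mul, norm_mul, mul_pow, norm_inv, Complex.norm_real,
        Real.norm_eq_abs, abs_of_nonneg (spinorNorm_nonneg v)]
      rw [← mul_add, ← spinorNorm_sq, inv_pow, inv_mul_cancel₀ (pow_ne_zero 2 hv0)]
    exact (pow_eq_one_iff_of_nonneg (spinorNorm_nonneg _) two_ne_zero).1 h
  have hgw : g.1.mulVec w = c • w := by
    have := hv.apply_eq_smul
    rw [Matrix.toLin'_apply] at this
    rw [hw, Matrix.mulVec_smul, this, smul_comm]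
  obtain ⟨u, hu0, hu1⟩ := exists_SU2_col w hw1
  refine ⟨u, ?_⟩
  change ((star u.1) * g.1 * u.1) 1 0 = 0
  have e0 := congrFun hgw 0
  have e1 := congrFun hgw 1
  simp only [Matrix.mulVec, dotProduct, Fin.sum_univ_two, Pi.smul_apply, smul_eq_mul, ← hu0,
    ← hu1] at e0 e1
  rw [mul_assoc, Matrix.mul_apply, Fin.sum_univ_two, Matrix.mul_apply, Matrix.mul_apply,
    Fin.sum_univ_two, Fin.sum_univ_two, e0, e1, Matrix.star_apply, Matrix.star_apply,
    u.apply_zero_one, u.apply_one_one]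
  simp; ring

end PonzanoRegge

namespace PonzanoRegge

/-! ### Gaussian integrals over spinors -/

/-- Integrals against `spinorMeasure` of a product of functions of the two components. -/
theorem integral_spinorMeasure_mul (f₀ f₁ : ℂ → ℂ) :
    ∫ z, f₀ (z 0) * f₁ (z 1) ∂spinorMeasure =
      ((Real.pi : ℂ)⁻¹ * ∫ z : ℂ, Complex.exp (-(‖z‖ : ℂ) ^ 2) * f₀ z) *
        ((Real.pi : ℂ)⁻¹ * ∫ z : ℂ, Complex.exp (-(‖z‖ : ℂ) ^ 2) * f₁ z) := by
  rw [spinorMeasure, integral_withDensity_eq_integral_toReal_smul (by fun_prop)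
    (Eventually.of_forall fun _ => ENNReal.ofReal_lt_top)]
  have h := integral_fintype_prod_volume_eq_prod (ι := Fin 2) (𝕜 := ℂ)
    (fun i z => Complex.exp (-(‖z‖ : ℂ) ^ 2) * (![f₀, f₁] i) z)
  simp only [Fin.prod_univ_two, Matrix.cons_val_zero, Matrix.cons_val_one] at h
  have h2 : ∀ z : Spinor, (ENNReal.ofReal
      (Real.exp (-(‖z 0‖ ^ 2 + ‖z 1‖ ^ 2)) / Real.pi ^ 2)).toReal • (f₀ (z 0) * f₁ (z 1)) =
      ((Real.pi : ℂ)⁻¹) ^ 2 * (Complex.exp (-(‖z 0‖ : ℂ) ^ 2) * f₀ (z 0) *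
        (Complex.exp (-(‖z 1‖ : ℂ) ^ 2) * f₁ (z 1))) := by
    intro z
    rw [ENNReal.toReal_ofReal (by positivity), Complex.real_smul, neg_add, Real.exp_add]
    push_cast
    ring
  simp_rw [h2]
  rw [integral_const_mul, h]
  ring

theorem integrable_exp_neg_mul_norm_sq {c : ℝ} (hc : 0 < c) :
    Integrable fun z : ℂ => Real.exp (-c * ‖z‖ ^ 2) := by
  have h := GaussianFourier.integrable_cexp_neg_mul_sq_norm_add (V := ℂ) (b := (c : ℂ))
    (by simpa using hc) 0 0
  refine h.norm.congr (Eventually.of_forall fun z => ?_)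
  simp only [zero_mul, add_zero, Complex.norm_exp]
  congr 1
  simp [← Complex.ofReal_pow, ← Complex.ofReal_mul, ← Complex.ofReal_neg]

theorem integrable_exp_spinorNorm {κ : ℝ} (hκ : κ < 1) :
    Integrable (fun z => Real.exp (κ * spinorNorm z ^ 2)) spinorMeasure := by
  rw [spinorMeasure, integrable_withDensity_iff_integrable_smul' (by fun_prop)
    (Eventually.of_forall fun _ => ENNReal.ofReal_lt_top)]
  have h := Integrable.fintype_prod (ι := Fin 2) (𝕜 := ℝ) (μ := fun _ => (volume : Measure ℂ))
    (f := fun _ z => Real.exp (-(1 - κ) * ‖z‖ ^ 2))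
    fun _ => integrable_exp_neg_mul_norm_sq (sub_pos.2 hκ)
  refine (h.const_mul (Real.pi ^ 2)⁻¹).congr (Eventually.of_forall fun z => ?_)
  simp only [Fin.prod_univ_two]
  rw [ENNReal.toReal_ofReal (by positivity), spinorNorm_sq, smul_eq_mul, div_mul_eq_mul_div,
    ← Real.exp_add, ← Real.exp_add, div_eq_inv_mul]
  congr 2
  ring

theorem integral_exp_neg_norm_sq_add_linear (α β : ℂ) :
    (Real.pi : ℂ)⁻¹ * ∫ z : ℂ, Complex.exp (-(‖z‖ : ℂ) ^ 2) * Complex.exp (α * z + β * conj z) =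
      Complex.exp (α * β) := by
  have hmp := Complex.volume_preserving_equiv_real_prod.symm
  rw [← hmp.integral_comp Complex.measurableEquivRealProd.symm.measurableEmbedding]
  have h : ∀ p : ℝ × ℝ, Complex.exp (-(‖Complex.measurableEquivRealProd.symm p‖ : ℂ) ^ 2) *
      Complex.exp (α * Complex.measurableEquivRealProd.symm p +
        β * conj (Complex.measurableEquivRealProd.symm p)) =
      Complex.exp ((-1) * (p.1 : ℂ) ^ 2 + (α + β) * p.1 + 0) *
        Complex.exp ((-1) * (p.2 : ℂ) ^ 2 + (Complex.I * (α - β)) * p.2 + 0) := by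
    intro p
    have hz : Complex.measurableEquivRealProd.symm p = p.1 + p.2 * Complex.I := by
      rw [Complex.measurableEquivRealProd_symm_apply, Complex.mk_eq_add_mul_I]
    rw [← Complex.mul_conj', hz, ← Complex.exp_add, ← Complex.exp_add]
    congr 1
    simp only [map_add, map_mul, Complex.conj_ofReal, Complex.conj_I]
    linear_combination (p.2 : ℂ) ^ 2 * Complex.I_sq
  simp_rw [h]
  rw [Measure.volume_eq_prod, integral_prod_mul
      (fun x : ℝ => Complex.exp ((-1) * (x : ℂ) ^ 2 + (α + β) * x + 0))
      (fun y : ℝ => Complex.exp ((-1) * (y : ℂ) ^ 2 + (Complex.I * (α - β)) * y + 0)),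
    integral_cexp_quadratic (by simp), integral_cexp_quadratic (by simp)]
  have hpi : (Real.pi : ℂ) ≠ 0 := by exact_mod_cast Real.pi_ne_zero
  have h2 : ((Real.pi : ℂ) / -(-1)) ^ (1 / 2 : ℂ) * ((Real.pi : ℂ) / -(-1)) ^ (1 / 2 : ℂ) =
      Real.pi := by
    rw [← Complex.cpow_add _ _ (by simp)]
    norm_num
  calc _ = (Real.pi : ℂ)⁻¹ * (((Real.pi : ℂ) / -(-1)) ^ (1 / 2 : ℂ) *
        ((Real.pi : ℂ) / -(-1)) ^ (1 / 2 : ℂ)) *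
        (Complex.exp (0 - (α + β) ^ 2 / (4 * -1)) *
          Complex.exp (0 - (Complex.I * (α - β)) ^ 2 / (4 * -1))) := by ring
    _ = _ := by
      rw [h2, inv_mul_cancel₀ hpi, one_mul, ← Complex.exp_add]
      congr 1
      linear_combination (α - β) ^ 2 / 4 * Complex.I_sq

/-- The reproducing property of the coherent states: a Gaussian integral of an exponential that is
linear in `z` and `conj z`. -/
theorem integral_exp_linear (u v : Fin 2 → ℂ) :
    ∫ z, Complex.exp (u 0 * z 0 + u 1 * z 1 + (v 0 * conj (z 0) + v 1 * conj (z 1))) ∂spinorMeasure =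
      Complex.exp (u 0 * v 0 + u 1 * v 1) := by
  have h := integral_spinorMeasure_mul (fun z => Complex.exp (u 0 * z + v 0 * conj z))
    (fun z => Complex.exp (u 1 * z + v 1 * conj z))
  rw [integral_exp_neg_norm_sq_add_linear, integral_exp_neg_norm_sq_add_linear] at h
  rw [Complex.exp_add, ← h]
  congr 1
  ext z
  rw [← Complex.exp_add]
  congr 1
  ring

instance : IsProbabilityMeasure spinorMeasure := by
  have hint : Integrable (fun _ : Spinor => (1 : ℝ)) spinorMeasure := by
    simpa using integrable_exp_spinorNorm (κ := 0) one_pos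
  have hfin : IsFiniteMeasure spinorMeasure := by
    simpa using (integrable_const_iff (c := (1 : ℝ))).1 hint
  have h := integral_exp_linear 0 0
  simp only [Pi.zero_apply, zero_mul, add_zero, Complex.exp_zero, integral_const, Complex.real_smul,
    mul_one] at h
  have h1 : spinorMeasure.real Set.univ = 1 := by exact_mod_cast h
  exact ⟨by rw [← ENNReal.ofReal_one, ← h1, ofReal_measureReal]⟩

/-- Domination by a Gaussian of strictly smaller rate gives integrability. -/
theorem integrable_of_norm_le_exp {f : Spinor → ℂ} (hf : Continuous f) {κ C : ℝ} (hκ : κ < 1)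
    (h : ∀ z, ‖f z‖ ≤ C * Real.exp (κ * spinorNorm z ^ 2)) : Integrable f spinorMeasure :=
  ((integrable_exp_spinorNorm hκ).const_mul C).mono' hf.aestronglyMeasurable
    (Eventually.of_forall h)

/-! #### Invariance under `SU(2)` -/

theorem measurePreserving_mulVec (g : SU2) :
    MeasurePreserving (fun z : Spinor => g.1.mulVec z) volume volume := by
  have hdet : LinearMap.det ((Matrix.toLin' g.1).restrictScalars ℝ) = 1 := by
    rw [LinearMap.det_restrictScalars, LinearMap.det_toLin', g.det_coe, map_one]
  have hc : Continuous fun z : Spinor => g.1.mulVec z := continuous_const.matrix_mulVec continuous_id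
  refine ⟨hc.measurable, ?_⟩
  have h := Measure.map_linearMap_addHaar_eq_smul_addHaar (volume : Measure Spinor)
    (f := (Matrix.toLin' g.1).restrictScalars ℝ) (by rw [hdet]; exact one_ne_zero)
  rw [hdet] at h
  simp only [inv_one, abs_one, ENNReal.ofReal_one, one_smul] at h
  exact h

theorem integral_comp_mulVec (g : SU2) (f : Spinor → ℂ) :
    ∫ z, f (g.1.mulVec z) ∂spinorMeasure = ∫ z, f z ∂spinorMeasure := by
  have hc : Continuous fun z : Spinor => g.1.mulVec z := continuous_const.matrix_mulVec continuous_id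
  have hinj : Function.Injective fun z : Spinor => g.1.mulVec z :=
    Matrix.mulVec_injective_of_isUnit
      ((Matrix.isUnit_iff_isUnit_det _).2 (by rw [g.det_coe]; exact isUnit_one))
  rw [spinorMeasure, integral_withDensity_eq_integral_toReal_smul (by fun_prop)
    (Eventually.of_forall fun _ => ENNReal.ofReal_lt_top),
    integral_withDensity_eq_integral_toReal_smul (by fun_prop)
    (Eventually.of_forall fun _ => ENNReal.ofReal_lt_top),
    
    ← (measurePreserving_mulVec g).integral_comp (hc.measurableEmbedding hinj) fun z =>
      (ENNReal.ofReal (Real.exp (-(‖z 0‖ ^ 2 + ‖z 1‖ ^ 2)) / Real.pi ^ 2)).toReal • f z]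
  congr 1
  ext z
  rw [← spinorNorm_sq, ← spinorNorm_sq, spinorNorm_mulVec]

/-! #### Gaussian integrals with a complex rate -/

theorem integral_exp_neg_norm_sq_mul_exp {a : ℂ} (ha : ‖a‖ < 1) :
    (Real.pi : ℂ)⁻¹ * ∫ z : ℂ, Complex.exp (-(‖z‖ : ℂ) ^ 2) * Complex.exp (a * (‖z‖ : ℂ) ^ 2) =
      (1 - a)⁻¹ := by
  have hre : 0 < (1 - a).re := by
    have := (Complex.abs_re_le_norm a).trans_lt ha
    simp only [Complex.sub_re, Complex.one_re]
    linarith [le_abs_self a.re]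
  have h0 : (1 - a) ≠ 0 := fun h => by rw [h] at hre; simp at hre
  have h := integral_fun_norm_addHaar (volume : Measure ℂ)
    (fun x : ℝ => Complex.exp (-(x : ℂ) ^ 2) * Complex.exp (a * (x : ℂ) ^ 2))
  rw [h]
  have h2 : ∀ y : ℝ, y ^ (Module.finrank ℝ ℂ - 1) •
      (Complex.exp (-(y : ℂ) ^ 2) * Complex.exp (a * (y : ℂ) ^ 2)) =
      (y : ℂ) * Complex.exp (-(1 - a) * (y : ℂ) ^ 2) := by
    intro y
    rw [Complex.finrank_real_complex, ← Complex.exp_add, Complex.real_smul]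
    norm_num
    left; congr 1; ring
  simp_rw [h2]
  rw [integral_mul_cexp_neg_mul_sq hre, Complex.finrank_real_complex]
  have hpi : (Real.pi : ℂ) ≠ 0 := by exact_mod_cast Real.pi_ne_zero
  have hb : (volume : Measure ℂ).real (Metric.ball 0 1) = Real.pi := by
    simp [Measure.real, Complex.volume_ball]
  rw [hb, Complex.real_smul, nsmul_eq_mul]
  field_simp
  norm_num

theorem integral_Ioi_pow_three_mul_cexp {b : ℂ} (hb : 0 < b.re) :
    ∫ r : ℝ in Set.Ioi 0, (r : ℂ) ^ 3 * Complex.exp (-b * (r : ℂ) ^ 2) = (2 * b ^ 2)⁻¹ := by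
  have h0 : b ≠ 0 := fun h => by rw [h] at hb; simp at hb
  have hint : IntegrableOn (fun r : ℝ => (r : ℂ) ^ 3 * Complex.exp (-b * (r : ℂ) ^ 2))
      (Set.Ioi 0) := by
    have h1 : IntegrableOn (fun r : ℝ => r ^ (3 : ℝ) * Real.exp (-b.re * r ^ 2)) (Set.Ioi 0) :=
      integrableOn_rpow_mul_exp_neg_mul_sq hb (by norm_num)
    refine Integrable.mono' h1 (Continuous.aestronglyMeasurable (by fun_prop)) ?_
    refine (ae_restrict_iff' measurableSet_Ioi).2 (Eventually.of_forall fun r hr => ?_)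
    rw [norm_mul, Complex.norm_exp, norm_pow, Complex.norm_real, Real.norm_eq_abs,
      abs_of_pos hr]
    refine le_of_eq ?_
    congr 1
    · norm_cast
    · congr 1
      simp [← Complex.ofReal_pow]
  have hder : ∀ r ∈ Set.Ioi (0 : ℝ), HasDerivAt
      (fun r : ℝ => -((r : ℂ) ^ 2 / (2 * b) + (2 * b ^ 2)⁻¹) * Complex.exp (-b * (r : ℂ) ^ 2))
      ((r : ℂ) ^ 3 * Complex.exp (-b * (r : ℂ) ^ 2)) r := by
    intro r _
    have h1 : HasDerivAt (fun r : ℂ =>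
        -(r ^ 2 / (2 * b) + (2 * b ^ 2)⁻¹) * Complex.exp (-b * r ^ 2))
        (-(2 * (r : ℂ) / (2 * b)) * Complex.exp (-b * (r : ℂ) ^ 2) +
          -((r : ℂ) ^ 2 / (2 * b) + (2 * b ^ 2)⁻¹) *
            (Complex.exp (-b * (r : ℂ) ^ 2) * (-b * (2 * (r : ℂ))))) r := by
      have hp : HasDerivAt (fun r : ℂ => r ^ 2) (2 * (r : ℂ)) (r : ℂ) := by
        simpa using hasDerivAt_pow 2 (r : ℂ)
      exact (((hp.div_const _).add_const _).neg).mul ((hp.const_mul (-b)).cexp)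
    convert h1.comp_ofReal using 1
    field_simp
    ring
  have hlim : Tendsto (fun r : ℝ => -((r : ℂ) ^ 2 / (2 * b) + (2 * b ^ 2)⁻¹) *
      Complex.exp (-b * (r : ℂ) ^ 2)) atTop (𝓝 0) := by
    have hx : ∀ k : ℕ, Tendsto (fun r : ℝ => (r : ℂ) ^ k * Complex.exp (-b * (r : ℂ) ^ 2)) atTop
        (𝓝 0) := by
      intro k
      rw [tendsto_zero_iff_norm_tendsto_zero]
      have h1 := (rpow_mul_exp_neg_mul_sq_isLittleO_exp_neg hb (k : ℝ)).trans_tendsto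
        (Real.tendsto_exp_neg_atTop_nhds_zero.comp
          (tendsto_id.const_mul_atTop (by norm_num : (0 : ℝ) < 1 / 2)) |>.congr fun x => by
            simp [neg_mul])
      refine h1.congr' ?_
      filter_upwards [eventually_gt_atTop 0] with r hr
      rw [norm_mul, Complex.norm_exp, norm_pow, Complex.norm_real, Real.norm_eq_abs,
        abs_of_pos hr, Real.rpow_natCast]
      congr 2
      simp [← Complex.ofReal_pow]
    have h2 := ((hx 2).const_mul (-(2 * b)⁻¹)).add ((hx 0).const_mul (-(2 * b ^ 2)⁻¹))
    rw [mul_zero, mul_zero, add_zero] at h2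
    refine h2.congr fun r => ?_
    rw [pow_zero, div_eq_mul_inv]
    ring
  have hcont : ContinuousWithinAt (fun r : ℝ => -((r : ℂ) ^ 2 / (2 * b) + (2 * b ^ 2)⁻¹) *
      Complex.exp (-b * (r : ℂ) ^ 2)) (Set.Ici 0) 0 :=
    (Continuous.continuousAt (by fun_prop)).continuousWithinAt
  rw [integral_Ioi_of_hasDerivAt_of_tendsto hcont hder hint hlim]
  simp

theorem integral_norm_sq_mul_exp_neg_norm_sq_mul_exp {a : ℂ} (ha : ‖a‖ < 1) :
    (Real.pi : ℂ)⁻¹ * ∫ z : ℂ, Complex.exp (-(‖z‖ : ℂ) ^ 2) *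
      ((‖z‖ : ℂ) ^ 2 * Complex.exp (a * (‖z‖ : ℂ) ^ 2)) = ((1 - a) ^ 2)⁻¹ := by
  have hre : 0 < (1 - a).re := by
    have := (Complex.abs_re_le_norm a).trans_lt ha
    simp only [Complex.sub_re, Complex.one_re]
    linarith [le_abs_self a.re]
  have h0 : (1 - a) ≠ 0 := fun h => by rw [h] at hre; simp at hre
  have h := integral_fun_norm_addHaar (volume : Measure ℂ)
    (fun x : ℝ => Complex.exp (-(x : ℂ) ^ 2) * ((x : ℂ) ^ 2 * Complex.exp (a * (x : ℂ) ^ 2)))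
  rw [h]
  have h2 : ∀ y : ℝ, y ^ (Module.finrank ℝ ℂ - 1) •
      (Complex.exp (-(y : ℂ) ^ 2) * ((y : ℂ) ^ 2 * Complex.exp (a * (y : ℂ) ^ 2))) =
      (y : ℂ) ^ 3 * Complex.exp (-(1 - a) * (y : ℂ) ^ 2) := by
    intro y
    have : Complex.exp (-(1 - a) * (y : ℂ) ^ 2) =
        Complex.exp (-(y : ℂ) ^ 2) * Complex.exp (a * (y : ℂ) ^ 2) := by
      rw [← Complex.exp_add]; congr 1; ring
    rw [Complex.finrank_real_complex, Complex.real_smul, this]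
    norm_num
    ring
  simp_rw [h2]
  rw [integral_Ioi_pow_three_mul_cexp hre, Complex.finrank_real_complex]
  have hpi : (Real.pi : ℂ) ≠ 0 := by exact_mod_cast Real.pi_ne_zero
  have hb : (volume : Measure ℂ).real (Metric.ball 0 1) = Real.pi := by
    simp [Measure.real, Complex.volume_ball]
  rw [hb, Complex.real_smul, nsmul_eq_mul]
  field_simp
  norm_num

/-! #### The Gaussian integral of a closed loop -/

/-- The kernel `(1 - q²) / (1 - q τ + q²)²`, with `τ` the trace of an element of `SU(2)`: the closed
form of the damped delta distribution. -/
noncomputable def poissonKernel (q τ : ℂ) : ℂ := (1 - q ^ 2) / (1 - q * τ + q ^ 2) ^ 2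

theorem mul_exp_le_exp {x ε : ℝ} (hε : 0 < ε) : x ≤ ε⁻¹ * Real.exp (ε * x) := by
  rw [← div_le_iff₀' (by positivity), div_inv_eq_mul, mul_comm]
  linarith [Real.add_one_le_exp (ε * x)]

theorem braket_conj_mulVec (u g : SU2) (z : Spinor) :
    braket (u.1.mulVec z) (g.1.mulVec (u.1.mulVec z)) = braket z ((u⁻¹ * g * u).1.mulVec z) := by
  have h : ∀ w y : Spinor, braket (u.1.mulVec w) y = braket w ((u⁻¹).1.mulVec y) := by
    intro w y
    rw [SU2.coe_inv]
    simp only [braket, Matrix.mulVec, dotProduct, Fin.sum_univ_two, Matrix.star_apply, star_add,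
      star_mul']
    ring
  rw [h, Matrix.mulVec_mulVec, Matrix.mulVec_mulVec]
  congr 2

/-- The Gaussian integral of a closed loop with the face amplitude inserted. By invariance `g` may be
taken diagonal, and the integral then splits into one-dimensional ones. -/
theorem integral_normSq_sub_one_mul_exp (q : ℂ) (hq : ‖q‖ < 1) (g : SU2) :
    ∫ z, (braket z z - 1) * Complex.exp (q * braket z (g.1.mulVec z)) ∂spinorMeasure =
      poissonKernel q g.1.trace := by
  obtain ⟨u, hu⟩ := g.exists_conj_diagonal
  set d := u⁻¹ * g * u with hd
  set a := d.1 0 0 with ha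
  have h01 : d.1 0 1 = 0 := by rw [d.apply_zero_one, hu, star_zero, neg_zero]
  have haa : a * star a = 1 := by simpa [hu] using d.normSq_add
  have hna : ‖a‖ = 1 := by
    rw [star_mul_self_eq] at haa
    have : ‖a‖ ^ 2 = 1 := by exact_mod_cast haa
    exact (pow_eq_one_iff_of_nonneg (norm_nonneg _) two_ne_zero).1 this
  have htr : g.1.trace = a + star a := by
    have h1 : d.1.trace = g.1.trace := by
      change ((u⁻¹).1 * g.1 * u.1).trace = _
      rw [Matrix.trace_mul_comm, ← mul_assoc]
      have : u.1 * (u⁻¹).1 = 1 := congrArg Subtype.val (mul_inv_cancel u)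
      rw [this, one_mul]
    rw [← h1, Matrix.trace_fin_two, d.apply_one_one]
  rw [← integral_comp_mulVec u]
  have hbr : ∀ z : Spinor, braket (u.1.mulVec z) (u.1.mulVec z) = braket z z := by
    intro z; rw [braket_self, braket_self, spinorNorm_mulVec]
  have hbr2 : ∀ z : Spinor, braket z (d.1.mulVec z) =
      a * (‖z 0‖ : ℂ) ^ 2 + star a * (‖z 1‖ : ℂ) ^ 2 := by
    intro z
    rw [← Complex.mul_conj', ← Complex.mul_conj']
    simp only [braket, Matrix.mulVec, dotProduct, Fin.sum_univ_two, h01, hu, d.apply_one_one, ← ha]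
    simp; ring
  have hnq : ‖q * a‖ < 1 := by rwa [norm_mul, hna, mul_one]
  have hnq' : ‖q * star a‖ < 1 := by rwa [norm_mul, norm_star, hna, mul_one]
  set e₀ : ℂ → ℂ := fun z => Complex.exp (q * a * (‖z‖ : ℂ) ^ 2)
  set e₁ : ℂ → ℂ := fun z => Complex.exp (q * star a * (‖z‖ : ℂ) ^ 2)
  have hsplit : ∀ z : Spinor, (braket (u.1.mulVec z) (u.1.mulVec z) - 1) *
      Complex.exp (q * braket (u.1.mulVec z) (g.1.mulVec (u.1.mulVec z))) =
      ((‖z 0‖ : ℂ) ^ 2 * e₀ (z 0)) * e₁ (z 1) + e₀ (z 0) * ((‖z 1‖ : ℂ) ^ 2 * e₁ (z 1)) -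
        e₀ (z 0) * e₁ (z 1) := by
    intro z
    have he : e₀ (z 0) * e₁ (z 1) =
        Complex.exp (q * (a * (‖z 0‖ : ℂ) ^ 2 + star a * (‖z 1‖ : ℂ) ^ 2)) := by
      simp only [e₀, e₁]; rw [← Complex.exp_add]; congr 1; ring
    rw [hbr, braket_conj_mulVec, hbr2, ← he, braket_self, spinorNorm_sq]
    push_cast
    ring
  simp_rw [hsplit]
  have hnorm : ∀ z : Spinor, ‖e₀ (z 0) * e₁ (z 1)‖ ≤ Real.exp (‖q‖ * spinorNorm z ^ 2) := by
    intro z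
    simp only [e₀, e₁]
    rw [← Complex.exp_add, Complex.norm_exp, Real.exp_le_exp]
    refine (Complex.re_le_norm _).trans ((norm_add_le _ _).trans (le_of_eq ?_))
    simp only [norm_mul, norm_star, hna, norm_pow, Complex.norm_real, norm_norm, mul_one,
      spinorNorm_sq]
    ring
  have hc : Continuous fun z : Spinor => e₀ (z 0) * e₁ (z 1) := by fun_prop
  have hε : 0 < (1 - ‖q‖) / 2 := by linarith
  -- the face amplitude costs an arbitrarily small part of the rate of the Gaussian
  have hi : ∀ k : Fin 2, Integrable (fun z : Spinor => (‖z k‖ : ℂ) ^ 2 * (e₀ (z 0) * e₁ (z 1)))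
      spinorMeasure := by
    intro k
    refine integrable_of_norm_le_exp (by fun_prop) (κ := (1 - ‖q‖) / 2 + ‖q‖)
      (C := ((1 - ‖q‖) / 2)⁻¹) (by linarith) fun z => ?_
    rw [norm_mul, add_mul, Real.exp_add, ← mul_assoc]
    refine mul_le_mul ?_ (hnorm z) (norm_nonneg _) (by positivity)
    refine le_trans ?_ (mul_exp_le_exp hε)
    rw [spinorNorm_sq]
    simp only [norm_pow, Complex.norm_real, norm_norm]
    fin_cases k
    · exact le_add_of_nonneg_right (by positivity)
    · exact le_add_of_nonneg_left (by positivity)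
  have h0 : Integrable (fun z : Spinor => e₀ (z 0) * e₁ (z 1)) spinorMeasure :=
    integrable_of_norm_le_exp hc (C := 1) hq fun z => by simpa using hnorm z
  rw [integral_sub, integral_add,
    integral_spinorMeasure_mul (fun z => (‖z‖ : ℂ) ^ 2 * e₀ z) e₁,
    integral_spinorMeasure_mul e₀ (fun z => (‖z‖ : ℂ) ^ 2 * e₁ z), integral_spinorMeasure_mul,
    integral_norm_sq_mul_exp_neg_norm_sq_mul_exp hnq, integral_exp_neg_norm_sq_mul_exp hnq,
    integral_norm_sq_mul_exp_neg_norm_sq_mul_exp hnq', integral_exp_neg_norm_sq_mul_exp hnq']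
  · have h1 : 1 - q * a ≠ 0 := fun h => by
      rw [← sub_eq_zero.1 h, norm_one] at hnq; exact lt_irrefl _ hnq
    have h2 : 1 - q * star a ≠ 0 := fun h => by
      rw [← sub_eq_zero.1 h, norm_one] at hnq'; exact lt_irrefl _ hnq'
    have h3 : 1 - q * (a + star a) + q ^ 2 = (1 - q * a) * (1 - q * star a) := by
      linear_combination (-q ^ 2) * haa
    rw [htr, poissonKernel, h3]
    generalize star a = b at *
    field_simp
    linear_combination (-q ^ 2) * haa
  · exact (hi 0).congr (Eventually.of_forall fun z => by simp only; ring)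
  · exact (hi 1).congr (Eventually.of_forall fun z => by simp only; ring)
  · refine Integrable.add ?_ ?_
    · exact (hi 0).congr (Eventually.of_forall fun z => by simp only; ring)
    · exact (hi 1).congr (Eventually.of_forall fun z => by simp only; ring)
  · exact h0

end PonzanoRegge

namespace PonzanoRegge

/-! ### Characters of `SU(2)` and the damped delta distribution -/

/-- The columns of a Wigner matrix are the coefficients of the substituted monomials. -/
theorem sum_wigner_mul_pow (n : ℕ) (g : SU2) (l : Fin (n + 1)) (x : ℂ) :
    ∑ k : Fin (n + 1), wigner n g k l * x ^ (k : ℕ) =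
      (g.1 0 0 * x + g.1 0 1) ^ (l : ℕ) * (g.1 1 0 * x + g.1 1 1) ^ (n - (l : ℕ)) := by
  set p : Polynomial ℂ := (Polynomial.C (g.1 0 0) * Polynomial.X + Polynomial.C (g.1 0 1)) ^ (l : ℕ) *
    (Polynomial.C (g.1 1 0) * Polynomial.X + Polynomial.C (g.1 1 1)) ^ (n - (l : ℕ)) with hp
  have hdeg : p.natDegree < n + 1 := by
    refine Nat.lt_succ_of_le (Polynomial.natDegree_mul_le.trans ?_)
    refine (add_le_add (Polynomial.natDegree_pow_le_of_le _ Polynomial.natDegree_linear_le)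
      (Polynomial.natDegree_pow_le_of_le _ Polynomial.natDegree_linear_le)).trans ?_
    have := l.2
    omega
  have h := Polynomial.eval_eq_sum_range' hdeg x
  rw [Finset.sum_range] at h
  have he : p.eval x =
      (g.1 0 0 * x + g.1 0 1) ^ (l : ℕ) * (g.1 1 0 * x + g.1 1 1) ^ (n - (l : ℕ)) := by
    simp [hp]
  rw [← he, h]
  rfl

/-- Substitution reverses products. The identity of polynomials is checked at the points where the
second component of the substituted vector does not vanish. -/
theorem wigner_mul (n : ℕ) (g h : SU2) : wigner n (g * h) = wigner n h * wigner n g := by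
  ext k l
  set c := h.1 1 0
  set d := h.1 1 1
  have hcd : (Polynomial.C c * Polynomial.X + Polynomial.C d : Polynomial ℂ) ≠ 0 := by
    intro h0
    have hc : c = 0 := by simpa using congrArg (Polynomial.coeff · 1) h0
    have hd : d = 0 := by simpa using congrArg (Polynomial.coeff · 0) h0
    have := h.det_coe
    rw [Matrix.det_fin_two] at this
    change h.1 0 0 * d - h.1 0 1 * c = 1 at this
    rw [hc, hd] at this
    simp at this
  set P : Polynomial ℂ := ∑ k : Fin (n + 1),
    Polynomial.C (wigner n (g * h) k l - (wigner n h * wigner n g) k l) * Polynomial.X ^ (k : ℕ)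
    with hP
  have hroot : ∀ x, c * x + d ≠ 0 → P.eval x = 0 := by
    intro x hx
    have h1 : P.eval x = ∑ k : Fin (n + 1), wigner n (g * h) k l * x ^ (k : ℕ) -
        ∑ m : Fin (n + 1), wigner n g m l * ∑ k : Fin (n + 1), wigner n h k m * x ^ (k : ℕ) := by
      rw [hP, Polynomial.eval_finsetSum]
      simp only [Polynomial.eval_mul, Polynomial.eval_C, Polynomial.eval_pow, Polynomial.eval_X,
        sub_mul, Finset.sum_sub_distrib, Matrix.mul_apply, Finset.mul_sum, Finset.sum_mul]
      congr 1
      rw [Finset.sum_comm]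
      exact Finset.sum_congr rfl fun _ _ => Finset.sum_congr rfl fun _ _ => by ring
    set s := c * x + d with hs
    set y := (h.1 0 0 * x + h.1 0 1) / s with hy
    have hys : h.1 0 0 * x + h.1 0 1 = y * s := by rw [hy, div_mul_cancel₀ _ hx]
    have h2 : ∀ m : Fin (n + 1), ∑ k : Fin (n + 1), wigner n h k m * x ^ (k : ℕ) =
        s ^ n * y ^ (m : ℕ) := by
      intro m
      rw [sum_wigner_mul_pow, hys, mul_pow, mul_assoc]
      change y ^ (m : ℕ) * (s ^ (m : ℕ) * s ^ (n - (m : ℕ))) = _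
      rw [← pow_add, Nat.add_sub_cancel' (Nat.lt_succ_iff.1 m.2), mul_comm]
    simp_rw [h1, h2]
    have h3 : ∑ m : Fin (n + 1), wigner n g m l * (s ^ n * y ^ (m : ℕ)) =
        s ^ n * ((g.1 0 0 * y + g.1 0 1) ^ (l : ℕ) * (g.1 1 0 * y + g.1 1 1) ^ (n - (l : ℕ))) := by
      rw [← sum_wigner_mul_pow, Finset.mul_sum]
      exact Finset.sum_congr rfl fun _ _ => by ring
    rw [h3, sum_wigner_mul_pow]
    have e : ∀ i : Fin 2, (g * h).1 i 0 * x + (g * h).1 i 1 = (g.1 i 0 * y + g.1 i 1) * s := by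
      intro i
      have m1 : ∀ j, (g * h).1 i j = g.1 i 0 * h.1 0 j + g.1 i 1 * h.1 1 j := by
        intro j
        change (g.1 * h.1) i j = _
        rw [Matrix.mul_apply, Fin.sum_univ_two]
      have hs' : h.1 1 0 * x + h.1 1 1 = s := rfl
      rw [m1, m1]
      linear_combination g.1 i 0 * hys + g.1 i 1 * hs'
    rw [e, e, mul_pow, mul_pow]
    have hpow : s ^ (l : ℕ) * s ^ (n - (l : ℕ)) = s ^ n := by
      rw [← pow_add, Nat.add_sub_cancel' (Nat.lt_succ_iff.1 l.2)]
    linear_combination (g.1 0 0 * y + g.1 0 1) ^ (l : ℕ) *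
      (g.1 1 0 * y + g.1 1 1) ^ (n - (l : ℕ)) * hpow
  have hP0 : P * (Polynomial.C c * Polynomial.X + Polynomial.C d) = 0 := by
    refine Polynomial.funext fun x => ?_
    by_cases hx : c * x + d = 0
    · simp [hx]
    · simp [hroot x hx]
  have hP1 : P = 0 := (mul_eq_zero.1 hP0).resolve_right hcd
  have hcoef : P.coeff k = wigner n (g * h) k l - (wigner n h * wigner n g) k l := by
    rw [hP, Polynomial.finsetSum_coeff]
    simp only [Polynomial.coeff_C_mul_X_pow]
    rw [Finset.sum_eq_single k]
    · simp
    · intro b _ hb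
      rw [if_neg fun h => hb (Fin.ext h.symm)]
    · simp
  rw [hP1, Polynomial.coeff_zero] at hcoef
  exact (sub_eq_zero.1 hcoef.symm)

theorem wigner_one (n : ℕ) : wigner n 1 = 1 := by
  ext k l
  simp only [wigner, OneMemClass.coe_one, Matrix.one_apply_eq, map_one, one_mul, ne_eq,
    Fin.isValue, zero_ne_one, not_false_eq_true, Matrix.one_apply_ne, map_zero, add_zero,
    one_ne_zero, zero_mul, zero_add, one_pow, mul_one, Polynomial.coeff_X_pow]
  rw [Matrix.one_apply]
  simp only [Fin.ext_iff]

theorem character_conj (n : ℕ) (u g : SU2) : character n (u⁻¹ * g * u) = character n g := by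
  rw [character, wigner_mul, wigner_mul, Matrix.trace_mul_comm, mul_assoc, ← wigner_mul,
    mul_inv_cancel, wigner_one, mul_one, character]

theorem character_of_diagonal (n : ℕ) (g : SU2) (h : g.1 1 0 = 0) :
    character n g = ∑ l ∈ Finset.range (n + 1), g.1 0 0 ^ l * star (g.1 0 0) ^ (n - l) := by
  rw [Finset.sum_range, character, Matrix.trace]
  refine Finset.sum_congr rfl fun l _ => ?_
  rw [Matrix.diag_apply, wigner, g.apply_zero_one, h, g.apply_one_one, star_zero, neg_zero,
    map_zero, add_zero, zero_mul, zero_add, ← Polynomial.C_pow, mul_pow, mul_right_comm,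
    ← Polynomial.C_pow, ← Polynomial.C_mul, Polynomial.coeff_C_mul_X_pow, if_pos rfl]

/-- The data of an eigenvalue `a` of `g`, in terms of which all characters are given by geometric
sums. -/
theorem exists_character_eq (g : SU2) : ∃ a : ℂ, ‖a‖ = 1 ∧ a * star a = 1 ∧
    g.1.trace = a + star a ∧
    ∀ n, character n g = ∑ l ∈ Finset.range (n + 1), a ^ l * star a ^ (n - l) := by
  obtain ⟨u, hu⟩ := g.exists_conj_diagonal
  set d := u⁻¹ * g * u with hd
  have haa : d.1 0 0 * star (d.1 0 0) = 1 := by simpa [hu] using d.normSq_add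
  refine ⟨d.1 0 0, ?_, haa, ?_, fun n => ?_⟩
  · rw [star_mul_self_eq] at haa
    have : ‖d.1 0 0‖ ^ 2 = 1 := by exact_mod_cast haa
    exact (pow_eq_one_iff_of_nonneg (norm_nonneg _) two_ne_zero).1 this
  · have h1 : d.1.trace = g.1.trace := by
      change ((u⁻¹).1 * g.1 * u.1).trace = _
      rw [Matrix.trace_mul_comm, ← mul_assoc]
      have : u.1 * (u⁻¹).1 = 1 := congrArg Subtype.val (mul_inv_cancel u)
      rw [this, one_mul]
    rw [← h1, Matrix.trace_fin_two, d.apply_one_one]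
  · rw [← character_of_diagonal n d hu, hd, character_conj]

theorem norm_character_le (n : ℕ) (g : SU2) : ‖character n g‖ ≤ n + 1 := by
  obtain ⟨a, ha, -, -, h⟩ := exists_character_eq g
  rw [h]
  refine (norm_sum_le _ _).trans ?_
  simp [ha]

theorem character_zero (g : SU2) : character 0 g = 1 := by
  obtain ⟨a, ha, -, -, h⟩ := exists_character_eq g
  simp [h]

theorem character_one (g : SU2) : character 1 g = g.1.trace := by
  obtain ⟨a, -, -, ht, h⟩ := exists_character_eq g
  simp [h, ht, Finset.sum_range_succ, add_comm]

theorem character_add_two (n : ℕ) (g : SU2) :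
    character (n + 2) g = g.1.trace * character (n + 1) g - character n g := by
  obtain ⟨a, -, ha, ht, h⟩ := exists_character_eq g
  have hs : ∀ m, character (m + 1) g = a * character m g + star a ^ (m + 1) := by
    intro m
    rw [h, h, Finset.sum_range_succ', Finset.mul_sum]
    simp only [Nat.add_sub_add_right, pow_zero, one_mul, Nat.sub_zero]
    congr 1
    exact Finset.sum_congr rfl fun _ _ => by ring
  rw [hs (n + 1), hs n, ht]
  linear_combination (-character n g) * ha

theorem summable_damped {q : ℂ} (hq : ‖q‖ < 1) (g : SU2) :
    Summable fun n : ℕ => q ^ n * ((n : ℂ) + 1) * character n g := by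
  have h1 : Summable fun n : ℕ => (n + 1 : ℝ) ^ 2 * ‖q‖ ^ n := by
    have hq' : ‖(‖q‖ : ℝ)‖ < 1 := by simpa using hq
    have a2 := summable_pow_mul_geometric_of_norm_lt_one 2 hq'
    have a1 := summable_pow_mul_geometric_of_norm_lt_one 1 hq'
    have a0 := summable_pow_mul_geometric_of_norm_lt_one 0 hq'
    refine ((a2.add (a1.mul_left 2)).add a0).congr fun n => ?_
    ring
  refine Summable.of_norm_bounded h1 fun n => ?_
  rw [norm_mul, norm_mul, norm_pow]
  have h2 : ‖((n : ℂ) + 1)‖ = n + 1 := by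
    rw [← Nat.cast_succ, Complex.norm_natCast]; push_cast; ring
  rw [h2]
  calc ‖q‖ ^ n * (n + 1) * ‖character n g‖ ≤ ‖q‖ ^ n * (n + 1) * (n + 1) := by
        gcongr; exact norm_character_le n g
    _ = _ := by ring

theorem summable_geometric_character {q : ℂ} (hq : ‖q‖ < 1) (g : SU2) :
    Summable fun n : ℕ => q ^ n * character n g := by
  refine Summable.of_norm_bounded (summable_damped hq g).norm fun n => ?_
  rw [norm_mul, norm_mul, norm_mul]
  refine mul_le_mul_of_nonneg_right (le_mul_of_one_le_right (norm_nonneg _) ?_) (norm_nonneg _)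
  rw [← Nat.cast_succ, Complex.norm_natCast]
  exact_mod_cast Nat.succ_le_succ (Nat.zero_le n)

theorem one_sub_mul_trace_ne_zero {q : ℂ} (hq : ‖q‖ < 1) (g : SU2) :
    1 - q * g.1.trace + q ^ 2 ≠ 0 := by
  obtain ⟨a, hna, ha, ht, -⟩ := exists_character_eq g
  have h3 : 1 - q * g.1.trace + q ^ 2 = (1 - q * a) * (1 - q * star a) := by
    rw [ht]; linear_combination (-q ^ 2) * ha
  have key : ∀ b : ℂ, ‖b‖ = 1 → 1 - q * b ≠ 0 := by
    intro b hb h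
    have : ‖q * b‖ < 1 := by rwa [norm_mul, hb, mul_one]
    rw [← sub_eq_zero.1 h, norm_one] at this
    exact lt_irrefl _ this
  rw [h3]
  exact mul_ne_zero (key a hna) (key _ (by rwa [norm_star]))

/-- The damped delta distribution in closed form. The three-term recurrence of the characters gives
linear equations for the generating functions `∑ qⁿ χ` and `∑ (n + 1) qⁿ χ`. -/
theorem tsum_damped_eq_poissonKernel {q : ℂ} (hq : ‖q‖ < 1) (g : SU2) :
    ∑' n : ℕ, q ^ n * ((n : ℂ) + 1) * character n g = poissonKernel q g.1.trace := by
  have hS := summable_damped hq g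
  have hF := summable_geometric_character hq g
  set f : ℕ → ℂ := fun n => q ^ n * ((n : ℂ) + 1) * character n g with hf
  set t : ℕ → ℂ := fun n => q ^ n * character n g with ht
  set τ := g.1.trace with hτ
  have t0 : t 0 = 1 := by simp [ht, character_zero]
  have t1 : t 1 = q * τ := by simp [ht, character_one, hτ]
  have f0 : f 0 = 1 := by simp [hf, character_zero]
  have f1 : f 1 = 2 * (q * τ) := by simp [hf, character_one, hτ]; ring
  have rt : ∀ n, t (n + 2) = q * τ * t (n + 1) - q ^ 2 * t n := by
    intro n; simp only [ht, character_add_two]; ring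
  have rf : ∀ n, f (n + 2) =
      q * τ * (f (n + 1) + t (n + 1)) - q ^ 2 * (f n + 2 * t n) := by
    intro n; simp only [hf, ht, character_add_two]; push_cast; ring
  have sF1 : ∑' n, t n = t 0 + ∑' n, t (n + 1) := hF.tsum_eq_zero_add
  have hF1 := (summable_nat_add_iff 1).2 hF
  have hS1 := (summable_nat_add_iff 1).2 hS
  have sF2 : ∑' n, t (n + 1) = t 1 + ∑' n, t (n + 2) := hF1.tsum_eq_zero_add
  have sS1 : ∑' n, f n = f 0 + ∑' n, f (n + 1) := hS.tsum_eq_zero_add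
  have sS2 : ∑' n, f (n + 1) = f 1 + ∑' n, f (n + 2) := hS1.tsum_eq_zero_add
  have eF : ∑' n, t (n + 2) = q * τ * ∑' n, t (n + 1) - q ^ 2 * ∑' n, t n := by
    simp_rw [rt]
    rw [(hF1.mul_left _).tsum_sub (hF.mul_left _), tsum_mul_left, tsum_mul_left]
  have eS : ∑' n, f (n + 2) = q * τ * (∑' n, f (n + 1) + ∑' n, t (n + 1)) -
      q ^ 2 * (∑' n, f n + 2 * ∑' n, t n) := by
    simp_rw [rf]
    rw [((hS1.add hF1).mul_left _).tsum_sub ((hS.add (hF.mul_left 2)).mul_left _), tsum_mul_left,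
      tsum_mul_left, hS1.tsum_add hF1, hS.tsum_add (hF.mul_left 2), tsum_mul_left]
  set S := ∑' n, f n
  set F := ∑' n, t n
  have d0 := one_sub_mul_trace_ne_zero hq g
  rw [← hτ] at d0
  have hFeq : (1 - q * τ + q ^ 2) * F = 1 := by
    rw [t0] at sF1; rw [t1] at sF2
    linear_combination (1 - q * τ) * sF1 + sF2 + eF
  have hSeq : (1 - q * τ + q ^ 2) * S = (1 - q ^ 2) * F := by
    rw [t0] at sF1; rw [f0] at sS1; rw [f1] at sS2
    linear_combination (1 - q * τ) * sS1 + sS2 + eS - q * τ * sF1 - hFeq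
  rw [poissonKernel, eq_div_iff (pow_ne_zero 2 d0)]
  linear_combination (1 - q * τ + q ^ 2) * hSeq + (1 - q ^ 2) * hFeq

theorem deltaKernel_eq {q : ℝ} (hq : |q| < 1) (g : SU2) :
    deltaKernel q g = poissonKernel q g.1.trace :=
  tsum_damped_eq_poissonKernel (by simpa using hq) g

theorem continuous_trace : Continuous fun g : SU2 => g.1.trace :=
  Continuous.matrix_trace continuous_subtype_val

theorem continuous_deltaKernel {q : ℝ} (hq : |q| < 1) : Continuous (deltaKernel q) := by
  have h : deltaKernel q = fun g => poissonKernel q g.1.trace := funext fun g => deltaKernel_eq hq g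
  rw [h]
  refine Continuous.div continuous_const ?_ fun g =>
    pow_ne_zero 2 (one_sub_mul_trace_ne_zero (by simpa using hq) g)
  exact ((continuous_const.sub (continuous_const.mul continuous_trace)).add continuous_const).pow 2

/-! #### Total mass of the damped delta distribution -/

/-- The matrix element `⟨b|g|b⟩ⁿ` has no invariant part for `n ≠ 0`. -/
theorem integral_braket_pow (n : ℕ) (hn : n ≠ 0) (b : Spinor) :
    ∫ g : SU2, braket b (g.1.mulVec b) ^ n ∂haar = 0 := by
  have hcoe : ∀ u v : SU2, (u * v).1 = u.1 * v.1 := fun _ _ => rfl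
  by_cases hb : spinorNorm b = 0
  · have : ∀ g : SU2, braket b (g.1.mulVec b) ^ n = 0 := by
      intro g
      refine pow_eq_zero_iff hn |>.2 (norm_le_zero_iff.1 ((norm_braket_le _ _).trans ?_))
      rw [hb, zero_mul]
    simp only [this, integral_zero]
  -- a first translation turns the bracket into the first component of `g b`
  set w : Spinor := ((spinorNorm b : ℂ)⁻¹) • b with hw
  have hw1 : spinorNorm w = 1 := by
    have h : spinorNorm w ^ 2 = 1 := by
      rw [spinorNorm_sq, hw]
      simp only [Pi.smul_apply, smul_eq_mul, norm_mul, mul_pow, norm_inv, Complex.norm_real,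
        Real.norm_eq_abs, abs_of_nonneg (spinorNorm_nonneg b)]
      rw [← mul_add, ← spinorNorm_sq, inv_pow, inv_mul_cancel₀ (pow_ne_zero 2 hb)]
    exact (pow_eq_one_iff_of_nonneg (spinorNorm_nonneg _) two_ne_zero).1 h
  obtain ⟨u, hu0, hu1⟩ := exists_SU2_col w hw1
  have hbC : (spinorNorm b : ℂ) ≠ 0 := by exact_mod_cast hb
  have h1 : ∀ g : SU2, braket b ((u * g).1.mulVec b) = spinorNorm b * (g.1.mulVec b) 0 := by
    intro g
    have hself := braket_self b
    rw [hcoe, ← Matrix.mulVec_mulVec]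
    set y := g.1.mulVec b
    simp only [braket, Matrix.mulVec, dotProduct, Fin.sum_univ_two, u.apply_zero_one,
      u.apply_one_one, hu0, hu1, hw, Pi.smul_apply, smul_eq_mul, star_mul', star_inv₀] at hself ⊢
    have hr : star (spinorNorm b : ℂ) = spinorNorm b := Complex.conj_ofReal _
    rw [hr]
    push_cast at hself
    field_simp
    linear_combination y 0 * hself
  rw [← integral_mul_left_eq_self _ u]
  simp_rw [h1]
  -- a second translation multiplies it by a phase
  set ω : ℂ := Complex.exp ((Real.pi / n : ℝ) * Complex.I) with hω
  have hωn : ω ^ n = -1 := by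
    rw [hω, ← Complex.exp_nat_mul, ← Complex.exp_pi_mul_I]
    congr 1
    push_cast
    field_simp
  have hωω : ω * star ω + 0 * star 0 = 1 := by
    rw [star_mul_self_eq, hω, Complex.norm_exp_ofReal_mul_I]; simp
  have h2 : ∀ g : SU2, ((SU2.mk ω 0 hωω * g).1.mulVec b) 0 = ω * (g.1.mulVec b) 0 := by
    intro g
    rw [hcoe, ← Matrix.mulVec_mulVec]
    set y := g.1.mulVec b
    simp [SU2.mk, Matrix.mulVec, dotProduct, Fin.sum_univ_two]
  have h3 := integral_mul_left_eq_self (μ := haar)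
    (fun g : SU2 => ((spinorNorm b : ℂ) * (g.1.mulVec b) 0) ^ n) (SU2.mk ω 0 hωω)
  simp_rw [h2, mul_left_comm _ ω, mul_pow ω, hωn] at h3
  rw [integral_const_mul] at h3
  linear_combination (-1 / 2 : ℂ) * h3

theorem continuous_braket_mulVec_left (b : Spinor) :
    Continuous fun g : SU2 => braket b (g.1.mulVec b) :=
  continuous_const.braket (continuous_subtype_val.matrix_mulVec continuous_const)

theorem norm_braket_mulVec_le (g : SU2) (b : Spinor) :
    ‖braket b (g.1.mulVec b)‖ ≤ spinorNorm b ^ 2 := by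
  refine (norm_braket_le _ _).trans (le_of_eq ?_)
  rw [spinorNorm_mulVec, sq]

theorem integrable_haar_of_continuous {E : Type*} [NormedAddCommGroup E]
    {f : SU2 → E} (hf : Continuous f) : Integrable f haar :=
  hf.integrable_of_hasCompactSupport (HasCompactSupport.of_compactSpace f)

theorem integral_exp_braket (q : ℂ) (b : Spinor) :
    ∫ g : SU2, Complex.exp (q * braket b (g.1.mulVec b)) ∂haar = 1 := by
  have h := hasSum_integral_of_summable_integral_norm (μ := haar)
    (F := fun (n : ℕ) (g : SU2) => (q * braket b (g.1.mulVec b)) ^ n / (n.factorial : ℂ))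
    (fun n => integrable_haar_of_continuous
      (((continuous_const.mul (continuous_braket_mulVec_left b)).pow n).div_const _)) ?_
  · have h0 : ∀ n : ℕ, ∫ g : SU2, (q * braket b (g.1.mulVec b)) ^ n / (n.factorial : ℂ) ∂haar =
        if n = 0 then 1 else 0 := by
      intro n
      split_ifs with hn
      · subst hn; simp
      · simp_rw [mul_pow]
        rw [integral_div, integral_const_mul, integral_braket_pow n hn]
        simp
    simp_rw [h0] at h
    have h1 := h.unique (hasSum_ite_eq 0 (1 : ℂ))
    rw [← h1]
    congr 1
    ext g
    rw [Complex.exp_eq_exp_ℂ, NormedSpace.exp_eq_tsum_div]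
  · refine Summable.of_nonneg_of_le (fun n => by positivity) (fun n => ?_)
      (Real.summable_pow_div_factorial (‖q‖ * spinorNorm b ^ 2))
    have hb : ∀ g : SU2, ‖(q * braket b (g.1.mulVec b)) ^ n / (n.factorial : ℂ)‖ ≤
        (‖q‖ * spinorNorm b ^ 2) ^ n / n.factorial := by
      intro g
      rw [norm_div, norm_pow, norm_mul, Complex.norm_natCast]
      gcongr
      exact norm_braket_mulVec_le g b
    refine (integral_mono_of_nonneg (Eventually.of_forall fun g => norm_nonneg _)
      (integrable_const _) (Eventually.of_forall hb)).trans ?_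
    simp

/-- The kernel is the Gaussian average of `(⟨z|z⟩ - 1) exp (q ⟨z|g|z⟩)`, and the Haar integral of the
exponential is `1` for every `z`. -/
theorem integral_deltaKernel {q : ℝ} (hq : |q| < 1) : ∫ g, deltaKernel q g ∂haar = 1 := by
  have hqC : ‖(q : ℂ)‖ < 1 := by simpa using hq
  have h1 : ∀ g : SU2, deltaKernel q g =
      ∫ z, (braket z z - 1) * Complex.exp (q * braket z (g.1.mulVec z)) ∂spinorMeasure :=
    fun g => by rw [deltaKernel_eq hq, integral_normSq_sub_one_mul_exp _ hqC]
  simp_rw [h1]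
  have hcont : Continuous fun p : SU2 × Spinor =>
      (braket p.2 p.2 - 1) * Complex.exp (q * braket p.2 (p.1.1.mulVec p.2)) :=
    ((continuous_snd.braket continuous_snd).sub continuous_const).mul
      (Complex.continuous_exp.comp (continuous_const.mul (continuous_snd.braket
        ((continuous_subtype_val.comp continuous_fst).matrix_mulVec continuous_snd))))
  have hε : 0 < (1 - |q|) / 2 := by linarith
  have hint : Integrable (Function.uncurry fun (g : SU2) (z : Spinor) =>
      (braket z z - 1) * Complex.exp (q * braket z (g.1.mulVec z))) (haar.prod spinorMeasure) := by
    have hdom : Integrable (fun p : SU2 × Spinor => (1 : ℝ) * ((((1 - |q|) / 2)⁻¹ + 1) *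
        Real.exp (((1 - |q|) / 2 + |q|) * spinorNorm p.2 ^ 2))) (haar.prod spinorMeasure) :=
      Integrable.mul_prod (integrable_const 1)
        ((integrable_exp_spinorNorm (by linarith)).const_mul _)
    refine hdom.mono' hcont.aestronglyMeasurable (Eventually.of_forall fun p => ?_)
    simp only [Function.uncurry]
    rw [norm_mul, one_mul, add_mul _ |q|, Real.exp_add, ← mul_assoc]
    refine mul_le_mul ?_ ?_ (norm_nonneg _) (by positivity)
    · refine (norm_sub_le _ _).trans ?_
      rw [braket_self, norm_one, Complex.norm_real, Real.norm_of_nonneg (sq_nonneg _), add_mul,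
        one_mul]
      exact add_le_add (mul_exp_le_exp hε) (Real.one_le_exp (by positivity))
    · rw [Complex.norm_exp, Real.exp_le_exp]
      refine (Complex.re_le_norm _).trans ?_
      rw [norm_mul, Complex.norm_real, Real.norm_eq_abs]
      exact mul_le_mul_of_nonneg_left (norm_braket_mulVec_le _ _) (abs_nonneg q)
  rw [integral_integral_swap hint]
  simp_rw [integral_const_mul, integral_exp_braket]
  have h2 := integral_normSq_sub_one_mul_exp 0 (by simp) 1
  simpa [poissonKernel] using h2

/-! #### Convergence to the delta distribution -/

theorem SU2.trace_eq (g : SU2) : g.1.trace = ((2 * (g.1 0 0).re : ℝ) : ℂ) := by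
  rw [Matrix.trace_fin_two, g.apply_one_one]
  apply Complex.ext <;> simp; ring

theorem SU2.re_le_one (g : SU2) : (g.1 0 0).re ≤ 1 ∧ -1 ≤ (g.1 0 0).re := by
  have h := g.normSq_add
  rw [star_mul_self_eq, star_mul_self_eq] at h
  have h1 : ‖g.1 0 0‖ ^ 2 + ‖g.1 1 0‖ ^ 2 = 1 := by exact_mod_cast h
  have h2 : ‖g.1 0 0‖ ≤ 1 := by
    nlinarith [sq_nonneg ‖g.1 1 0‖, norm_nonneg (g.1 0 0)]
  have h3 := abs_le.1 ((Complex.abs_re_le_norm (g.1 0 0)).trans h2)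
  exact ⟨h3.2, h3.1⟩

theorem SU2.eq_one_of_re (g : SU2) (hg : (g.1 0 0).re = 1) : g = 1 := by
  have h := g.normSq_add
  rw [star_mul_self_eq, star_mul_self_eq] at h
  have h1 : ‖g.1 0 0‖ ^ 2 + ‖g.1 1 0‖ ^ 2 = 1 := by exact_mod_cast h
  have h2 : ‖g.1 0 0‖ ^ 2 = (g.1 0 0).re ^ 2 + (g.1 0 0).im ^ 2 := by
    rw [Complex.sq_norm, Complex.normSq_apply]; ring
  rw [h2, hg] at h1
  have h3 : (g.1 0 0).im ^ 2 = 0 := by nlinarith [sq_nonneg ‖g.1 1 0‖, sq_nonneg (g.1 0 0).im]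
  have h4 : ‖g.1 1 0‖ ^ 2 = 0 := by nlinarith [sq_nonneg ‖g.1 1 0‖, sq_nonneg (g.1 0 0).im]
  refine SU2.ext_col ?_ ?_
  · apply Complex.ext
    · simp [hg]
    · simpa using h3
  · simpa using h4

/-- The damped kernels form an approximate identity: they are non-negative, have total mass `1`, and
tend to zero uniformly away from the identity, where the trace is bounded away from `2`. -/
theorem tendsto_integral_deltaKernel (F : SU2 → ℂ) (hF : Continuous F) :
    Tendsto (fun q : ℝ => ∫ g, deltaKernel q g * F g ∂haar) (𝓝[<] 1) (𝓝 (F 1)) := by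
  set φ : ℝ → SU2 → ℝ := fun q g =>
    (1 - q ^ 2) / (1 - q * (2 * (g.1 0 0).re) + q ^ 2) ^ 2 with hφ
  have hφδ : ∀ q : ℝ, |q| < 1 → ∀ g, deltaKernel q g = (φ q g : ℂ) := by
    intro q hq g
    rw [deltaKernel_eq hq, SU2.trace_eq, poissonKernel]
    simp [hφ]
  have hev : ∀ᶠ q : ℝ in 𝓝[<] 1, 1 / 2 < q ∧ q < 1 :=
    (eventually_nhdsWithin_of_eventually_nhds (eventually_gt_nhds (by norm_num))).and
      self_mem_nhdsWithin
  have habs : ∀ q : ℝ, 1 / 2 < q ∧ q < 1 → |q| < 1 := fun q hq =>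
    abs_lt.2 ⟨by linarith [hq.1], hq.2⟩
  have hmain : Tendsto (fun q : ℝ => ∫ g, φ q g • F g ∂haar) (𝓝[<] 1) (𝓝 (F 1)) := by
    refine tendsto_integral_peak_smul_of_integrable_of_tendsto (x₀ := (1 : SU2)) (a := F 1)
      MeasurableSet.univ univ_mem (measure_ne_top _ _) ?_ ?_ ?_ ?_
      (integrable_haar_of_continuous hF) hF.continuousAt
    · filter_upwards [hev] with q hq g
      have : 0 ≤ 1 - q ^ 2 := by nlinarith [hq.1, hq.2]
      positivity
    -- away from the identity, the real part of the first entry is at most `1 - ε`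
    · intro U hU h1U
      have hcomp : IsCompact Uᶜ := hU.isClosed_compl.isCompact
      obtain ⟨ε, hε, hε'⟩ : ∃ ε > 0, ∀ g ∈ Uᶜ, (g.1 0 0).re ≤ 1 - ε := by
        rcases (Uᶜ).eq_empty_or_nonempty with he | hne
        · exact ⟨1, one_pos, by simp [he]⟩
        · obtain ⟨g₀, hg₀, hmax⟩ := hcomp.exists_isMaxOn hne
            (Complex.continuous_re.comp (continuous_coe_apply 0 0)).continuousOn
          refine ⟨1 - (g₀.1 0 0).re, ?_, fun g hg => ?_⟩
          · refine sub_pos.2 (lt_of_le_of_ne g₀.re_le_one.1 fun h => hg₀ ?_)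
            rw [g₀.eq_one_of_re h]; exact h1U
          · have := hmax hg
            simp only [Function.comp_def, Set.mem_ofPred_eq] at this
            linarith
      rw [Metric.tendstoUniformlyOn_iff]
      intro δ hδ
      have hlim : Tendsto (fun q : ℝ => (1 - q ^ 2) / ε ^ 2) (𝓝[<] 1) (𝓝 0) := by
        have : Tendsto (fun q : ℝ => (1 - q ^ 2) / ε ^ 2) (𝓝 1) (𝓝 ((1 - 1 ^ 2) / ε ^ 2)) :=
          Continuous.tendsto (by fun_prop) _
        simp only [one_pow, sub_self, zero_div] at this
        exact this.mono_left nhdsWithin_le_nhds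
      filter_upwards [hev, hlim.eventually (gt_mem_nhds hδ)] with q hq hqδ g hg
      have h0 : 0 ≤ 1 - q ^ 2 := by nlinarith [hq.1, hq.2]
      have hφ0 : 0 ≤ φ q g := by simp only [hφ]; positivity
      rw [Pi.zero_apply, dist_comm, Real.dist_eq, sub_zero, abs_of_nonneg hφ0]
      refine lt_of_le_of_lt ?_ hqδ
      have hden : ε ≤ 1 - q * (2 * (g.1 0 0).re) + q ^ 2 := by
        nlinarith [hε' g hg, hq.1, hq.2, sq_nonneg (1 - q)]
      simp only [hφ]
      gcongr
    · refine (tendsto_const_nhds (x := (1 : ℝ))).congr' ?_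
      filter_upwards [hev] with q hq
      have h1 := integral_deltaKernel (habs q hq)
      simp_rw [hφδ q (habs q hq)] at h1
      rw [integral_complex_ofReal] at h1
      rw [Measure.restrict_univ]
      exact_mod_cast h1.symm
    · filter_upwards [hev] with q hq
      have hc : Continuous fun g => (deltaKernel q g).re :=
        Complex.continuous_re.comp (continuous_deltaKernel (habs q hq))
      refine hc.aestronglyMeasurable.congr (Eventually.of_forall fun g => ?_)
      simp only [hφδ q (habs q hq), Complex.ofReal_re]
  refine hmain.congr' ?_
  filter_upwards [hev] with q hq
  simp_rw [hφδ q (habs q hq), Complex.real_smul]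

end PonzanoRegge

namespace PonzanoRegge

/-! ### Contraction of spinors along a dual face -/

/-- A pair of spinors: the two spinors at an interior triangle that lie on the links dual to one
edge. -/
abbrev SpinorPair : Type := Spinor × Spinor

/-- The product Gaussian measure on pairs of spinors. -/
noncomputable def pairMeasure : Measure SpinorPair := spinorMeasure.prod spinorMeasure

instance : IsProbabilityMeasure pairMeasure :=
  inferInstanceAs (IsProbabilityMeasure (spinorMeasure.prod spinorMeasure))

/-- Integration over the spinor at the end of a link, contracted with the spinor on the other side of
the triangle. -/
theorem integral_exp_dualBraket_add (c ρ D : ℂ) (a w : Spinor) (A : SU2) :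
    ∫ x, Complex.exp (c * dualBraket a A x + ρ * braket x (dual w) + D) ∂spinorMeasure =
      Complex.exp (c * ρ * dualBraket a A (dual w) + D) := by
  have h := integral_exp_linear
    ![c * (-a 1 * A.1 0 0 + a 0 * A.1 1 0), c * (-a 1 * A.1 0 1 + a 0 * A.1 1 1)]
    ![ρ * (dual w) 0, ρ * (dual w) 1]
  simp only [Complex.exp_add _ D]
  rw [integral_mul_const]
  congr 1
  convert h using 1
  · congr 1
    ext x
    congr 1
    rw [dualBraket_eq]
    simp only [braket, Matrix.mulVec, dotProduct, Fin.sum_univ_two, Matrix.cons_val_zero,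
      Matrix.cons_val_one]
    simp only [← starRingEnd_apply]
    ring
  · congr 1
    rw [dualBraket_eq]
    simp only [Matrix.mulVec, dotProduct, Fin.sum_univ_two, Matrix.cons_val_zero,
      Matrix.cons_val_one]
    ring

/-- Integration over the spinor at the beginning of a link multiplies the group elements of two
successive links. -/
theorem integral_exp_dualBraket_dual (c d : ℂ) (a y : Spinor) (A B : SU2) :
    ∫ w, Complex.exp (c * dualBraket a A (dual w) + d * dualBraket w B y) ∂spinorMeasure =
      Complex.exp (c * d * dualBraket a (A * B) y) := by
  set v := B.1.mulVec y with hv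
  have h := integral_exp_linear ![d * v 1, -(d * v 0)]
    ![c * (-a 1 * A.1 0 1 + a 0 * A.1 1 1), -(c * (-a 1 * A.1 0 0 + a 0 * A.1 1 0))]
  convert h using 1
  · congr 1
    ext w
    congr 1
    rw [dualBraket_eq, dualBraket_eq, ← hv]
    simp only [dual, Matrix.mulVec, dotProduct, Fin.sum_univ_two, Matrix.cons_val_zero,
      Matrix.cons_val_one]
    simp only [← starRingEnd_apply]
    ring
  · congr 1
    rw [dualBraket_eq]
    have hAB : (A * B).1.mulVec y = A.1.mulVec v := by
      rw [hv, Matrix.mulVec_mulVec]; rfl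
    rw [hAB]
    simp only [Matrix.mulVec, dotProduct, Fin.sum_univ_two, Matrix.cons_val_zero,
      Matrix.cons_val_one]
    ring

theorem dualBraket_dual_self (w : Spinor) (G : SU2) :
    dualBraket w G (dual w) = braket w ((G⁻¹).1.mulVec w) := by
  rw [dualBraket_eq, SU2.coe_inv]
  simp only [braket, dual, Matrix.mulVec, dotProduct, Fin.sum_univ_two, Matrix.star_apply,
    G.apply_one_one, G.apply_zero_one, Matrix.cons_val_zero, Matrix.cons_val_one, star_neg,
    star_star]
  ring

/-- Integration over the second spinor of the last pair of a closed chain. -/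
theorem integral_exp_dualBraket_self (C ρ : ℂ) (x : Spinor) (G : SU2) :
    ∫ w, Complex.exp (C * dualBraket w G x + ρ * braket x (dual w)) ∂spinorMeasure =
      Complex.exp (C * ρ * braket x (G.1.mulVec x)) := by
  set v := G.1.mulVec x with hv
  have h := integral_exp_linear ![C * v 1, -(C * v 0)]
    ![ρ * star (x 1), -(ρ * star (x 0))]
  convert h using 1
  · congr 1
    ext w
    congr 1
    rw [dualBraket_eq, ← hv, braket_dual_eq]
    simp only [Matrix.cons_val_zero, Matrix.cons_val_one]
    simp only [← starRingEnd_apply]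
    ring
  · congr 1
    simp only [braket, Matrix.cons_val_zero, Matrix.cons_val_one]
    ring

theorem SU2.trace_inv (G : SU2) : (G⁻¹).1.trace = G.1.trace := by
  have h : (G⁻¹).1 0 0 = star (G.1 0 0) := by rw [SU2.coe_inv, Matrix.star_apply]
  rw [SU2.trace_eq, SU2.trace_eq, h]
  simp

/-! #### Chains -/

section Chain

variable {n : ℕ}

/-- The sequence of pairs `p`, continued by zero. -/
noncomputable def pairExt (p : Fin n → SpinorPair) (i : ℕ) : SpinorPair :=
  if h : i < n then p ⟨i, h⟩ else 0

/-- The spinor with which the `i`-th bracket of a chain begins: the given spinor `a` for the first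
bracket, and afterwards the second spinor of the preceding pair. -/
noncomputable def chainLeft (a : Spinor) (p : Fin n → SpinorPair) (i : ℕ) : Spinor :=
  if i = 0 then a else (pairExt p (i - 1)).2

/-- The spinor with which the `i`-th bracket of a chain ends: the first spinor of the following pair,
and the given spinor `b` for the last bracket. -/
noncomputable def chainRight (b : Spinor) (p : Fin n → SpinorPair) (i : ℕ) : Spinor :=
  if i < n then (pairExt p i).1 else b

/-- The exponent `∑ cᵢ [wᵢ|Aᵢ|xᵢ⟩ + ∑ ρⱼ ⟨xⱼ|wⱼ₊₁]` of an open chain of `n` pairs `(xⱼ, wⱼ₊₁)`, which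
begins with the spinor `a = w₀` and ends with the spinor `b = xₙ`. -/
noncomputable def chainAction (c ρ : ℕ → ℂ) (A : ℕ → SU2) (a b : Spinor) (p : Fin n → SpinorPair) : ℂ :=
  ∑ i ∈ Finset.range (n + 1), c i * dualBraket (chainLeft a p i) (A i) (chainRight b p i) +
    ∑ j ∈ Finset.range n, ρ j * braket (pairExt p j).1 (dual (pairExt p j).2)

/-- The exponent of a closed chain of `n` pairs. -/
noncomputable def loopAction (c ρ : ℕ → ℂ) (A : ℕ → SU2) (p : Fin n → SpinorPair) : ℂ :=
  ∑ i ∈ Finset.range n,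
      c i * dualBraket (chainLeft (pairExt p (n - 1)).2 p i) (A i) (pairExt p i).1 +
    ∑ j ∈ Finset.range n, ρ j * braket (pairExt p j).1 (dual (pairExt p j).2)

/-- The sum of the squared norms of the spinors in a pair. -/
noncomputable def pairNormSq (x : SpinorPair) : ℝ := spinorNorm x.1 ^ 2 + spinorNorm x.2 ^ 2

theorem pairNormSq_nonneg (x : SpinorPair) : 0 ≤ pairNormSq x := by unfold pairNormSq; positivity

theorem continuous_pairExt (i : ℕ) : Continuous fun p : Fin n → SpinorPair => pairExt p i := by
  unfold pairExt
  split_ifs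
  · exact continuous_apply _
  · exact continuous_const

theorem continuous_chainLeft (i : ℕ) :
    Continuous fun q : Spinor × (Fin n → SpinorPair) => chainLeft q.1 q.2 i := by
  unfold chainLeft
  split_ifs
  · exact continuous_fst
  · exact continuous_snd.comp ((continuous_pairExt _).comp continuous_snd)

theorem continuous_chainRight (b : Spinor) (i : ℕ) :
    Continuous fun p : Fin n → SpinorPair => chainRight b p i := by
  unfold chainRight
  split_ifs
  · exact continuous_fst.comp (continuous_pairExt _)
  · exact continuous_const

theorem continuous_sum_braket_pairExt (ρ : ℕ → ℂ) : Continuous fun p : Fin n → SpinorPair =>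
    ∑ j ∈ Finset.range n, ρ j * braket (pairExt p j).1 (dual (pairExt p j).2) :=
  continuous_finsetSum _ fun j _ => continuous_const.mul
    ((continuous_fst.comp (continuous_pairExt j)).braket
      (continuous_dual.comp (continuous_snd.comp (continuous_pairExt j))))

/-- Joint continuity of the open chain in the spinors and in the group elements. -/
theorem continuous_chainAction {X : Type*} [TopologicalSpace X] (c ρ : ℕ → ℂ) {A : X → ℕ → SU2}
    (hA : ∀ i, Continuous fun x => A x i) (a b : Spinor) {p : X → Fin n → SpinorPair}
    (hp : Continuous p) : Continuous fun x => chainAction c ρ (A x) a b (p x) := by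
  refine Continuous.add ?_ ((continuous_sum_braket_pairExt ρ).comp hp)
  refine continuous_finsetSum _ fun i _ => continuous_const.mul (Continuous.dualBraket ?_ (hA i) ?_)
  · exact (continuous_chainLeft i).comp (continuous_const.prodMk hp)
  · exact (continuous_chainRight b i).comp hp

theorem continuous_loopAction {X : Type*} [TopologicalSpace X] (c ρ : ℕ → ℂ) {A : X → ℕ → SU2}
    (hA : ∀ i, Continuous fun x => A x i) {p : X → Fin n → SpinorPair}
    (hp : Continuous p) : Continuous fun x => loopAction c ρ (A x) (p x) := by
  refine Continuous.add ?_ ((continuous_sum_braket_pairExt ρ).comp hp)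
  refine continuous_finsetSum _ fun i _ => continuous_const.mul (Continuous.dualBraket ?_ (hA i) ?_)
  · exact (continuous_chainLeft i).comp
      ((continuous_snd.comp ((continuous_pairExt _).comp hp)).prodMk hp)
  · exact continuous_fst.comp ((continuous_pairExt i).comp hp)

theorem pairExt_cons_zero (x : SpinorPair) (p : Fin n → SpinorPair) :
    pairExt (Fin.cons x p : Fin (n + 1) → SpinorPair) 0 = x := by
  simp [pairExt]

theorem pairExt_cons_succ (x : SpinorPair) (p : Fin n → SpinorPair) (i : ℕ) :
    pairExt (Fin.cons x p : Fin (n + 1) → SpinorPair) (i + 1) = pairExt p i := by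
  unfold pairExt
  by_cases h : i < n
  · rw [dif_pos h, dif_pos (Nat.succ_lt_succ h)]
    exact Fin.cons_succ (α := fun _ => SpinorPair) x p ⟨i, h⟩
  · rw [dif_neg h, dif_neg fun h' => h (Nat.lt_of_succ_lt_succ h')]

theorem pairExt_snoc_of_lt (x : SpinorPair) (p : Fin n → SpinorPair) {i : ℕ} (h : i < n) :
    pairExt (Fin.snoc p x : Fin (n + 1) → SpinorPair) i = pairExt p i := by
  rw [pairExt, pairExt, dif_pos h, dif_pos (Nat.lt_succ_of_lt h)]
  exact Fin.snoc_castSucc (α := fun _ => SpinorPair) x p ⟨i, h⟩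

theorem pairExt_snoc_last (x : SpinorPair) (p : Fin n → SpinorPair) :
    pairExt (Fin.snoc p x : Fin (n + 1) → SpinorPair) n = x := by
  rw [pairExt, dif_pos (Nat.lt_succ_self n)]
  exact Fin.snoc_last (α := fun _ => SpinorPair) x p

/-- Splitting off the first pair of an open chain. -/
theorem chainAction_cons (c ρ : ℕ → ℂ) (A : ℕ → SU2) (a b : Spinor) (x : SpinorPair)
    (p : Fin n → SpinorPair) :
    chainAction c ρ A a b (Fin.cons x p : Fin (n + 1) → SpinorPair) =
      c 0 * dualBraket a (A 0) x.1 + ρ 0 * braket x.1 (dual x.2) +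
        chainAction (fun i => c (i + 1)) (fun i => ρ (i + 1)) (fun i => A (i + 1)) x.2 b p := by
  have hl : ∀ i, chainLeft a (Fin.cons x p : Fin (n + 1) → SpinorPair) (i + 1) =
      chainLeft x.2 p i := by
    intro i
    cases i with
    | zero => simp [chainLeft, pairExt_cons_zero]
    | succ i => simp [chainLeft, pairExt_cons_succ]
  have hr : ∀ i, chainRight b (Fin.cons x p : Fin (n + 1) → SpinorPair) (i + 1) =
      chainRight b p i := by
    intro i
    simp [chainRight, pairExt_cons_succ]
  have hl0 : chainLeft a (Fin.cons x p : Fin (n + 1) → SpinorPair) 0 = a := by simp [chainLeft]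
  have hr0 : chainRight b (Fin.cons x p : Fin (n + 1) → SpinorPair) 0 = x.1 := by
    simp [chainRight, pairExt_cons_zero]
  have h1 := Finset.sum_range_succ' (fun j => ρ j *
    braket (pairExt (Fin.cons x p : Fin (n + 1) → SpinorPair) j).1
      (dual (pairExt (Fin.cons x p : Fin (n + 1) → SpinorPair) j).2)) n
  simp only [pairExt_cons_zero, pairExt_cons_succ] at h1
  rw [chainAction, Finset.sum_range_succ' _ (n + 1), h1, chainAction]
  simp only [hl, hr, hl0, hr0]
  ring

/-- A closed chain is an open chain between the two spinors of its last pair, together with the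
contraction of this pair. -/
theorem loopAction_snoc (c ρ : ℕ → ℂ) (A : ℕ → SU2) (x : SpinorPair) (p : Fin n → SpinorPair) :
    loopAction c ρ A (Fin.snoc p x : Fin (n + 1) → SpinorPair) =
      chainAction c ρ A x.2 x.1 p + ρ n * braket x.1 (dual x.2) := by
  rw [loopAction, chainAction, Finset.sum_range_succ (fun j => ρ j *
    braket (pairExt (Fin.snoc p x : Fin (n + 1) → SpinorPair) j).1
      (dual (pairExt (Fin.snoc p x : Fin (n + 1) → SpinorPair) j).2)) n, ← add_assoc,
    Nat.add_sub_cancel, pairExt_snoc_last]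
  congr 2
  · refine Finset.sum_congr rfl fun i hi => ?_
    have hi' : i < n + 1 := Finset.mem_range.1 hi
    congr 2
    · unfold chainLeft
      split_ifs with h0
      · rfl
      · rw [pairExt_snoc_of_lt _ _ (by omega)]
    · unfold chainRight
      split_ifs with h0
      · rw [pairExt_snoc_of_lt _ _ h0]
      · rw [show i = n by omega, pairExt_snoc_last]
  · refine Finset.sum_congr rfl fun j hj => ?_
    rw [pairExt_snoc_of_lt _ _ (Finset.mem_range.1 hj)]

/-! #### Convergence -/

/-- A rescaled arithmetic-geometric mean inequality: of the coefficient `1 / 2` available to `y ^ 2`, the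
strict inequality `s < 1 / 2` leaves something over. -/
theorem exists_mul_le_sq {s : ℝ} (hs : 0 ≤ s) (hs' : s < 1 / 2) : ∃ κ t : ℝ, 0 ≤ κ ∧ κ < 1 ∧ 0 ≤ t ∧
    t < 1 / 2 ∧ ∀ x y : ℝ, s * x ^ 2 + x * y ≤ κ * x ^ 2 + t * y ^ 2 := by
  obtain ⟨δ, hδ⟩ : ∃ δ, δ = 3 / 4 - s / 2 := ⟨_, rfl⟩
  have hδ0 : 1 / 2 < δ := by linarith
  have hδ1 : 0 < δ := by linarith
  refine ⟨s + δ, (4 * δ)⁻¹, by linarith, by linarith, by positivity, ?_, fun x y => ?_⟩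
  · rw [inv_lt_comm₀ (by positivity) (by norm_num)]; linarith
  · have h : 0 ≤ δ * (x - (2 * δ)⁻¹ * y) ^ 2 := by positivity
    have h2 : δ * (x - (2 * δ)⁻¹ * y) ^ 2 = δ * x ^ 2 - x * y + (4 * δ)⁻¹ * y ^ 2 := by
      field_simp
      ring
    rw [h2] at h
    linarith

/-- An open chain with undamped contractions is dominated by a Gaussian of rate less than `1`. The
free coefficient `s < 1 / 2` in front of the norm of the initial spinor is what the elimination of the
preceding spinors of the chain leaves behind. -/
theorem exists_norm_chainAction_le (n : ℕ) : ∀ s : ℝ, 0 ≤ s → s < 1 / 2 → ∃ κ C : ℝ, 0 ≤ κ ∧ κ < 1 ∧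
    ∀ (c ρ : ℕ → ℂ) (A : ℕ → SU2) (a b : Spinor) (p : Fin n → SpinorPair),
      (∀ i, ‖c i‖ ≤ 1) → (∀ i, ‖ρ i‖ ≤ 1) →
      s * spinorNorm a ^ 2 + ‖chainAction c ρ A a b p‖ ≤
        κ * (spinorNorm a ^ 2 + ∑ j, pairNormSq (p j)) + C * spinorNorm b ^ 2 := by
  have hterm : ∀ (k z : ℂ) (y : ℝ), ‖k‖ ≤ 1 → ‖z‖ ≤ y → ‖k * z‖ ≤ y := by
    intro k z y hk hz
    rw [norm_mul]
    exact (mul_le_of_le_one_left (norm_nonneg _) hk).trans hz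
  induction n with
  | zero =>
    intro s hs hs'
    obtain ⟨κ, t, hκ0, hκ1, -, -, h⟩ := exists_mul_le_sq hs hs'
    refine ⟨κ, t, hκ0, hκ1, fun c ρ A a b p hc _ => ?_⟩
    have h1 : ‖chainAction c ρ A a b p‖ ≤ spinorNorm a * spinorNorm b := by
      simp only [chainAction, chainLeft, chainRight, zero_add, Finset.sum_range_one,
        Finset.sum_range_zero, add_zero, if_true, lt_irrefl, if_false]
      exact hterm _ _ _ (hc 0) (norm_dualBraket_le _ _ _)
    have h2 := h (spinorNorm a) (spinorNorm b)
    simp only [Finset.univ_eq_empty, Finset.sum_empty, add_zero]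
    linarith
  | succ n ih =>
    intro s hs hs'
    obtain ⟨κ₁, s₁, hκ₁, hκ₁', hs₁, hs₁', h₁⟩ := exists_mul_le_sq hs hs'
    obtain ⟨κ₂, s₂, hκ₂, hκ₂', hs₂, hs₂', h₂⟩ := exists_mul_le_sq hs₁ hs₁'
    obtain ⟨κ₃, C, hκ₃, hκ₃', h₃⟩ := ih s₂ hs₂ hs₂'
    refine ⟨max κ₁ (max κ₂ κ₃), C, le_max_of_le_left hκ₁, max_lt hκ₁' (max_lt hκ₂' hκ₃'),
      fun c ρ A a b p hc hρ => ?_⟩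
    obtain ⟨x, p, rfl⟩ : ∃ x p', p = (Fin.cons x p' : Fin (n + 1) → SpinorPair) :=
      ⟨p 0, Fin.tail p, (Fin.cons_self_tail p).symm⟩
    rw [chainAction_cons, Fin.sum_univ_succ]
    simp only [Fin.cons_zero, Fin.cons_succ]
    have e₁ := hterm _ _ _ (hc 0) (norm_dualBraket_le a (A 0) x.1)
    have e₂ := hterm _ _ _ (hρ 0) (norm_braket_le x.1 (dual x.2))
    rw [spinorNorm_dual] at e₂
    have e₃ := h₃ (fun i => c (i + 1)) (fun i => ρ (i + 1)) (fun i => A (i + 1)) x.2 b p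
      (fun i => hc _) (fun i => hρ _)
    have e₄ := h₁ (spinorNorm a) (spinorNorm x.1)
    have e₅ := h₂ (spinorNorm x.1) (spinorNorm x.2)
    have e₆ := norm_add₃_le (a := c 0 * dualBraket a (A 0) x.1) (b := ρ 0 * braket x.1 (dual x.2))
      (c := chainAction (fun i => c (i + 1)) (fun i => ρ (i + 1)) (fun i => A (i + 1)) x.2 b p)
    have hS : 0 ≤ ∑ j, pairNormSq (p j) := Finset.sum_nonneg fun j _ => pairNormSq_nonneg _
    set κ := max κ₁ (max κ₂ κ₃)
    have m₁ : κ₁ * spinorNorm a ^ 2 ≤ κ * spinorNorm a ^ 2 :=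
      mul_le_mul_of_nonneg_right (le_max_left _ _) (sq_nonneg _)
    have m₂ : κ₂ * spinorNorm x.1 ^ 2 ≤ κ * spinorNorm x.1 ^ 2 :=
      mul_le_mul_of_nonneg_right ((le_max_left _ _).trans (le_max_right _ _)) (sq_nonneg _)
    have m₃ : κ₃ * (spinorNorm x.2 ^ 2 + ∑ j, pairNormSq (p j)) ≤
        κ * (spinorNorm x.2 ^ 2 + ∑ j, pairNormSq (p j)) :=
      mul_le_mul_of_nonneg_right ((le_max_right _ _).trans (le_max_right _ _))
        (add_nonneg (sq_nonneg _) hS)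
    have hx : pairNormSq x = spinorNorm x.1 ^ 2 + spinorNorm x.2 ^ 2 := rfl
    rw [hx]
    linarith

/-- With contractions damped by `r`, the ends of the chain enter with coefficient `1 / 2`, which leaves
room for a damped contraction that closes the chain. -/
theorem norm_chainAction_le_of_damped {r : ℝ} (hr : 0 ≤ r) : ∀ (n : ℕ) (c ρ : ℕ → ℂ) (A : ℕ → SU2)
    (a b : Spinor) (p : Fin n → SpinorPair), (∀ i, ‖c i‖ ≤ 1) → (∀ i, ‖ρ i‖ ≤ r) →
      ‖chainAction c ρ A a b p‖ ≤ 1 / 2 * (spinorNorm a ^ 2 + spinorNorm b ^ 2) +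
        (1 + r) / 2 * ∑ j, pairNormSq (p j) := by
  have hterm : ∀ (k z : ℂ) (x y t : ℝ), 0 ≤ t → ‖k‖ ≤ t → ‖z‖ ≤ x * y →
      ‖k * z‖ ≤ t * (1 / 2 * (x ^ 2 + y ^ 2)) := by
    intro k z x y t ht hk hz
    rw [norm_mul]
    exact mul_le_mul hk (hz.trans (by nlinarith [sq_nonneg (x - y)])) (norm_nonneg _) ht
  intro n
  induction n with
  | zero =>
    intro c ρ A a b p hc _
    simp only [chainAction, chainLeft, chainRight, zero_add, Finset.sum_range_one,
      Finset.sum_range_zero, add_zero, if_true, lt_irrefl, if_false, Finset.univ_eq_empty,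
      Finset.sum_empty, mul_zero]
    simpa using hterm _ _ _ _ 1 zero_le_one (hc 0) (norm_dualBraket_le a (A 0) b)
  | succ n ih =>
    intro c ρ A a b p hc hρ
    obtain ⟨x, p, rfl⟩ : ∃ x p', p = (Fin.cons x p' : Fin (n + 1) → SpinorPair) :=
      ⟨p 0, Fin.tail p, (Fin.cons_self_tail p).symm⟩
    rw [chainAction_cons, Fin.sum_univ_succ]
    simp only [Fin.cons_zero, Fin.cons_succ]
    have e₁ := hterm _ _ _ _ 1 zero_le_one (hc 0) (norm_dualBraket_le a (A 0) x.1)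
    have e₂ := hterm _ _ (spinorNorm x.1) (spinorNorm (dual x.2)) r hr (hρ 0) (norm_braket_le _ _)
    rw [spinorNorm_dual] at e₂
    have e₃ := ih (fun i => c (i + 1)) (fun i => ρ (i + 1)) (fun i => A (i + 1)) x.2 b p
      (fun i => hc _) (fun i => hρ _)
    have e₆ := norm_add₃_le (a := c 0 * dualBraket a (A 0) x.1) (b := ρ 0 * braket x.1 (dual x.2))
      (c := chainAction (fun i => c (i + 1)) (fun i => ρ (i + 1)) (fun i => A (i + 1)) x.2 b p)
    have hx : pairNormSq x = spinorNorm x.1 ^ 2 + spinorNorm x.2 ^ 2 := rfl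
    rw [hx]
    linarith

theorem integrable_exp_pairNormSq {κ : ℝ} (hκ : κ < 1) :
    Integrable (fun p : Fin n → SpinorPair => Real.exp (κ * ∑ j, pairNormSq (p j)))
      (Measure.pi fun _ => pairMeasure) := by
  have h1 : Integrable (fun x : SpinorPair => Real.exp (κ * pairNormSq x)) pairMeasure := by
    refine ((integrable_exp_spinorNorm hκ).mul_prod (integrable_exp_spinorNorm hκ)).congr
      (Eventually.of_forall fun x => ?_)
    simp only [pairNormSq, mul_add, Real.exp_add]
  refine (Integrable.fintype_prod (ι := Fin n) (𝕜 := ℝ) fun _ => h1).congr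
    (Eventually.of_forall fun p => ?_)
  simp only [Finset.mul_sum, Real.exp_sum]

theorem integrable_of_norm_le_exp_pairNormSq {f : (Fin n → SpinorPair) → ℂ} (hf : Continuous f)
    {κ C : ℝ} (hκ : κ < 1) (h : ∀ p, ‖f p‖ ≤ C * Real.exp (κ * ∑ j, pairNormSq (p j))) :
    Integrable f (Measure.pi fun _ => pairMeasure) :=
  ((integrable_exp_pairNormSq hκ).const_mul C).mono' hf.aestronglyMeasurable
    (Eventually.of_forall h)

theorem exists_norm_exp_chainAction_le (n : ℕ) (a b : Spinor) : ∃ κ C : ℝ, κ < 1 ∧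
    ∀ (c ρ : ℕ → ℂ) (A : ℕ → SU2) (p : Fin n → SpinorPair),
      (∀ i, ‖c i‖ ≤ 1) → (∀ i, ‖ρ i‖ ≤ 1) →
      ‖Complex.exp (chainAction c ρ A a b p)‖ ≤ C * Real.exp (κ * ∑ j, pairNormSq (p j)) := by
  obtain ⟨κ, C, -, hκ, h⟩ := exists_norm_chainAction_le n 0 le_rfl (by norm_num)
  refine ⟨κ, Real.exp (κ * spinorNorm a ^ 2 + C * spinorNorm b ^ 2), hκ, fun c ρ A p hc hρ => ?_⟩
  rw [Complex.norm_exp, ← Real.exp_add, Real.exp_le_exp]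
  have := h c ρ A a b p hc hρ
  refine (Complex.re_le_norm _).trans ?_
  linarith

theorem norm_loopAction_le {r : ℝ} (hr : 0 ≤ r) (c ρ : ℕ → ℂ) (A : ℕ → SU2)
    (p : Fin (n + 1) → SpinorPair) (hc : ∀ i, ‖c i‖ ≤ 1) (hρ : ∀ i, ‖ρ i‖ ≤ r) :
    ‖loopAction c ρ A p‖ ≤ (1 + r) / 2 * ∑ j, pairNormSq (p j) := by
  obtain ⟨x, p, rfl⟩ : ∃ x p', p = (Fin.snoc p' x : Fin (n + 1) → SpinorPair) :=
    ⟨p (Fin.last n), Fin.init p, (Fin.snoc_init_self p).symm⟩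
  rw [loopAction_snoc, Fin.sum_univ_castSucc]
  simp only [Fin.snoc_castSucc, Fin.snoc_last]
  have h1 := norm_chainAction_le_of_damped hr n c ρ A x.2 x.1 p hc hρ
  have h2 : ‖ρ n * braket x.1 (dual x.2)‖ ≤
      r * (1 / 2 * (spinorNorm x.1 ^ 2 + spinorNorm x.2 ^ 2)) := by
    rw [norm_mul]
    refine mul_le_mul (hρ n) ?_ (norm_nonneg _) hr
    refine (norm_braket_le _ _).trans ?_
    rw [spinorNorm_dual]
    nlinarith [sq_nonneg (spinorNorm x.1 - spinorNorm x.2)]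
  have h3 := norm_add_le (chainAction c ρ A x.2 x.1 p) (ρ n * braket x.1 (dual x.2))
  have hx : pairNormSq x = spinorNorm x.1 ^ 2 + spinorNorm x.2 ^ 2 := rfl
  rw [hx]
  linarith

/-- One of the two spinors of a pair. -/
def pairSide (side : Bool) (x : SpinorPair) : Spinor := if side then x.2 else x.1

theorem continuous_pairSide (side : Bool) : Continuous (pairSide side) := by
  cases side
  · exact continuous_fst
  · exact continuous_snd

theorem spinorNorm_pairSide_sq_le (side : Bool) (x : SpinorPair) :
    spinorNorm (pairSide side x) ^ 2 ≤ pairNormSq x := by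
  cases side
  · exact le_add_of_nonneg_right (sq_nonneg _)
  · exact le_add_of_nonneg_left (sq_nonneg _)

theorem exists_norm_loop_le (n : ℕ) {r : ℝ} (hr : 0 ≤ r) (hr1 : r < 1) : ∃ κ C : ℝ, κ < 1 ∧
    ∀ (c ρ : ℕ → ℂ) (A : ℕ → SU2) (p : Fin n → SpinorPair) (k : Fin n) (side : Bool),
      (∀ i, ‖c i‖ ≤ 1) → (∀ i, ‖ρ i‖ ≤ r) →
      ‖(braket (pairSide side (p k)) (pairSide side (p k)) - 1) * Complex.exp (loopAction c ρ A p)‖ ≤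
        C * Real.exp (κ * ∑ j, pairNormSq (p j)) := by
  have hε : 0 < (1 - r) / 4 := by linarith
  refine ⟨(1 - r) / 4 + (1 + r) / 2, ((1 - r) / 4)⁻¹ + 1, by linarith,
    fun c ρ A p k side hc hρ => ?_⟩
  obtain ⟨n, rfl⟩ : ∃ m, n = m + 1 := ⟨n - 1, (Nat.succ_pred_eq_of_pos k.pos).symm⟩
  set S := ∑ j, pairNormSq (p j) with hS
  have hk : spinorNorm (pairSide side (p k)) ^ 2 ≤ S :=
    (spinorNorm_pairSide_sq_le side (p k)).trans
      (Finset.single_le_sum (f := fun j => pairNormSq (p j)) (fun j _ => pairNormSq_nonneg _)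
        (Finset.mem_univ k))
  rw [norm_mul, add_mul ((1 - r) / 4), Real.exp_add, ← mul_assoc]
  refine mul_le_mul ?_ ?_ (norm_nonneg _) (by positivity)
  · refine (norm_sub_le _ _).trans ?_
    rw [braket_self, norm_one, Complex.norm_real, Real.norm_of_nonneg (sq_nonneg _), add_mul,
      one_mul]
    refine add_le_add (hk.trans (mul_exp_le_exp hε)) (Real.one_le_exp ?_)
    have : 0 ≤ S := (sq_nonneg _).trans hk
    positivity
  · rw [Complex.norm_exp, Real.exp_le_exp]
    exact (Complex.re_le_norm _).trans (norm_loopAction_le hr c ρ A p hc hρ)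

end Chain

/-! #### Evaluation -/

/-- Fubini's theorem for the removal of one pair of spinors. -/
theorem integral_pi_insertNth {n : ℕ} (i : Fin (n + 1)) {f : (Fin (n + 1) → SpinorPair) → ℂ}
    (hf : Integrable f (Measure.pi fun _ => pairMeasure)) :
    Integrable (fun x => ∫ p, f (i.insertNth x p) ∂(Measure.pi fun _ : Fin n => pairMeasure))
      pairMeasure ∧
    ∫ p, f p ∂(Measure.pi fun _ => pairMeasure) =
      ∫ x, ∫ p, f (i.insertNth x p) ∂(Measure.pi fun _ : Fin n => pairMeasure) ∂pairMeasure := by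
  have hmp := (measurePreserving_piFinSuccAbove (fun _ : Fin (n + 1) => pairMeasure) i).symm
  have hint : Integrable (fun q : SpinorPair × (Fin n → SpinorPair) =>
      f (i.insertNth (α := fun _ => SpinorPair) q.1 q.2))
      (pairMeasure.prod (Measure.pi fun _ : Fin n => pairMeasure)) :=
    (hmp.integrable_comp_emb (MeasurableEquiv.measurableEmbedding _)).2 hf
  refine ⟨hint.integral_prod_left, ?_⟩
  have h := integral_prod _ hint
  rw [← hmp.integral_comp (MeasurableEquiv.measurableEmbedding _)]
  exact h

/-- Contraction of an open chain: integrating out the pairs of spinors multiplies the group elements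
along the chain. -/
theorem integral_exp_chainAction (n : ℕ) : ∀ (c ρ : ℕ → ℂ) (A : ℕ → SU2) (a b : Spinor),
    (∀ i, ‖c i‖ ≤ 1) → (∀ i, ‖ρ i‖ ≤ 1) →
    ∫ p : Fin n → SpinorPair, Complex.exp (chainAction c ρ A a b p)
        ∂(Measure.pi fun _ => pairMeasure) =
      Complex.exp ((∏ i ∈ Finset.range (n + 1), c i) * (∏ j ∈ Finset.range n, ρ j) *
        dualBraket a (List.ofFn fun i : Fin (n + 1) => A i).prod b) := by
  induction n with
  | zero =>
    intro c ρ A a b _ _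
    simp [chainAction, chainLeft, chainRight]
  | succ n ih =>
    intro c ρ A a b hc hρ
    have hint : Integrable (fun p : Fin (n + 1) → SpinorPair =>
        Complex.exp (chainAction c ρ A a b p)) (Measure.pi fun _ => pairMeasure) := by
      obtain ⟨κ, C, hκ, h⟩ := exists_norm_exp_chainAction_le (n + 1) a b
      have hcont : Continuous fun p : Fin (n + 1) → SpinorPair => chainAction c ρ A a b p :=
        continuous_chainAction c ρ (A := fun _ => A) (fun i => continuous_const) a b continuous_id
      exact integrable_of_norm_le_exp_pairNormSq (Complex.continuous_exp.comp hcont) hκ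
        fun p => h c ρ A p hc hρ
    obtain ⟨hint', heq⟩ := integral_pi_insertNth 0 hint
    set C := (∏ i ∈ Finset.range (n + 1), c (i + 1)) * ∏ j ∈ Finset.range n, ρ (j + 1) with hC
    set G := (List.ofFn fun i : Fin (n + 1) => A (i + 1)).prod with hG
    have hinner : ∀ x : SpinorPair, ∫ p, Complex.exp (chainAction c ρ A a b
        ((0 : Fin (n + 1)).insertNth (α := fun _ => SpinorPair) x p))
          ∂(Measure.pi fun _ : Fin n => pairMeasure) =
        Complex.exp (c 0 * dualBraket a (A 0) x.1 + ρ 0 * braket x.1 (dual x.2) +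
          C * dualBraket x.2 G b) := by
      intro x
      simp_rw [Fin.insertNth_zero']
      simp_rw [chainAction_cons]
      simp_rw [Complex.exp_add _ (chainAction _ _ _ _ _ _)]
      rw [integral_const_mul, ih _ _ _ _ _ (fun i => hc _) (fun i => hρ _), ← Complex.exp_add]
    simp_rw [hinner] at hint' heq
    rw [pairMeasure] at hint'
    nth_rewrite 2 [pairMeasure] at heq
    -- `x.1`, at the end of the first link, is integrated before `x.2`, where the rest of the chain begins
    rw [heq, integral_prod_symm _ hint']
    simp_rw [integral_exp_dualBraket_add]
    rw [integral_exp_dualBraket_dual, Finset.prod_range_succ' c (n + 1),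
      Finset.prod_range_succ' ρ n, List.ofFn_succ, List.prod_cons]
    congr 1
    simp only [Fin.val_zero, Fin.val_succ, ← hG]
    rw [hC]
    ring

/-- Contraction of a closed chain, with the face amplitude inserted at the pair where the chain is cut
open. -/
theorem integral_loop_last (n : ℕ) (c ρ : ℕ → ℂ) (A : ℕ → SU2) {r : ℝ} (hr : 0 ≤ r) (hr1 : r < 1)
    (hc : ∀ i, ‖c i‖ ≤ 1) (hρ : ∀ i, ‖ρ i‖ ≤ r) (side : Bool) :
    ∫ p : Fin (n + 1) → SpinorPair, (braket (pairSide side (p (Fin.last n)))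
        (pairSide side (p (Fin.last n))) - 1) * Complex.exp (loopAction c ρ A p)
        ∂(Measure.pi fun _ => pairMeasure) =
      poissonKernel ((∏ i ∈ Finset.range (n + 1), c i) * ∏ j ∈ Finset.range (n + 1), ρ j)
        (List.ofFn fun i : Fin (n + 1) => A i).prod.1.trace := by
  have hint : Integrable (fun p : Fin (n + 1) → SpinorPair =>
      (braket (pairSide side (p (Fin.last n))) (pairSide side (p (Fin.last n))) - 1) *
        Complex.exp (loopAction c ρ A p)) (Measure.pi fun _ => pairMeasure) := by
    obtain ⟨κ, C, hκ, h⟩ := exists_norm_loop_le (n + 1) hr hr1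
    have hk : Continuous fun p : Fin (n + 1) → SpinorPair => pairSide side (p (Fin.last n)) :=
      (continuous_pairSide side).comp (continuous_apply _)
    have hcont : Continuous fun p : Fin (n + 1) → SpinorPair => loopAction c ρ A p :=
      continuous_loopAction c ρ (A := fun _ => A) (fun i => continuous_const) continuous_id
    exact integrable_of_norm_le_exp_pairNormSq (((hk.braket hk).sub continuous_const).mul
      (Complex.continuous_exp.comp hcont)) hκ fun p => h c ρ A p _ side hc hρ
  obtain ⟨hint', heq⟩ := integral_pi_insertNth (Fin.last n) hint
  set C := (∏ i ∈ Finset.range (n + 1), c i) * ∏ j ∈ Finset.range n, ρ j with hC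
  set G := (List.ofFn fun i : Fin (n + 1) => A i).prod with hG
  have hinner : ∀ x : SpinorPair, ∫ p, (braket
      (pairSide side ((Fin.last n).insertNth (α := fun _ => SpinorPair) x p (Fin.last n)))
      (pairSide side ((Fin.last n).insertNth (α := fun _ => SpinorPair) x p (Fin.last n))) - 1) *
      Complex.exp (loopAction c ρ A ((Fin.last n).insertNth (α := fun _ => SpinorPair) x p))
          ∂(Measure.pi fun _ : Fin n => pairMeasure) =
      (braket (pairSide side x) (pairSide side x) - 1) *
        Complex.exp (C * dualBraket x.2 G x.1 + ρ n * braket x.1 (dual x.2)) := by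
    intro x
    simp_rw [Fin.insertNth_last']
    simp_rw [Fin.snoc_last, loopAction_snoc, Complex.exp_add (chainAction _ _ _ _ _ _)]
    rw [integral_const_mul, integral_mul_const, integral_exp_chainAction n c ρ A x.2 x.1 hc
      (fun i => (hρ i).trans hr1.le), ← Complex.exp_add]
  simp_rw [hinner] at hint' heq
  rw [pairMeasure] at hint'
  nth_rewrite 2 [pairMeasure] at heq
  have hnorm : ‖C * ρ n‖ < 1 := by
    have h1 : ‖∏ i ∈ Finset.range (n + 1), c i‖ ≤ 1 := by
      rw [norm_prod]; exact Finset.prod_le_one (fun _ _ => norm_nonneg _) fun i _ => hc i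
    have h2 : ‖∏ j ∈ Finset.range n, ρ j‖ ≤ 1 := by
      rw [norm_prod]
      exact Finset.prod_le_one (fun _ _ => norm_nonneg _) fun i _ => (hρ i).trans hr1.le
    rw [norm_mul, hC, norm_mul]
    calc _ ≤ 1 * ‖ρ n‖ := by gcongr; exact mul_le_one₀ h1 (norm_nonneg _) h2
      _ < 1 := by rw [one_mul]; exact (hρ n).trans_lt hr1
  have hCρ : (∏ i ∈ Finset.range (n + 1), c i) * ∏ j ∈ Finset.range (n + 1), ρ j = C * ρ n := by
    rw [hC, Finset.prod_range_succ ρ]; ring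
  rw [heq, hCρ]
  cases side with
  -- the spinor that does not enter the face amplitude is integrated first
  | false =>
    rw [integral_prod _ hint']
    simp only [pairSide, Bool.false_eq_true, if_false]
    simp_rw [integral_const_mul, integral_exp_dualBraket_self]
    exact integral_normSq_sub_one_mul_exp _ hnorm G
  | true =>
    rw [integral_prod_symm _ hint']
    simp only [pairSide, if_true]
    have h0 : ∀ w : Spinor, ∫ x, Complex.exp (C * dualBraket w G x + ρ n * braket x (dual w))
        ∂spinorMeasure = Complex.exp (C * ρ n * braket w ((G⁻¹).1.mulVec w)) := by
      intro w
      have := integral_exp_dualBraket_add C (ρ n) 0 w w G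
      simp only [add_zero] at this
      rw [this, dualBraket_dual_self]
    simp_rw [integral_const_mul, h0]
    rw [integral_normSq_sub_one_mul_exp _ hnorm, SU2.trace_inv]

/-- The exponent of a closed chain in cyclic form. -/
theorem loopAction_eq_sum {n : ℕ} (c ρ : ℕ → ℂ) (A : ℕ → SU2) (p : Fin (n + 1) → SpinorPair) :
    loopAction c ρ A p = ∑ i : Fin (n + 1), c i * dualBraket (p (i - 1)).2 (A i) (p i).1 +
      ∑ i : Fin (n + 1), ρ i * braket (p i).1 (dual (p i).2) := by
  have hext : ∀ i : Fin (n + 1), pairExt p i = p i := fun i => dif_pos i.2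
  rw [loopAction, Finset.sum_range, Finset.sum_range]
  congr 1
  · refine Finset.sum_congr rfl fun i _ => ?_
    rw [hext]
    congr 2
    unfold chainLeft
    induction i using Fin.cases with
    | zero =>
      rw [if_pos (by simp)]
      have h1 : (0 : Fin (n + 1)) - 1 = Fin.last n := by
        rw [sub_eq_iff_eq_add, Fin.last_add_one]
      rw [h1, Nat.add_sub_cancel, ← hext, Fin.val_last]
    | succ i =>
      have h1 : i.succ - 1 = i.castSucc := by
        rw [sub_eq_iff_eq_add, Fin.coeSucc_eq_succ]
      rw [if_neg (by simp), h1, ← hext]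
      simp
  · simp_rw [hext]

theorem trace_prod_ofFn_add_one {n : ℕ} (A : Fin (n + 1) → SU2) :
    (List.ofFn fun i => A (i + 1)).prod.1.trace = (List.ofFn A).prod.1.trace := by
  have h1 : (List.ofFn fun i : Fin (n + 1) => A (i + 1)).prod =
      (List.ofFn fun i : Fin n => A i.succ).prod * A 0 := by
    rw [List.ofFn_succ', List.concat_eq_append, List.prod_append, List.prod_singleton,
      Fin.last_add_one]
    simp_rw [Fin.coeSucc_eq_succ]
  rw [h1, List.ofFn_succ, List.prod_cons]
  exact Matrix.trace_mul_comm _ _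

theorem integral_pi_comp_equiv {n : ℕ} (σ : Fin n ≃ Fin n) (f : (Fin n → SpinorPair) → ℂ) :
    ∫ p, f (p ∘ σ) ∂(Measure.pi fun _ => pairMeasure) =
      ∫ p, f p ∂(Measure.pi fun _ => pairMeasure) := by
  have hmp := measurePreserving_piCongrLeft (fun _ : Fin n => pairMeasure) σ
  rw [← hmp.integral_comp (MeasurableEquiv.measurableEmbedding _)]
  congr 1
  ext p
  congr 1
  funext i
  exact Equiv.piCongrLeft_apply_apply (P := fun _ : Fin n => SpinorPair) σ p i

/-- Contraction of a closed chain, in cyclic form. The position of the face amplitude is moved by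
rotating the chain. -/
theorem integral_loop_fin {n : ℕ} {r : ℝ} (hr : 0 ≤ r) (hr1 : r < 1) (side : Bool)
    (k : Fin (n + 1)) : ∀ (c ρ : Fin (n + 1) → ℂ) (A : Fin (n + 1) → SU2),
    (∀ i, ‖c i‖ ≤ 1) → (∀ i, ‖ρ i‖ ≤ r) →
    ∫ p : Fin (n + 1) → SpinorPair, (braket (pairSide side (p k)) (pairSide side (p k)) - 1) *
        Complex.exp (∑ i, c i * dualBraket (p (i - 1)).2 (A i) (p i).1 +
          ∑ i, ρ i * braket (p i).1 (dual (p i).2)) ∂(Measure.pi fun _ => pairMeasure) =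
      poissonKernel ((∏ i, c i) * ∏ i, ρ i) (List.ofFn A).prod.1.trace := by
  have hlast : ∀ (c ρ : Fin (n + 1) → ℂ) (A : Fin (n + 1) → SU2),
      (∀ i, ‖c i‖ ≤ 1) → (∀ i, ‖ρ i‖ ≤ r) →
      ∫ p : Fin (n + 1) → SpinorPair, (braket (pairSide side (p (Fin.last n)))
          (pairSide side (p (Fin.last n))) - 1) *
          Complex.exp (∑ i, c i * dualBraket (p (i - 1)).2 (A i) (p i).1 +
            ∑ i, ρ i * braket (p i).1 (dual (p i).2)) ∂(Measure.pi fun _ => pairMeasure) =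
        poissonKernel ((∏ i, c i) * ∏ i, ρ i) (List.ofFn A).prod.1.trace := by
    intro c ρ A hc hρ
    have h := integral_loop_last n (fun i => c (Fin.ofNat (n + 1) i)) (fun i => ρ (Fin.ofNat (n + 1) i))
      (fun i => A (Fin.ofNat (n + 1) i)) hr hr1 (fun i => hc _) (fun i => hρ _) side
    simp_rw [loopAction_eq_sum] at h
    simpa only [Finset.prod_range, Fin.ofNat_val_eq_self] using h
  have hstep : ∀ k : Fin (n + 1), (∀ (c ρ : Fin (n + 1) → ℂ) (A : Fin (n + 1) → SU2),
      (∀ i, ‖c i‖ ≤ 1) → (∀ i, ‖ρ i‖ ≤ r) →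
      ∫ p : Fin (n + 1) → SpinorPair, (braket (pairSide side (p k)) (pairSide side (p k)) - 1) *
          Complex.exp (∑ i, c i * dualBraket (p (i - 1)).2 (A i) (p i).1 +
            ∑ i, ρ i * braket (p i).1 (dual (p i).2)) ∂(Measure.pi fun _ => pairMeasure) =
        poissonKernel ((∏ i, c i) * ∏ i, ρ i) (List.ofFn A).prod.1.trace) →
      ∀ (c ρ : Fin (n + 1) → ℂ) (A : Fin (n + 1) → SU2),
      (∀ i, ‖c i‖ ≤ 1) → (∀ i, ‖ρ i‖ ≤ r) →
      ∫ p : Fin (n + 1) → SpinorPair,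
          (braket (pairSide side (p (k + 1))) (pairSide side (p (k + 1))) - 1) *
          Complex.exp (∑ i, c i * dualBraket (p (i - 1)).2 (A i) (p i).1 +
            ∑ i, ρ i * braket (p i).1 (dual (p i).2)) ∂(Measure.pi fun _ => pairMeasure) =
        poissonKernel ((∏ i, c i) * ∏ i, ρ i) (List.ofFn A).prod.1.trace := by
    intro k hk c ρ A hc hρ
    have h := hk (fun i => c (i + 1)) (fun i => ρ (i + 1)) (fun i => A (i + 1)) (fun i => hc _)
      (fun i => hρ _)
    have hprod : ∀ f : Fin (n + 1) → ℂ, ∏ i, f (i + 1) = ∏ i, f i :=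
      Equiv.prod_comp (Equiv.addRight (1 : Fin (n + 1)))
    have hsum : ∀ f : Fin (n + 1) → ℂ, ∑ i, f i = ∑ i, f (i + 1) := fun f =>
      (Equiv.sum_comp (Equiv.addRight (1 : Fin (n + 1))) f).symm
    rw [hprod, hprod, trace_prod_ofFn_add_one] at h
    rw [← h, ← integral_pi_comp_equiv (Equiv.subRight (1 : Fin (n + 1)))]
    congr 1
    ext p
    simp only [Function.comp_apply, Equiv.subRight_apply, add_sub_cancel_right]
    rw [hsum fun i => c i * dualBraket (p (i - 1 - 1)).2 (A i) (p (i - 1)).1,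
      hsum fun i => ρ i * braket (p (i - 1)).1 (dual (p (i - 1)).2)]
    simp only [add_sub_cancel_right]
  -- the last position is the predecessor of the first one in the cyclic order
  induction k using Fin.induction with
  | zero =>
    have := hstep (Fin.last n) hlast
    rwa [Fin.last_add_one] at this
  | succ i ih =>
    have := hstep i.castSucc ih
    rwa [Fin.coeSucc_eq_succ] at this

/-- Contraction of a closed chain: the result depends on the conjugacy class of the product of the
group elements only, and not on the position of the face amplitude. -/
theorem integral_loop {n : ℕ} (c ρ : ℕ → ℂ) (A : ℕ → SU2) {r : ℝ} (hr : 0 ≤ r) (hr1 : r < 1)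
    (hc : ∀ i, ‖c i‖ ≤ 1) (hρ : ∀ i, ‖ρ i‖ ≤ r) (k : Fin n) (side : Bool) :
    ∫ p : Fin n → SpinorPair, (braket (pairSide side (p k)) (pairSide side (p k)) - 1) *
        Complex.exp (loopAction c ρ A p) ∂(Measure.pi fun _ => pairMeasure) =
      poissonKernel ((∏ i ∈ Finset.range n, c i) * ∏ j ∈ Finset.range n, ρ j)
        (List.ofFn fun i : Fin n => A i).prod.1.trace := by
  obtain ⟨n, rfl⟩ : ∃ m, n = m + 1 := ⟨n - 1, (Nat.succ_pred_eq_of_pos k.pos).symm⟩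
  simp_rw [loopAction_eq_sum, Finset.prod_range]
  exact integral_loop_fin hr hr1 side k (fun i => c i) (fun i => ρ i) (fun i => A i)
    (fun i => hc _) (fun i => hρ _)

end PonzanoRegge

namespace PonzanoRegge

/-! ### The combinatorics of dual faces -/

section Combinatorics

variable {V : Type*} [DecidableEq V] {K : Triangulation V} {e : Finset V}

theorem Triangulation.mem_edges_iff : e ∈ K.edges ↔ ∃ T ∈ K.tets, e ⊆ T ∧ e.card = 2 := by
  simp [Triangulation.edges, Finset.mem_powersetCard]

theorem Triangulation.mem_triangles_iff {t : Finset V} :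
    t ∈ K.triangles ↔ ∃ T ∈ K.tets, t ⊆ T ∧ t.card = 3 := by
  simp [Triangulation.triangles, Finset.mem_powersetCard]

theorem Triangulation.card_of_mem_edges (he : e ∈ K.edges) : e.card = 2 := by
  obtain ⟨T, -, -, h⟩ := mem_edges_iff.1 he
  exact h

namespace Fan

variable (F : Fan K.tets e)

theorem len_pos (he : e ∈ K.edges) : 0 < F.len := by
  obtain ⟨T, hT, h, -⟩ := Triangulation.mem_edges_iff.1 he
  obtain ⟨i, hi, -⟩ := F.cover T hT h
  exact (Nat.zero_le i).trans_lt hi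

theorem tet_mem {i : ℕ} (hi : i < F.len) : F.tet i ∈ K.tets := F.mem_tets i hi

theorem pt_facts (he : e ∈ K.edges) {i : ℕ} (hi : i < F.len) :
    F.pt i ∉ e ∧ F.pt (i + 1) ∉ e ∧ F.pt i ≠ F.pt (i + 1) := by
  have h4 := K.card_tet _ (F.mem_tets i hi)
  have h2 := Triangulation.card_of_mem_edges he
  have h1 : F.pt i ∉ insert (F.pt (i + 1)) e := by
    intro h
    rw [Finset.insert_eq_of_mem h] at h4
    have := Finset.card_insert_le (F.pt (i + 1)) e
    omega
  rw [Finset.card_insert_of_notMem h1] at h4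
  have h3 : F.pt (i + 1) ∉ e := by
    intro h
    rw [Finset.insert_eq_of_mem h] at h4
    omega
  rw [Finset.mem_insert, not_or] at h1
  exact ⟨h1.2, h3, h1.1⟩

theorem pt_notMem (he : e ∈ K.edges) {i : ℕ} (hi : i ≤ F.len) : F.pt i ∉ e := by
  rcases hi.lt_or_eq with h | rfl
  · exact (F.pt_facts he h).1
  · have h0 := F.len_pos he
    have h1 : F.len - 1 + 1 = F.len := by omega
    have := (F.pt_facts he (Nat.sub_lt h0 one_pos)).2.1
    rwa [h1] at this

theorem tri_card (he : e ∈ K.edges) {i : ℕ} (hi : i ≤ F.len) : (F.tri i).card = 3 := by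
  rw [tri, Finset.card_insert_of_notMem (F.pt_notMem he hi), Triangulation.card_of_mem_edges he]

theorem sub_tri (i : ℕ) : e ⊆ F.tri i := Finset.subset_insert _ _

theorem tri_sub_tet (i : ℕ) : F.tri i ⊆ F.tet i :=
  Finset.insert_subset_insert _ (Finset.subset_insert _ _)

theorem tri_succ_sub_tet (i : ℕ) : F.tri (i + 1) ⊆ F.tet i := Finset.subset_insert _ _

theorem sub_tet (i : ℕ) : e ⊆ F.tet i := (F.sub_tri i).trans (F.tri_sub_tet i)

theorem tri_eq_iff (he : e ∈ K.edges) {i j : ℕ} (hi : i ≤ F.len) :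
    F.tri i = F.tri j ↔ F.pt i = F.pt j := by
  constructor
  · intro h
    have : F.pt i ∈ F.tri j := h ▸ Finset.mem_insert_self _ _
    exact (Finset.mem_insert.1 this).resolve_right (F.pt_notMem he hi)
  · intro h; rw [tri, tri, h]

theorem tri_sub_tet_iff (he : e ∈ K.edges) {i j : ℕ} (hi : i ≤ F.len) :
    F.tri i ⊆ F.tet j ↔ F.pt i = F.pt j ∨ F.pt i = F.pt (j + 1) := by
  rw [tri, Finset.insert_subset_iff, and_iff_left (F.sub_tet j), tet, Finset.mem_insert,
    Finset.mem_insert, or_iff_left (F.pt_notMem he hi)]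

theorem mem_triangles_tri (he : e ∈ K.edges) {i : ℕ} (hi : i ≤ F.len) : F.tri i ∈ K.triangles := by
  rw [Triangulation.mem_triangles_iff]
  rcases hi.lt_or_eq with h | rfl
  · exact ⟨F.tet i, F.tet_mem h, F.tri_sub_tet i, F.tri_card he h.le⟩
  · have h0 := F.len_pos he
    refine ⟨F.tet (F.len - 1), F.tet_mem (Nat.sub_lt h0 one_pos), ?_, F.tri_card he le_rfl⟩
    have := F.tri_succ_sub_tet (F.len - 1)
    rwa [Nat.sub_add_cancel h0] at this

theorem tet_injOn {i j : ℕ} (he : e ∈ K.edges) (hi : i < F.len) (hj : j < F.len)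
    (h : F.tet i = F.tet j) : i = j := by
  have key : ∀ i j : ℕ, i < j → j < F.len → F.tet i = F.tet j → False := by
    intro i j hij hj h
    have hi : i < F.len := hij.trans hj
    have h1 := (F.tri_sub_tet_iff he hi.le).1 (h ▸ F.tri_sub_tet i)
    have h2 := (F.tri_sub_tet_iff he (Nat.succ_le_of_lt hi)).1 (h ▸ F.tri_succ_sub_tet i)
    rcases h1 with h1 | h1
    · have := F.simple i j hij hj.le h1; omega
    · obtain ⟨rfl, hl⟩ := F.simple i (j + 1) (by omega) hj h1
      rcases h2 with h2 | h2
      · by_cases h3 : j = 1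
        · have := F.three_le (hl ▸ h1); omega
        · have := F.simple (0 + 1) j (by omega) hj.le h2; omega
      · have := F.simple (0 + 1) (j + 1) (by omega) hj h2; omega
  rcases lt_trichotomy i j with hij | hij | hij
  · exact (key i j hij hj h).elim
  · exact hij
  · exact (key j i hij hi h.symm).elim

theorem tri_succ_injOn {i j : ℕ} (he : e ∈ K.edges) (hi : i < F.len) (hj : j < F.len)
    (h : F.tri (i + 1) = F.tri (j + 1)) : i = j := by
  rw [F.tri_eq_iff he hi] at h
  rcases lt_trichotomy i j with hij | hij | hij
  · have := F.simple (i + 1) (j + 1) (by omega) hj h; omega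
  · exact hij
  · have := F.simple (j + 1) (i + 1) (by omega) hi h.symm; omega

/-- The triangles of a tetrahedron of the fan that contain the edge are its two neighbours in the
fan. -/
theorem eq_tri_or_of_sub_tet {i : ℕ} {t : Finset V} (he : e ∈ K.edges)
    (ht : t ⊆ F.tet i) (hc : t.card = 3) (het : e ⊆ t) : t = F.tri i ∨ t = F.tri (i + 1) := by
  have h2 := Triangulation.card_of_mem_edges he
  have hsd : (t \ e).card = 1 := by rw [Finset.card_sdiff_of_subset het]; omega
  obtain ⟨v, hv⟩ := Finset.card_eq_one.1 hsd
  have hvt : v ∈ t \ e := hv ▸ Finset.mem_singleton_self v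
  have hte : t = insert v e := by
    rw [← Finset.sdiff_union_of_subset het, hv, Finset.singleton_union]
  have := ht (Finset.mem_sdiff.1 hvt).1
  rw [tet, Finset.mem_insert, Finset.mem_insert] at this
  rcases this with h | h | h
  · left; rw [hte, h, tri]
  · right; rw [hte, h, tri]
  · exact ((Finset.mem_sdiff.1 hvt).2 h).elim

theorem exists_tri_of_mem_triangles {t : Finset V} (he : e ∈ K.edges) (ht : t ∈ K.triangles)
    (het : e ⊆ t) : ∃ i ≤ F.len, t = F.tri i := by
  obtain ⟨T, hT, htT, hc⟩ := Triangulation.mem_triangles_iff.1 ht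
  obtain ⟨i, hi, rfl⟩ := F.cover T hT (het.trans htT)
  rcases F.eq_tri_or_of_sub_tet he htT hc het with h | h
  · exact ⟨i, hi.le, h⟩
  · exact ⟨i + 1, hi, h⟩

/-- A fan is closed if the link of its edge is a circle. -/
def Closed : Prop := F.pt 0 = F.pt F.len

open Classical in
/-- The number of interior triangles around the edge of a fan. The `j`-th one is `tri (j + 1)`. -/
noncomputable def numBulk : ℕ := if F.Closed then F.len else F.len - 1

/-- The index of the tetrahedron behind the triangle `tri (j + 1)`; around an interior edge the last
tetrahedron is followed by the first one. -/
def next (j : ℕ) : ℕ := if j + 1 = F.len then 0 else j + 1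

theorem numBulk_le : F.numBulk ≤ F.len := by
  unfold numBulk; split_ifs <;> omega

theorem numBulk_of_closed (h : F.Closed) : F.numBulk = F.len := if_pos h

theorem numBulk_of_not_closed (he : e ∈ K.edges) (h : ¬ F.Closed) : F.numBulk + 1 = F.len := by
  rw [numBulk, if_neg h, Nat.sub_add_cancel (F.len_pos he)]

theorem next_lt (he : e ∈ K.edges) {j : ℕ} (hj : j < F.len) : F.next j < F.len := by
  have := F.len_pos he
  unfold next; split_ifs <;> omega

theorem three_le_len (h : F.Closed) : 3 ≤ F.len := F.three_le h

theorem next_ne {j : ℕ} (hj : j < F.numBulk) : F.next j ≠ j := by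
  unfold next
  split_ifs with h
  · by_cases hc : F.Closed
    · have := F.three_le_len hc; omega
    · rw [numBulk, if_neg hc] at hj; omega
  · omega

theorem tri_next (he : e ∈ K.edges) {j : ℕ} (hj : j < F.numBulk) : F.tri (F.next j) = F.tri (j + 1) := by
  unfold next
  split_ifs with h
  · have hc : F.Closed := by
      by_contra hc
      have := F.numBulk_of_not_closed he hc; omega
    rw [h, tri, tri, hc]
  · rfl

/-- The tetrahedra that contain an interior triangle of the fan. -/
theorem tri_succ_sub_tet_iff (he : e ∈ K.edges) {i j : ℕ} (hj : j < F.numBulk) (hi : i < F.len) :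
    F.tri (j + 1) ⊆ F.tet i ↔ i = j ∨ i = F.next j := by
  have hjl : j < F.len := hj.trans_le F.numBulk_le
  constructor
  · intro h
    rcases (F.tri_sub_tet_iff he (Nat.succ_le_of_lt hjl)).1 h with h | h
    · right
      unfold next
      rcases lt_trichotomy (j + 1) i with h1 | h1 | h1
      · have := F.simple _ _ h1 hi.le h; omega
      · rw [if_neg (by omega), h1]
      · have := F.simple _ _ h1 (by omega) h.symm
        rw [if_pos this.2, this.1]
    · left
      rcases lt_trichotomy i j with h1 | h1 | h1
      · have := F.simple _ _ (Nat.succ_lt_succ h1) hjl h.symm; omega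
      · exact h1
      · have := F.simple _ _ (Nat.succ_lt_succ h1) hi h; omega
  · rintro (rfl | rfl)
    · exact F.tri_succ_sub_tet _
    · rw [← F.tri_next he hj]; exact F.tri_sub_tet _

theorem filter_tets_eq {t : Finset V} (het : e ⊆ t) :
    K.tets.filter (fun T => t ⊆ T) =
      ((Finset.range F.len).filter fun i => t ⊆ F.tet i).image F.tet := by
  ext T
  simp only [Finset.mem_filter, Finset.mem_image, Finset.mem_range]
  constructor
  · rintro ⟨hT, htT⟩
    obtain ⟨i, hi, rfl⟩ := F.cover T hT (het.trans htT)
    exact ⟨i, ⟨hi, htT⟩, rfl⟩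
  · rintro ⟨i, ⟨hi, hti⟩, rfl⟩
    exact ⟨F.tet_mem hi, hti⟩

theorem card_filter_tets (he : e ∈ K.edges) {t : Finset V} (het : e ⊆ t) :
    (K.tets.filter fun T => t ⊆ T).card =
      ((Finset.range F.len).filter fun i => t ⊆ F.tet i).card := by
  rw [F.filter_tets_eq het, Finset.card_image_of_injOn]
  intro i hi j hj h
  rw [Finset.mem_coe, Finset.mem_filter, Finset.mem_range] at hi hj
  exact F.tet_injOn he hi.1 hj.1 h

theorem tri_succ_mem_bulkTriangles (he : e ∈ K.edges) {j : ℕ} (hj : j < F.numBulk) :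
    F.tri (j + 1) ∈ K.bulkTriangles := by
  have hjl : j < F.len := hj.trans_le F.numBulk_le
  refine Finset.mem_filter.2 ⟨F.mem_triangles_tri he (Nat.succ_le_of_lt hjl), ?_⟩
  rw [F.card_filter_tets he (F.sub_tri _)]
  have : (Finset.range F.len).filter (fun i => F.tri (j + 1) ⊆ F.tet i) = {j, F.next j} := by
    ext i
    rw [Finset.mem_filter, Finset.mem_range, Finset.mem_insert, Finset.mem_singleton]
    constructor
    · rintro ⟨hi, h⟩
      exact (F.tri_succ_sub_tet_iff he hj hi).1 h
    · intro h
      have hi : i < F.len := by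
        rcases h with rfl | rfl
        · exact hjl
        · exact F.next_lt he hjl
      exact ⟨hi, (F.tri_succ_sub_tet_iff he hj hi).2 h⟩
  rw [this, Finset.card_pair (F.next_ne hj).symm]

theorem tri_zero_mem_bdTriangles (he : e ∈ K.edges) (h : ¬ F.Closed) : F.tri 0 ∈ K.bdTriangles := by
  have h0 := F.len_pos he
  refine Finset.mem_filter.2 ⟨F.mem_triangles_tri he (Nat.zero_le _), ?_⟩
  rw [F.card_filter_tets he (F.sub_tri _), Finset.card_eq_one]
  refine ⟨0, ?_⟩
  ext i
  rw [Finset.mem_filter, Finset.mem_range, Finset.mem_singleton,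
    F.tri_sub_tet_iff he (Nat.zero_le _)]
  constructor
  · rintro ⟨hi, h1 | h1⟩
    · by_contra h2
      have := F.simple 0 i (by omega) hi.le h1; omega
    · have := F.simple 0 (i + 1) (by omega) hi h1
      exact (h (show F.pt 0 = F.pt F.len by rw [← this.2]; exact h1)).elim
  · rintro rfl
    exact ⟨h0, Or.inl rfl⟩

theorem tri_len_mem_bdTriangles (he : e ∈ K.edges) (h : ¬ F.Closed) : F.tri F.len ∈ K.bdTriangles := by
  have h0 := F.len_pos he
  refine Finset.mem_filter.2 ⟨F.mem_triangles_tri he le_rfl, ?_⟩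
  rw [F.card_filter_tets he (F.sub_tri _), Finset.card_eq_one]
  refine ⟨F.len - 1, ?_⟩
  ext i
  rw [Finset.mem_filter, Finset.mem_range, Finset.mem_singleton, F.tri_sub_tet_iff he le_rfl]
  constructor
  · rintro ⟨hi, h1 | h1⟩
    · have := F.simple i F.len hi le_rfl h1.symm
      exact (h (show F.pt 0 = F.pt F.len by rw [← this.1]; exact h1.symm)).elim
    · by_contra h2
      have := F.simple (i + 1) F.len (by omega) le_rfl h1.symm; omega
  · rintro rfl
    exact ⟨by omega, Or.inr (by rw [Nat.sub_add_cancel h0])⟩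

theorem tri_zero_ne_tri_len (he : e ∈ K.edges) (h : ¬ F.Closed) : F.tri 0 ≠ F.tri F.len := by
  rw [Ne, F.tri_eq_iff he (Nat.zero_le _)]
  exact h

theorem tri_zero_eq_tri_len (h : F.Closed) : F.tri 0 = F.tri F.len := by rw [tri, tri, h]

end Fan

theorem Triangulation.not_mem_bulk_of_mem_bd {t : Finset V} (h : t ∈ K.bdTriangles) :
    t ∉ K.bulkTriangles := by
  intro h'
  have h1 := (Finset.mem_filter.1 h).2
  have h2 := (Finset.mem_filter.1 h').2
  omega

theorem Triangulation.mem_triangles_of_bd {t : Finset V} (h : t ∈ K.bdTriangles) : t ∈ K.triangles :=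
  (Finset.mem_filter.1 h).1

theorem Triangulation.mem_triangles_of_bulk {t : Finset V} (h : t ∈ K.bulkTriangles) :
    t ∈ K.triangles := (Finset.mem_filter.1 h).1

namespace Fan

variable (F : Fan K.tets e)

/-- Around an edge, the triangles are `tri 1, …, tri numBulk` in the interior and, if the link of the edge
is an arc, `tri 0` and `tri len` in the boundary. -/
theorem tri_cases (he : e ∈ K.edges) {i : ℕ} (hi : i ≤ F.len) :
    (∃ j < F.numBulk, F.tri i = F.tri (j + 1)) ∨ (¬ F.Closed ∧ (i = 0 ∨ i = F.len)) := by
  have h0 := F.len_pos he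
  by_cases hc : F.Closed
  · left
    rw [F.numBulk_of_closed hc]
    rcases Nat.eq_zero_or_pos i with rfl | hpos
    · exact ⟨F.len - 1, by omega, by rw [Nat.sub_add_cancel h0, F.tri_zero_eq_tri_len hc]⟩
    · exact ⟨i - 1, by omega, by rw [Nat.sub_add_cancel hpos]⟩
  · have hn := F.numBulk_of_not_closed he hc
    by_cases h1 : i = 0 ∨ i = F.len
    · exact Or.inr ⟨hc, h1⟩
    · rw [not_or] at h1
      exact Or.inl ⟨i - 1, by omega, by rw [Nat.sub_add_cancel (by omega)]⟩

theorem exists_of_mem_bulkTriangles (he : e ∈ K.edges) {t : Finset V} (ht : t ∈ K.bulkTriangles)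
    (het : e ⊆ t) : ∃ j < F.numBulk, t = F.tri (j + 1) := by
  obtain ⟨i, hi, rfl⟩ :=
    F.exists_tri_of_mem_triangles he (Triangulation.mem_triangles_of_bulk ht) het
  rcases F.tri_cases he hi with h | ⟨hc, rfl | rfl⟩
  · exact h
  · exact (Triangulation.not_mem_bulk_of_mem_bd (F.tri_zero_mem_bdTriangles he hc) ht).elim
  · exact (Triangulation.not_mem_bulk_of_mem_bd (F.tri_len_mem_bdTriangles he hc) ht).elim

theorem eq_of_mem_bdTriangles (he : e ∈ K.edges) {t : Finset V} (ht : t ∈ K.bdTriangles)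
    (het : e ⊆ t) : ¬ F.Closed ∧ (t = F.tri 0 ∨ t = F.tri F.len) := by
  obtain ⟨i, hi, rfl⟩ :=
    F.exists_tri_of_mem_triangles he (Triangulation.mem_triangles_of_bd ht) het
  rcases F.tri_cases he hi with ⟨j, hj, h⟩ | ⟨hc, h⟩
  · rw [h] at ht
    exact (Triangulation.not_mem_bulk_of_mem_bd ht (F.tri_succ_mem_bulkTriangles he hj)).elim
  · exact ⟨hc, h.imp (fun h => by rw [h]) fun h => by rw [h]⟩

theorem mem_bdEdges_iff (he : e ∈ K.edges) : e ∈ K.bdEdges ↔ ¬ F.Closed := by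
  rw [Triangulation.bdEdges, Finset.mem_filter]
  constructor
  · rintro ⟨-, t, ht, het⟩
    exact (F.eq_of_mem_bdTriangles he ht het).1
  · intro h
    exact ⟨he, F.tri 0, F.tri_zero_mem_bdTriangles he h, F.sub_tri 0⟩

theorem mem_bulkEdges_iff (he : e ∈ K.edges) : e ∈ K.bulkEdges ↔ F.Closed := by
  have h := F.mem_bdEdges_iff he
  rw [Triangulation.bdEdges, Finset.mem_filter, and_iff_right he] at h
  rw [Triangulation.bulkEdges, Finset.mem_filter, and_iff_right he, h, not_not]

end Fan

/-! #### Sums over incidences as sums along the dual faces -/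

namespace Triangulation

theorem sum_tets_of_sub {M : Type*} [AddCommMonoid M] (he : e ∈ K.edges) (F : Fan K.tets e)
    (f : Finset V → M) :
    ∑ T ∈ K.tets.filter (fun T => e ⊆ T), f T = ∑ i ∈ Finset.range F.len, f (F.tet i) := by
  rw [F.filter_tets_eq subset_rfl, Finset.filter_true_of_mem fun i _ => F.sub_tet i,
    Finset.sum_image]
  intro i hi j hj h
  exact F.tet_injOn he (Finset.mem_range.1 hi) (Finset.mem_range.1 hj) h

theorem sum_bulkTriangles_of_sub {M : Type*} [AddCommMonoid M] (he : e ∈ K.edges) (F : Fan K.tets e)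
    (f : Finset V → M) :
    ∑ t ∈ K.bulkTriangles.filter (fun t => e ⊆ t), f t =
      ∑ j ∈ Finset.range F.numBulk, f (F.tri (j + 1)) := by
  have h : K.bulkTriangles.filter (fun t => e ⊆ t) =
      (Finset.range F.numBulk).image fun j => F.tri (j + 1) := by
    ext t
    rw [Finset.mem_filter, Finset.mem_image]
    constructor
    · rintro ⟨ht, het⟩
      obtain ⟨j, hj, rfl⟩ := F.exists_of_mem_bulkTriangles he ht het
      exact ⟨j, Finset.mem_range.2 hj, rfl⟩
    · rintro ⟨j, hj, rfl⟩
      exact ⟨F.tri_succ_mem_bulkTriangles he (Finset.mem_range.1 hj), F.sub_tri _⟩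
  rw [h, Finset.sum_image]
  intro i hi j hj h
  exact F.tri_succ_injOn he ((Finset.mem_range.1 hi).trans_le F.numBulk_le)
    ((Finset.mem_range.1 hj).trans_le F.numBulk_le) h

/-- The triangles at an edge are `tri 1, …, tri len`, and `tri 0` if it is different from `tri len`. -/
theorem prod_triangles_of_sub {M : Type*} [CommMonoid M] (he : e ∈ K.edges) (F : Fan K.tets e)
    (f : Finset V → M) :
    ∏ t ∈ K.triangles.filter (fun t => e ⊆ t), f t =
      (∏ j ∈ Finset.range F.len, f (F.tri (j + 1))) *
        (haveI := Classical.dec F.Closed; if F.Closed then 1 else f (F.tri 0)) := by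
  have hinj : Set.InjOn (fun j => F.tri (j + 1)) (Finset.range F.len) := by
    intro i hi j hj h
    rw [Finset.mem_coe, Finset.mem_range] at hi hj
    exact F.tri_succ_injOn he hi hj h
  have hmem : ∀ t, t ∈ K.triangles.filter (fun t => e ⊆ t) ↔ ∃ i ≤ F.len, t = F.tri i := by
    intro t
    rw [Finset.mem_filter]
    constructor
    · rintro ⟨ht, het⟩
      exact F.exists_tri_of_mem_triangles he ht het
    · rintro ⟨i, hi, rfl⟩
      exact ⟨F.mem_triangles_tri he hi, F.sub_tri i⟩
  have h0 := F.len_pos he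
  split_ifs with hc
  · have h : K.triangles.filter (fun t => e ⊆ t) =
        (Finset.range F.len).image fun j => F.tri (j + 1) := by
      ext t
      rw [hmem, Finset.mem_image]
      constructor
      · rintro ⟨i, hi, rfl⟩
        rcases Nat.eq_zero_or_pos i with rfl | hpos
        · exact ⟨F.len - 1, Finset.mem_range.2 (by omega), by
            simp only [Nat.sub_add_cancel h0, F.tri_zero_eq_tri_len hc]⟩
        · exact ⟨i - 1, Finset.mem_range.2 (by omega), by simp only [Nat.sub_add_cancel hpos]⟩
      · rintro ⟨j, hj, rfl⟩
        exact ⟨j + 1, Finset.mem_range.1 hj, rfl⟩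
    rw [h, Finset.prod_image hinj, mul_one]
  · have h : K.triangles.filter (fun t => e ⊆ t) =
        insert (F.tri 0) ((Finset.range F.len).image fun j => F.tri (j + 1)) := by
      ext t
      rw [hmem, Finset.mem_insert, Finset.mem_image]
      constructor
      · rintro ⟨i, hi, rfl⟩
        rcases Nat.eq_zero_or_pos i with rfl | hpos
        · exact Or.inl rfl
        · exact Or.inr ⟨i - 1, Finset.mem_range.2 (by omega), by simp only [Nat.sub_add_cancel hpos]⟩
      · rintro (rfl | ⟨j, hj, rfl⟩)
        · exact ⟨0, Nat.zero_le _, rfl⟩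
        · exact ⟨j + 1, Finset.mem_range.1 hj, rfl⟩
    rw [h, Finset.prod_insert, Finset.prod_image hinj, mul_comm]
    rw [Finset.mem_image]
    rintro ⟨j, hj, h1⟩
    have hj' := Finset.mem_range.1 hj
    have h2 := F.simple 0 (j + 1) (by omega) hj'
      ((F.tri_eq_iff he (Nat.zero_le _)).1 h1.symm)
    rw [h2.2] at h1
    exact F.tri_zero_ne_tri_len he hc h1.symm

/-- A sum over the edges of all tetrahedra, sorted by dual faces. -/
theorem sum_tets_sum_edges {M : Type*} [AddCommMonoid M] (F : ∀ e : ↥K.edges, Fan K.tets e.1)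
    (f : Finset V → Finset V → M) :
    ∑ T ∈ K.tets, ∑ e ∈ T.powersetCard 2, f T e =
      ∑ e : ↥K.edges, ∑ i ∈ Finset.range (F e).len, f ((F e).tet i) e.1 := by
  have h1 : ∑ T ∈ K.tets, ∑ e ∈ T.powersetCard 2, f T e =
      ∑ e ∈ K.edges, ∑ T ∈ K.tets.filter (fun T => e ⊆ T), f T e := by
    refine Finset.sum_comm' fun T e => ?_
    rw [Finset.mem_powersetCard, Finset.mem_filter, mem_edges_iff]
    constructor
    · rintro ⟨hT, he, hc⟩
      exact ⟨⟨hT, he⟩, T, hT, he, hc⟩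
    · rintro ⟨⟨hT, he⟩, T', -, -, hc⟩
      exact ⟨hT, he, hc⟩
  rw [h1, ← Finset.sum_coe_sort K.edges]
  exact Finset.sum_congr rfl fun e _ => sum_tets_of_sub e.2 (F e) fun T => f T e.1

/-- A sum over the edges of all interior triangles, sorted by dual faces. -/
theorem sum_bulkTriangles_sum_edges {M : Type*} [AddCommMonoid M]
    (F : ∀ e : ↥K.edges, Fan K.tets e.1) (f : Finset V → Finset V → M) :
    ∑ t ∈ K.bulkTriangles, ∑ e ∈ t.powersetCard 2, f t e =
      ∑ e : ↥K.edges, ∑ j ∈ Finset.range (F e).numBulk, f ((F e).tri (j + 1)) e.1 := by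
  have h1 : ∑ t ∈ K.bulkTriangles, ∑ e ∈ t.powersetCard 2, f t e =
      ∑ e ∈ K.edges, ∑ t ∈ K.bulkTriangles.filter (fun t => e ⊆ t), f t e := by
    refine Finset.sum_comm' fun t e => ?_
    rw [Finset.mem_powersetCard, Finset.mem_filter, mem_edges_iff]
    constructor
    · rintro ⟨ht, he, hc⟩
      obtain ⟨T, hT, htT, -⟩ := mem_triangles_iff.1 (mem_triangles_of_bulk ht)
      exact ⟨⟨ht, he⟩, T, hT, he.trans htT, hc⟩
    · rintro ⟨⟨ht, he⟩, T', -, -, hc⟩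
      exact ⟨ht, he, hc⟩
  rw [h1, ← Finset.sum_coe_sort K.edges]
  exact Finset.sum_congr rfl fun e _ => sum_bulkTriangles_of_sub e.2 (F e) fun t => f t e.1

end Triangulation

end Combinatorics

end PonzanoRegge

namespace PonzanoRegge

namespace Triangulation

namespace Choices

variable {V : Type*} [DecidableEq V] {K : Triangulation V} (D : K.Choices)

/-! ### The spinor integral as an integral over dual faces -/

/-! #### Spinors along the dual faces -/

/-- The pairs of integrated spinors, sorted by the dual faces to which they belong. -/
abbrev FaceSpinors : Type _ := (e : ↥K.edges) → Fin (D.fan e).numBulk → SpinorPair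

/-- The label of a spinor at the `j`-th interior triangle around the edge `e`, on the side of the
tetrahedron before (`false`) or behind (`true`) that triangle. -/
def flagAt (e : ↥K.edges) (j : ℕ) (side : Bool) : Finset V × Finset V × Finset V :=
  ((D.fan e).tet (if side then (D.fan e).next j else j), (D.fan e).tri (j + 1), e.1)

theorem flagAt_mem (e : ↥K.edges) {j : ℕ} (hj : j < (D.fan e).numBulk) (side : Bool) :
    D.flagAt e j side ∈ K.bulkFlags := by
  have hl : j < (D.fan e).len := hj.trans_le (D.fan e).numBulk_le
  have hi : (if side then (D.fan e).next j else j) < (D.fan e).len := by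
    split_ifs
    · exact (D.fan e).next_lt e.2 hl
    · exact hl
  rw [bulkFlags, Finset.mem_filter, Finset.mem_product, Finset.mem_product]
  refine ⟨⟨(D.fan e).tet_mem hi, (D.fan e).tri_succ_mem_bulkTriangles e.2 hj, e.2⟩, ?_,
    (D.fan e).sub_tri _⟩
  refine ((D.fan e).tri_succ_sub_tet_iff e.2 hj hi).2 ?_
  cases side
  · exact Or.inl rfl
  · exact Or.inr rfl

theorem exists_flagAt {p : Finset V × Finset V × Finset V} (hp : p ∈ K.bulkFlags) (e : ↥K.edges)
    (he : p.2.2 = e.1) : ∃ (j : Fin (D.fan e).numBulk) (side : Bool), D.flagAt e j side = p := by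
  rw [bulkFlags, Finset.mem_filter, Finset.mem_product, Finset.mem_product] at hp
  obtain ⟨⟨hT, ht, -⟩, htT, het⟩ := hp
  obtain ⟨T, t, e'⟩ := p
  subst he
  obtain ⟨j, hj, rfl⟩ := (D.fan e).exists_of_mem_bulkTriangles e.2 ht het
  obtain ⟨i, hi, rfl⟩ := (D.fan e).cover T hT (het.trans htT)
  rcases ((D.fan e).tri_succ_sub_tet_iff e.2 hj hi).1 htT with rfl | rfl
  · exact ⟨⟨i, hj⟩, false, rfl⟩
  · exact ⟨⟨j, hj⟩, true, rfl⟩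

/-- Every integrated spinor belongs to exactly one position on one dual face. -/
theorem flagAt_bijective : Function.Bijective
    fun s : (Σ e : ↥K.edges, Fin (D.fan e).numBulk × Bool) =>
      (⟨D.flagAt s.1 s.2.1 s.2.2, D.flagAt_mem s.1 s.2.1.2 s.2.2⟩ : ↥K.bulkFlags) := by
  constructor
  · rintro ⟨e, j, a⟩ ⟨e', j', a'⟩ h
    have h' : D.flagAt e j a = D.flagAt e' j' a' := congrArg Subtype.val h
    obtain rfl : e = e' := Subtype.ext (congrArg (fun p => p.2.2) h')
    have hj := j.2.trans_le (D.fan e).numBulk_le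
    have ht : (D.fan e).tri (j + 1) = (D.fan e).tri (j' + 1) := congrArg (fun p => p.2.1) h'
    obtain rfl : j = j' := Fin.ext ((D.fan e).tri_succ_injOn e.2 hj
      (j'.2.trans_le (D.fan e).numBulk_le) ht)
    have hT : (D.fan e).tet (if a then (D.fan e).next j else j) =
      (D.fan e).tet (if a' then (D.fan e).next j else j) := congrArg (fun p => p.1) h'
    have hn := (D.fan e).next_lt e.2 hj
    have hne := (D.fan e).next_ne j.2
    cases a <;> cases a'
    · rfl
    · exact (hne ((D.fan e).tet_injOn e.2 hj hn hT).symm).elim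
    · exact (hne ((D.fan e).tet_injOn e.2 hn hj hT)).elim
    · rfl
  · rintro ⟨p, hp⟩
    have he : p.2.2 ∈ K.edges := by
      rw [bulkFlags, Finset.mem_filter, Finset.mem_product, Finset.mem_product] at hp
      exact hp.1.2.2
    obtain ⟨j, a, h⟩ := D.exists_flagAt hp ⟨p.2.2, he⟩ rfl
    exact ⟨⟨⟨p.2.2, he⟩, j, a⟩, Subtype.ext h⟩

/-- The labels of the integrated spinors, sorted by dual faces. -/
noncomputable def flagEquiv : (Σ e : ↥K.edges, Fin (D.fan e).numBulk × Bool) ≃ ↥K.bulkFlags :=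
  Equiv.ofBijective _ D.flagAt_bijective

/-- The integrated spinors as a function of their labels. -/
noncomputable def flagSpinors : D.FaceSpinors ≃ᵐ (↥K.bulkFlags → Spinor) where
  toFun y f := pairSide (D.flagEquiv.symm f).2.2 (y (D.flagEquiv.symm f).1 (D.flagEquiv.symm f).2.1)
  invFun z e j := (z (D.flagEquiv ⟨e, j, false⟩), z (D.flagEquiv ⟨e, j, true⟩))
  left_inv y := by
    funext e j
    change (pairSide (D.flagEquiv.symm (D.flagEquiv ⟨e, j, false⟩)).2.2 _,
      pairSide (D.flagEquiv.symm (D.flagEquiv ⟨e, j, true⟩)).2.2 _) = _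
    rw [Equiv.symm_apply_apply, Equiv.symm_apply_apply]
    rfl
  right_inv z := by
    funext f
    obtain ⟨⟨e, j, side⟩, rfl⟩ := D.flagEquiv.surjective f
    change pairSide (D.flagEquiv.symm (D.flagEquiv ⟨e, j, side⟩)).2.2 _ = _
    rw [Equiv.symm_apply_apply]
    cases side <;> rfl
  measurable_toFun := by
    refine measurable_pi_lambda _ fun f => ?_
    exact (continuous_pairSide _).measurable.comp
      ((measurable_pi_apply _).comp (measurable_pi_apply _))
  measurable_invFun := by
    refine measurable_pi_lambda _ fun e => measurable_pi_lambda _ fun j => ?_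
    exact (measurable_pi_apply _).prodMk (measurable_pi_apply _)

theorem flagSpinors_apply (y : D.FaceSpinors) (e : ↥K.edges) (j : Fin (D.fan e).numBulk)
    (side : Bool) : D.flagSpinors y (D.flagEquiv ⟨e, j, side⟩) = pairSide side (y e j) := by
  change pairSide (D.flagEquiv.symm _).2.2 _ = _
  rw [Equiv.symm_apply_apply]

/-- The Gaussian measure on the spinors, sorted by dual faces. -/
noncomputable def faceMeasure : Measure D.FaceSpinors :=
  Measure.pi fun _ => Measure.pi fun _ => pairMeasure

theorem measurePreserving_flagSpinors :
    MeasurePreserving D.flagSpinors D.faceMeasure (Measure.pi fun _ => spinorMeasure) := by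
  refine ⟨D.flagSpinors.measurable, ?_⟩
  refine (Measure.pi_eq fun s hs => ?_).symm
  rw [Measure.map_apply D.flagSpinors.measurable (MeasurableSet.univ_pi hs)]
  have hpre : D.flagSpinors ⁻¹' Set.univ.pi s = Set.univ.pi fun e => Set.univ.pi fun j =>
      s (D.flagEquiv ⟨e, j, false⟩) ×ˢ s (D.flagEquiv ⟨e, j, true⟩) := by
    ext y
    simp only [Set.mem_preimage, Set.mem_univ_pi, Set.mem_prod]
    constructor
    · intro h e j
      exact ⟨by simpa [flagSpinors_apply, pairSide] using h (D.flagEquiv ⟨e, j, false⟩),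
        by simpa [flagSpinors_apply, pairSide] using h (D.flagEquiv ⟨e, j, true⟩)⟩
    · intro h f
      obtain ⟨⟨e, j, side⟩, rfl⟩ := D.flagEquiv.surjective f
      rw [flagSpinors_apply]
      cases side
      · exact (h e j).1
      · exact (h e j).2
  rw [hpre, faceMeasure, Measure.pi_pi]
  simp_rw [Measure.pi_pi, pairMeasure, Measure.prod_prod]
  rw [← Equiv.prod_comp D.flagEquiv, Fintype.prod_sigma]
  refine Finset.prod_congr rfl fun e _ => ?_
  rw [Fintype.prod_prod_type]
  refine Finset.prod_congr rfl fun j _ => ?_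
  rw [Fintype.prod_bool, mul_comm]

variable (ζ : Finset V → Finset V → Spinor)

theorem spinorAt_flagAt (y : D.FaceSpinors) (e : ↥K.edges) {j : ℕ} (hj : j < (D.fan e).numBulk)
    (side : Bool) : spinorAt ζ (D.flagSpinors y) (D.flagAt e j side).1 (D.flagAt e j side).2.1
      (D.flagAt e j side).2.2 = pairSide side (pairExt (y e) j) := by
  rw [spinorAt, dif_pos (D.flagAt_mem e hj side), pairExt, dif_pos hj]
  exact D.flagSpinors_apply y e ⟨j, hj⟩ side

theorem spinorAt_bdTriangle (z : ↥K.bulkFlags → Spinor) (T t e : Finset V) (ht : t ∈ K.bdTriangles) :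
    spinorAt ζ z T t e = ζ t e := by
  rw [spinorAt, dif_neg]
  intro h
  rw [bulkFlags, Finset.mem_filter, Finset.mem_product, Finset.mem_product] at h
  exact not_mem_bulk_of_mem_bd ht h.1.2.1

theorem spinorAt_tri_succ (y : D.FaceSpinors) (e : ↥K.edges) {i : ℕ} (hi : i < (D.fan e).len) :
    spinorAt ζ (D.flagSpinors y) ((D.fan e).tet i) ((D.fan e).tri (i + 1)) e =
      chainRight (ζ ((D.fan e).tri (D.fan e).len) e) (y e) i := by
  unfold chainRight
  split_ifs with h
  · exact D.spinorAt_flagAt ζ y e h false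
  · have hc : ¬ (D.fan e).Closed := fun hc => by rw [Fan.numBulk_of_closed _ hc] at h; omega
    have hn := (D.fan e).numBulk_of_not_closed e.2 hc
    have h1 : i + 1 = (D.fan e).len := by omega
    rw [h1]
    exact spinorAt_bdTriangle ζ _ _ _ _ ((D.fan e).tri_len_mem_bdTriangles e.2 hc)

theorem spinorAt_tri_of_closed (y : D.FaceSpinors) (e : ↥K.edges) (hc : (D.fan e).Closed) {i : ℕ}
    (hi : i < (D.fan e).len) :
    spinorAt ζ (D.flagSpinors y) ((D.fan e).tet i) ((D.fan e).tri i) e =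
      chainLeft (pairExt (y e) ((D.fan e).numBulk - 1)).2 (y e) i := by
  have hn := (D.fan e).numBulk_of_closed hc
  have h0 := (D.fan e).len_pos e.2
  unfold chainLeft
  split_ifs with h
  · subst h
    have h1 : (D.fan e).next ((D.fan e).numBulk - 1) = 0 := by
      rw [Fan.next, if_pos (by omega)]
    have := D.spinorAt_flagAt ζ y e (j := (D.fan e).numBulk - 1) (by omega) true
    simp only [flagAt, if_true, h1] at this
    rw [show (D.fan e).numBulk - 1 + 1 = (D.fan e).len by omega,
      ← (D.fan e).tri_zero_eq_tri_len hc] at this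
    exact this
  · have h1 : (D.fan e).next (i - 1) = i := by
      rw [Fan.next, if_neg (by omega)]; omega
    have := D.spinorAt_flagAt ζ y e (j := i - 1) (by omega) true
    simp only [flagAt, if_true, h1] at this
    rw [show i - 1 + 1 = i by omega] at this
    exact this

theorem spinorAt_tri_of_not_closed (y : D.FaceSpinors) (e : ↥K.edges) (hc : ¬ (D.fan e).Closed)
    {i : ℕ} (hi : i < (D.fan e).len) :
    spinorAt ζ (D.flagSpinors y) ((D.fan e).tet i) ((D.fan e).tri i) e =
      chainLeft (ζ ((D.fan e).tri 0) e) (y e) i := by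
  have hn := (D.fan e).numBulk_of_not_closed e.2 hc
  unfold chainLeft
  split_ifs with h
  · subst h
    exact spinorAt_bdTriangle ζ _ _ _ _ ((D.fan e).tri_zero_mem_bdTriangles e.2 hc)
  · have h1 : (D.fan e).next (i - 1) = i := by
      rw [Fan.next, if_neg (by omega)]; omega
    have := D.spinorAt_flagAt ζ y e (j := i - 1) (by omega) true
    simp only [flagAt, if_true, h1] at this
    rw [show i - 1 + 1 = i by omega] at this
    exact this

/-! #### Vertex amplitudes as group integrals -/

variable (K) in
/-- The group elements of the vertex amplitudes: one for each triangle of each tetrahedron. -/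
abbrev NodeElts : Type _ := (T : ↥K.tets) → ↥(T.1.powersetCard 3) → SU2

variable (K) in
/-- The Haar measure on the group elements of the vertex amplitudes. -/
noncomputable def nodeMeasure : Measure (NodeElts K) := Measure.pi fun _ => Measure.pi fun _ => haar

instance : IsProbabilityMeasure (nodeMeasure K) := by unfold nodeMeasure; infer_instance

/-- The group element at the triangle `t` of the tetrahedron `T`. -/
noncomputable def nodeElt (h : NodeElts K) (T t : Finset V) : SU2 :=
  if hT : T ∈ K.tets then if ht : t ∈ T.powersetCard 3 then h ⟨T, hT⟩ ⟨t, ht⟩ else 1 else 1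

theorem nodeElt_eq (h : NodeElts K) (T : ↥K.tets) (t : ↥(T.1.powersetCard 3)) :
    nodeElt h T t = h T t := by
  rw [nodeElt, dif_pos T.2, dif_pos t.2]

theorem continuous_nodeElt (T t : Finset V) : Continuous fun h : NodeElts K => nodeElt h T t := by
  unfold nodeElt
  split_ifs
  · exact (continuous_apply _).comp (continuous_apply _)
  · exact continuous_const
  · exact continuous_const

/-- The exponent belonging to the link dual to the edge `e` in the boundary graph of `T`. -/
noncomputable def linkAction (w : Finset V → Finset V → Finset V → Spinor) (h : NodeElts K)
    (T e : Finset V) : ℂ :=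
  dualBraket (w T (D.linkTgt T e) e)
    ((nodeElt h T (D.linkTgt T e))⁻¹ * nodeElt h T (D.linkSrc T e)) (w T (D.linkSrc T e) e)

/-- The vertex amplitudes are independent integrals over the elements at the nodes of their
tetrahedra. -/
theorem prod_vertexAmplitude (w : Finset V → Finset V → Finset V → Spinor) :
    ∏ T : ↥K.tets, D.vertexAmplitude w T =
      ∫ h, Complex.exp (∑ T ∈ K.tets, ∑ e ∈ T.powersetCard 2, D.linkAction w h T e)
        ∂(nodeMeasure K) := by
  have h1 := integral_fintype_prod_eq_prod (𝕜 := ℂ)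
    (μ := fun T : ↥K.tets => (Measure.pi fun _ : ↥(T.1.powersetCard 3) => haar))
    (fun (T : ↥K.tets) (h : ↥(T.1.powersetCard 3) → SU2) =>
      Complex.exp (∑ l : ↥(T.1.powersetCard 2), dualBraket (w T.1 (D.linkTgt T.1 l.1) l.1)
        ((h ⟨D.linkTgt T.1 l.1, D.linkTgt_mem T.1 T.2 l.1 l.2⟩)⁻¹ * (1 : SU2) *
          h ⟨D.linkSrc T.1 l.1, D.linkSrc_mem T.1 T.2 l.1 l.2⟩) (w T.1 (D.linkSrc T.1 l.1) l.1)))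
  refine Eq.trans h1.symm ?_
  rw [nodeMeasure]
  congr 1
  ext h
  rw [← Complex.exp_sum, ← Finset.sum_coe_sort K.tets]
  congr 1
  refine Finset.sum_congr rfl fun T _ => ?_
  rw [← Finset.sum_coe_sort (T.1.powersetCard 2)]
  refine Finset.sum_congr rfl fun l _ => ?_
  rw [linkAction, nodeElt_eq h T ⟨_, D.linkTgt_mem T.1 T.2 l.1 l.2⟩,
    nodeElt_eq h T ⟨_, D.linkSrc_mem T.1 T.2 l.1 l.2⟩, mul_one]

/-! #### Orientation signs -/

/-- The sign for traversing the link of the `i`-th tetrahedron: `-1` if the link is traversed from its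
source to its target. -/
noncomputable def linkSign (e : ↥K.edges) (i : ℕ) : ℤˣ :=
  if D.linkSrc ((D.fan e).tet i) e.1 = (D.fan e).tri i then -1 else 1

/-- The sign for crossing the triangle `tri (j + 1)`: `-1` if the dual edge is traversed against its
orientation. -/
noncomputable def crossSign (e : ↥K.edges) (j : ℕ) : ℤˣ :=
  if D.src ((D.fan e).tri (j + 1)) = (D.fan e).tet j then 1 else -1

/-- The group element picked up in the `i`-th tetrahedron around `e`. -/
noncomputable def linkElt (h : NodeElts K) (e : ↥K.edges) (i : ℕ) : SU2 :=
  (nodeElt h ((D.fan e).tet i) ((D.fan e).tri i))⁻¹ *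
    nodeElt h ((D.fan e).tet i) ((D.fan e).tri (i + 1))

theorem continuous_linkElt (e : ↥K.edges) (i : ℕ) :
    Continuous fun h : NodeElts K => D.linkElt h e i :=
  (continuous_nodeElt _ _).inv.mul (continuous_nodeElt _ _)

theorem mem_powersetCard_tet (e : ↥K.edges) {i : ℕ} (hi : i < (D.fan e).len) :
    (D.fan e).tet i ∈ K.tets ∧ e.1 ∈ ((D.fan e).tet i).powersetCard 2 :=
  ⟨(D.fan e).tet_mem hi,
    Finset.mem_powersetCard.2 ⟨(D.fan e).sub_tet i, card_of_mem_edges e.2⟩⟩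

/-- The exponent of a link in the direction in which the dual face is traversed. -/
theorem linkAction_eq (w : Finset V → Finset V → Finset V → Spinor) (h : NodeElts K)
    (e : ↥K.edges) {i : ℕ} (hi : i < (D.fan e).len) :
    D.linkAction w h ((D.fan e).tet i) e = ((D.linkSign e i : ℤ) : ℂ) *
      dualBraket (w ((D.fan e).tet i) ((D.fan e).tri i) e) (D.linkElt h e i)
        (w ((D.fan e).tet i) ((D.fan e).tri (i + 1)) e) := by
  obtain ⟨hT, he⟩ := D.mem_powersetCard_tet e hi
  have hs := Finset.mem_powersetCard.1 (D.linkSrc_mem _ hT _ he)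
  have ht := Finset.mem_powersetCard.1 (D.linkTgt_mem _ hT _ he)
  obtain ⟨hes, het, hne⟩ := D.link_sub _ hT _ he
  have hs' := (D.fan e).eq_tri_or_of_sub_tet e.2 hs.1 hs.2 hes
  have ht' := (D.fan e).eq_tri_or_of_sub_tet e.2 ht.1 ht.2 het
  rw [linkAction, linkSign, linkElt]
  rcases hs' with hs' | hs' <;> rcases ht' with ht' | ht'
  · exact (hne (hs'.trans ht'.symm)).elim
  · rw [hs', ht', if_pos rfl, dualBraket_swap, mul_inv_rev, inv_inv]
    simp
  · rw [hs', ht', if_neg]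
    · simp
    · intro h1
      exact hne (hs'.trans (h1.trans ht'.symm))
  · exact (hne (hs'.trans ht'.symm)).elim

/-- The tetrahedra on the two sides of an interior triangle on a dual face are the source and the target
of its dual edge, in one order or the other. -/
theorem src_tgt_cases (e : ↥K.edges) {j : ℕ} (hj : j < (D.fan e).numBulk) :
    (D.src ((D.fan e).tri (j + 1)) = (D.fan e).tet j ∧
        D.tgt ((D.fan e).tri (j + 1)) = (D.fan e).tet ((D.fan e).next j)) ∨
      (D.src ((D.fan e).tri (j + 1)) = (D.fan e).tet ((D.fan e).next j) ∧
        D.tgt ((D.fan e).tri (j + 1)) = (D.fan e).tet j ∧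
        D.src ((D.fan e).tri (j + 1)) ≠ (D.fan e).tet j) := by
  have hb := (D.fan e).tri_succ_mem_bulkTriangles e.2 hj
  obtain ⟨hs, hts⟩ := D.src_mem _ (mem_triangles_of_bulk hb)
  obtain ⟨ht, htt, hne⟩ := D.tgt_mem _ hb
  have key : ∀ T ∈ K.tets, (D.fan e).tri (j + 1) ⊆ T →
      T = (D.fan e).tet j ∨ T = (D.fan e).tet ((D.fan e).next j) := by
    intro T hT htT
    obtain ⟨i, hi, rfl⟩ := (D.fan e).cover T hT (((D.fan e).sub_tri _).trans htT)
    rcases ((D.fan e).tri_succ_sub_tet_iff e.2 hj hi).1 htT with rfl | rfl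
    · exact Or.inl rfl
    · exact Or.inr rfl
  rcases key _ hs hts with h1 | h1 <;> rcases key _ ht htt with h2 | h2
  · exact (hne (h2.trans h1.symm)).elim
  · exact Or.inl ⟨h1, h2⟩
  · exact Or.inr ⟨h1, h2, fun h3 => hne (h2.trans h3.symm)⟩
  · exact (hne (h2.trans h1.symm)).elim

/-- The exponent of the edge amplitude in the direction in which the dual face is traversed. -/
theorem braket_cross_eq (w : Finset V → Finset V → Finset V → Spinor) (e : ↥K.edges) {j : ℕ}
    (hj : j < (D.fan e).numBulk) :
    braket (w (D.src ((D.fan e).tri (j + 1))) ((D.fan e).tri (j + 1)) e)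
        (dual (w (D.tgt ((D.fan e).tri (j + 1))) ((D.fan e).tri (j + 1)) e)) =
      ((D.crossSign e j : ℤ) : ℂ) * braket (w ((D.fan e).tet j) ((D.fan e).tri (j + 1)) e)
        (dual (w ((D.fan e).tet ((D.fan e).next j)) ((D.fan e).tri (j + 1)) e)) := by
  rw [crossSign]
  rcases D.src_tgt_cases e hj with ⟨h1, h2⟩ | ⟨h1, h2, h3⟩
  · rw [if_pos h1, h1, h2]; simp
  · rw [if_neg h3, h1, h2, braket_dual_swap]; simp

/-! #### The integrand along one dual face -/

/-- The coefficient of the contraction at the `j`-th interior triangle around `e`. -/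
noncomputable def crossCoeff (r : ↥K.bulkEdges → ℝ) (e : ↥K.edges) (j : ℕ) : ℂ :=
  (damping r e.1 : ℂ) * ((D.crossSign e j : ℤ) : ℂ)

open Classical in
/-- The exponent of the spinor integrand along the dual face of `e`. -/
noncomputable def faceAction (r : ↥K.bulkEdges → ℝ) (e : ↥K.edges)
    (A : ℕ → SU2) (p : Fin (D.fan e).numBulk → SpinorPair) : ℂ :=
  if (D.fan e).Closed then
    loopAction (fun i => ((D.linkSign e i : ℤ) : ℂ)) (D.crossCoeff r e) A p
  else
    chainAction (fun i => ((D.linkSign e i : ℤ) : ℂ)) (D.crossCoeff r e) A (ζ ((D.fan e).tri 0) e)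
      (ζ ((D.fan e).tri (D.fan e).len) e) p

/-- The exponents of the edge and vertex amplitudes, sorted by dual faces. -/
theorem sum_faceAction (r : ↥K.bulkEdges → ℝ) (y : D.FaceSpinors) (h : NodeElts K) :
    ∑ t ∈ K.bulkTriangles, ∑ e ∈ t.powersetCard 2, (damping r e : ℂ) *
        braket (spinorAt ζ (D.flagSpinors y) (D.src t) t e)
          (dual (spinorAt ζ (D.flagSpinors y) (D.tgt t) t e)) +
      ∑ T ∈ K.tets, ∑ e ∈ T.powersetCard 2, D.linkAction (spinorAt ζ (D.flagSpinors y)) h T e =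
      ∑ e : ↥K.edges, D.faceAction ζ r e (D.linkElt h e) (y e) := by
  rw [sum_bulkTriangles_sum_edges D.fan fun t e => (damping r e : ℂ) *
        braket (spinorAt ζ (D.flagSpinors y) (D.src t) t e)
          (dual (spinorAt ζ (D.flagSpinors y) (D.tgt t) t e)),
    sum_tets_sum_edges D.fan, ← Finset.sum_add_distrib]
  refine Finset.sum_congr rfl fun e _ => ?_
  rw [add_comm]
  have hcross : ∑ j ∈ Finset.range (D.fan e).numBulk, (damping r e.1 : ℂ) *
        braket (spinorAt ζ (D.flagSpinors y) (D.src ((D.fan e).tri (j + 1))) ((D.fan e).tri (j + 1)) e)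
          (dual (spinorAt ζ (D.flagSpinors y) (D.tgt ((D.fan e).tri (j + 1)))
            ((D.fan e).tri (j + 1)) e)) =
      ∑ j ∈ Finset.range (D.fan e).numBulk, D.crossCoeff r e j *
        braket (pairExt (y e) j).1 (dual (pairExt (y e) j).2) := by
    refine Finset.sum_congr rfl fun j hj => ?_
    have hj := Finset.mem_range.1 hj
    have h1 : spinorAt ζ (D.flagSpinors y) ((D.fan e).tet j) ((D.fan e).tri (j + 1)) e =
        (pairExt (y e) j).1 := D.spinorAt_flagAt ζ y e hj false
    have h2 : spinorAt ζ (D.flagSpinors y) ((D.fan e).tet ((D.fan e).next j))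
        ((D.fan e).tri (j + 1)) e = (pairExt (y e) j).2 := D.spinorAt_flagAt ζ y e hj true
    rw [D.braket_cross_eq _ e hj, h1, h2, crossCoeff, mul_assoc]
  rw [hcross]
  unfold faceAction
  split_ifs with hc
  · have hn := (D.fan e).numBulk_of_closed hc
    rw [loopAction]
    congr 1
    refine Finset.sum_congr (congrArg Finset.range hn.symm) fun i hi => ?_
    have hb := Finset.mem_range.1 hi
    have hi : i < (D.fan e).len := hn ▸ hb
    rw [D.linkAction_eq _ h e hi, D.spinorAt_tri_succ ζ y e hi,
      D.spinorAt_tri_of_closed ζ y e hc hi, chainRight, if_pos hb]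
  · have hn := (D.fan e).numBulk_of_not_closed e.2 hc
    rw [chainAction]
    congr 1
    refine Finset.sum_congr (congrArg Finset.range hn.symm) fun i hi => ?_
    rw [hn] at hi
    have hi := Finset.mem_range.1 hi
    rw [D.linkAction_eq _ h e hi, D.spinorAt_tri_succ ζ y e hi,
      D.spinorAt_tri_of_not_closed ζ y e hc hi]

end Choices

end Triangulation

end PonzanoRegge

namespace PonzanoRegge

namespace Triangulation

namespace Choices

variable {V : Type*} [DecidableEq V] {K : Triangulation V} (D : K.Choices)
  (ζ : Finset V → Finset V → Spinor)

/-! #### Integration over the spinors of one dual face -/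

theorem exists_base (e : ↥K.edges) (hc : (D.fan e).Closed) :
    ∃ s : Fin (D.fan e).numBulk × Bool,
      D.flagAt e s.1 s.2 = (D.baseTet e.1, D.baseTri e.1, e.1) := by
  have he := ((D.fan e).mem_bulkEdges_iff e.2).2 hc
  obtain ⟨hT, ht, het⟩ := D.base_mem _ he
  have htT := Finset.mem_powersetCard.1 ht
  have hmem : D.baseTri e.1 ∈ K.triangles := mem_triangles_iff.2 ⟨_, hT, htT⟩
  have hb : (D.baseTet e.1, D.baseTri e.1, e.1) ∈ K.bulkFlags := by
    rw [bulkFlags, Finset.mem_filter, Finset.mem_product, Finset.mem_product]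
    refine ⟨⟨hT, ?_, e.2⟩, htT.1, het⟩
    obtain ⟨i, hi, h⟩ := (D.fan e).exists_tri_of_mem_triangles e.2 hmem het
    rcases (D.fan e).tri_cases e.2 hi with ⟨j, hj, hij⟩ | ⟨h', -⟩
    · rw [h, hij]
      exact (D.fan e).tri_succ_mem_bulkTriangles e.2 hj
    · exact (h' hc).elim
  obtain ⟨j, side, h⟩ := D.exists_flagAt hb e rfl
  exact ⟨(j, side), h⟩

/-- The position, on the dual face of the interior edge `e`, of the spinor in the face amplitude. -/
noncomputable def basePos (e : ↥K.edges) (hc : (D.fan e).Closed) : Fin (D.fan e).numBulk × Bool :=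
  (D.exists_base e hc).choose

open Classical in
/-- The face amplitude of an interior edge, as a function of the spinors along its dual face (and `1`
for an edge in the boundary). -/
noncomputable def facePrefactor (e : ↥K.edges) (p : Fin (D.fan e).numBulk → SpinorPair) : ℂ :=
  if hc : (D.fan e).Closed then
    braket (pairSide (D.basePos e hc).2 (p (D.basePos e hc).1))
      (pairSide (D.basePos e hc).2 (p (D.basePos e hc).1)) - 1
  else 1

theorem prod_faceAmplitude (y : D.FaceSpinors) :
    ∏ e ∈ K.bulkEdges, D.faceAmplitude (spinorAt ζ (D.flagSpinors y)) e =
      ∏ e : ↥K.edges, D.facePrefactor e (y e) := by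
  classical
  rw [bulkEdges, Finset.prod_filter, ← Finset.prod_coe_sort]
  refine Finset.prod_congr rfl fun e _ => ?_
  have hiff : (¬ ∃ t ∈ K.bdTriangles, e.1 ⊆ t) ↔ (D.fan e).Closed := by
    rw [← (D.fan e).mem_bulkEdges_iff e.2, bulkEdges, Finset.mem_filter]
    exact ⟨fun h => ⟨e.2, h⟩, fun h => h.2⟩
  by_cases hc : (D.fan e).Closed
  · rw [if_pos (hiff.2 hc), facePrefactor, dif_pos hc, faceAmplitude]
    have hs := (D.exists_base e hc).choose_spec
    change D.flagAt e (D.basePos e hc).1 (D.basePos e hc).2 = _ at hs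
    have h := D.spinorAt_flagAt ζ y e (D.basePos e hc).1.2 (D.basePos e hc).2
    rw [hs, pairExt, dif_pos (D.basePos e hc).1.2] at h
    rw [show spinorAt ζ (D.flagSpinors y) (D.baseTet e.1) (D.baseTri e.1) e.1 = _ from h]
  · rw [if_neg fun h => hc (hiff.1 h), facePrefactor, dif_neg hc]

/-- The integrand along the dual face of `e`, after the vertex amplitudes are written as integrals over
group elements. -/
noncomputable def faceFactor (r : ↥K.bulkEdges → ℝ) (e : ↥K.edges) (A : ℕ → SU2)
    (p : Fin (D.fan e).numBulk → SpinorPair) : ℂ :=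
  D.facePrefactor e p * Complex.exp (D.faceAction ζ r e A p)

/-- For fixed group elements, the integrand of the spinor integral is a product over the dual faces. -/
theorem spinorIntegrand_flagSpinors (r : ↥K.bulkEdges → ℝ) (y : D.FaceSpinors) :
    D.spinorIntegrand ζ r (D.flagSpinors y) =
      ∫ h, ∏ e : ↥K.edges, D.faceFactor ζ r e (D.linkElt h e) (y e) ∂(nodeMeasure K) := by
  rw [spinorIntegrand, prod_faceAmplitude, prod_vertexAmplitude, ← integral_const_mul]
  refine integral_congr_ae (Eventually.of_forall fun h => ?_)
  simp only [edgeAmplitude, faceFactor]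
  rw [Finset.prod_mul_distrib, ← Complex.exp_sum, ← Complex.exp_sum, mul_assoc, ← Complex.exp_add,
    D.sum_faceAction ζ r y h]

variable {r : ↥K.bulkEdges → ℝ}

theorem norm_units_coe (s : ℤˣ) : ‖((s : ℤ) : ℂ)‖ = 1 := by
  rcases Int.units_eq_one_or s with rfl | rfl <;> simp

theorem damping_of_closed (e : ↥K.edges) (hc : (D.fan e).Closed) :
    damping r e.1 = r ⟨e.1, ((D.fan e).mem_bulkEdges_iff e.2).2 hc⟩ :=
  dif_pos _

theorem damping_of_not_closed (e : ↥K.edges) (hc : ¬ (D.fan e).Closed) : damping r e.1 = 1 :=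
  dif_neg fun h => hc (((D.fan e).mem_bulkEdges_iff e.2).1 h)

theorem norm_crossCoeff (e : ↥K.edges) (j : ℕ) : ‖D.crossCoeff r e j‖ = |damping r e.1| := by
  rw [crossCoeff, norm_mul, norm_units_coe, mul_one, Complex.norm_real, Real.norm_eq_abs]

/-- Domination uniform in the group elements. It is here that the interior faces need the damping. -/
theorem exists_norm_faceFactor_le (hr : ∀ e, r e ∈ Set.Ioo (0 : ℝ) 1) (e : ↥K.edges) :
    ∃ B : (Fin (D.fan e).numBulk → SpinorPair) → ℝ,
      Integrable B (Measure.pi fun _ => pairMeasure) ∧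
      ∀ A p, ‖D.faceFactor ζ r e A p‖ ≤ B p := by
  by_cases hc : (D.fan e).Closed
  · obtain ⟨h0, h1⟩ := hr ⟨e.1, ((D.fan e).mem_bulkEdges_iff e.2).2 hc⟩
    obtain ⟨κ, C, hκ, h⟩ := exists_norm_loop_le (D.fan e).numBulk h0.le h1
    refine ⟨_, (integrable_exp_pairNormSq hκ).const_mul C, fun A p => ?_⟩
    rw [faceFactor, facePrefactor, dif_pos hc, faceAction, if_pos hc]
    refine h _ _ A p _ _ (fun i => (norm_units_coe _).le) fun j => ?_
    rw [norm_crossCoeff, D.damping_of_closed e hc, abs_of_pos h0]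
  · obtain ⟨κ, C, hκ, h⟩ := exists_norm_exp_chainAction_le (D.fan e).numBulk (ζ ((D.fan e).tri 0) e)
      (ζ ((D.fan e).tri (D.fan e).len) e)
    refine ⟨_, (integrable_exp_pairNormSq hκ).const_mul C, fun A p => ?_⟩
    rw [faceFactor, facePrefactor, dif_neg hc, faceAction, if_neg hc, one_mul]
    refine h _ _ A p (fun i => (norm_units_coe _).le) fun j => ?_
    rw [norm_crossCoeff, D.damping_of_not_closed e hc, abs_one]

theorem continuous_faceFactor (e : ↥K.edges) {X : Type*} [TopologicalSpace X] {A : X → ℕ → SU2}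
    (hA : ∀ i, Continuous fun x => A x i) {p : X → Fin (D.fan e).numBulk → SpinorPair}
    (hp : Continuous p) : Continuous fun x => D.faceFactor ζ r e (A x) (p x) := by
  unfold faceFactor
  refine Continuous.mul ?_ (Complex.continuous_exp.comp ?_)
  · unfold facePrefactor
    split_ifs with hc
    · have h : Continuous fun x => pairSide (D.basePos e hc).2 (p x (D.basePos e hc).1) :=
        (continuous_pairSide _).comp ((continuous_apply _).comp hp)
      exact (h.braket h).sub continuous_const
    · exact continuous_const
  · unfold faceAction
    split_ifs with hc
    · exact continuous_loopAction _ _ hA hp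
    · exact continuous_chainAction _ _ hA _ _ hp

/-- The orientation sign picked up along the dual face of `e`. -/
noncomputable def faceSign (e : ↥K.edges) : ℤˣ :=
  (∏ i ∈ Finset.range (D.fan e).len, D.linkSign e i) *
    ∏ j ∈ Finset.range (D.fan e).numBulk, D.crossSign e j

theorem prod_linkSign_mul_prod_crossCoeff (e : ↥K.edges) :
    (∏ i ∈ Finset.range (D.fan e).len, ((D.linkSign e i : ℤ) : ℂ)) *
        ∏ j ∈ Finset.range (D.fan e).numBulk, D.crossCoeff r e j =
      (damping r e.1 : ℂ) ^ (D.fan e).numBulk * ((D.faceSign e : ℤ) : ℂ) := by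
  simp only [crossCoeff, faceSign, Finset.prod_mul_distrib, Finset.prod_const, Finset.card_range]
  push_cast
  ring

theorem poissonKernel_units_mul (s : ℤˣ) (q τ : ℂ) :
    poissonKernel (q * ((s : ℤ) : ℂ)) τ = poissonKernel q (((s : ℤ) : ℂ) * τ) := by
  rcases Int.units_eq_one_or s with rfl | rfl <;> simp [poissonKernel]

/-- The group element around a dual face in terms of the group elements of the vertex amplitudes. -/
noncomputable def faceElt (h : NodeElts K) (e : ↥K.edges) : SU2 :=
  (List.ofFn fun i : Fin (D.fan e).len => D.linkElt h e i).prod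

/-- The spinor integral along a closed dual face is the damped delta distribution of its holonomy. -/
theorem integral_faceFactor_of_closed (hr : ∀ e, r e ∈ Set.Ioo (0 : ℝ) 1) (e : ↥K.edges)
    (hc : (D.fan e).Closed) (h : NodeElts K) :
    ∫ p, D.faceFactor ζ r e (D.linkElt h e) p ∂(Measure.pi fun _ => pairMeasure) =
      deltaKernel (damping r e.1 ^ (D.fan e).len) (signElt (D.faceSign e) * D.faceElt h e) := by
  obtain ⟨h0, h1⟩ := hr ⟨e.1, ((D.fan e).mem_bulkEdges_iff e.2).2 hc⟩
  have hn := (D.fan e).numBulk_of_closed hc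
  have key := integral_loop (fun i => ((D.linkSign e i : ℤ) : ℂ)) (D.crossCoeff r e) (D.linkElt h e)
    h0.le h1 (fun i => (norm_units_coe _).le) (fun j => by
      rw [norm_crossCoeff, D.damping_of_closed e hc, abs_of_pos h0]) (D.basePos e hc).1
    (D.basePos e hc).2
  have hval : ∀ p, D.faceFactor ζ r e (D.linkElt h e) p =
      (braket (pairSide (D.basePos e hc).2 (p (D.basePos e hc).1))
        (pairSide (D.basePos e hc).2 (p (D.basePos e hc).1)) - 1) *
      Complex.exp (loopAction (fun i => ((D.linkSign e i : ℤ) : ℂ)) (D.crossCoeff r e)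
        (D.linkElt h e) p) := fun p => by
    rw [faceFactor, facePrefactor, dif_pos hc, faceAction, if_pos hc]
  simp_rw [hval]
  rw [key, deltaKernel_eq]
  · have hs := D.prod_linkSign_mul_prod_crossCoeff (r := r) e
    rw [hn] at hs ⊢
    rw [hs, poissonKernel_units_mul, coe_signElt_mul, Matrix.trace_smul, smul_eq_mul, faceElt]
    push_cast
    rfl
  · rw [D.damping_of_closed e hc, abs_pow, abs_of_pos h0]
    exact pow_lt_one₀ h0.le h1 ((D.fan e).len_pos e.2).ne'

/-- The spinor integral along the dual face of a boundary edge is the exponential of the corresponding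
link of the boundary state. -/
theorem integral_faceFactor_of_not_closed (e : ↥K.edges) (hc : ¬ (D.fan e).Closed)
    (h : NodeElts K) :
    ∫ p, D.faceFactor ζ r e (D.linkElt h e) p ∂(Measure.pi fun _ => pairMeasure) =
      Complex.exp (dualBraket (ζ ((D.fan e).tri 0) e) (signElt (D.faceSign e) * D.faceElt h e)
        (ζ ((D.fan e).tri (D.fan e).len) e)) := by
  have hn := (D.fan e).numBulk_of_not_closed e.2 hc
  have key := integral_exp_chainAction (D.fan e).numBulk (fun i => ((D.linkSign e i : ℤ) : ℂ))
    (D.crossCoeff r e) (D.linkElt h e) (ζ ((D.fan e).tri 0) e) (ζ ((D.fan e).tri (D.fan e).len) e)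
    (fun i => (norm_units_coe _).le) (fun j => by
      rw [norm_crossCoeff, D.damping_of_not_closed e hc, abs_one])
  have hval : ∀ p, D.faceFactor ζ r e (D.linkElt h e) p =
      Complex.exp (chainAction (fun i => ((D.linkSign e i : ℤ) : ℂ)) (D.crossCoeff r e)
        (D.linkElt h e) (ζ ((D.fan e).tri 0) e) (ζ ((D.fan e).tri (D.fan e).len) e) p) := fun p => by
    rw [faceFactor, facePrefactor, dif_neg hc, faceAction, if_neg hc, one_mul]
  simp_rw [hval]
  rw [key]
  have hs := D.prod_linkSign_mul_prod_crossCoeff (r := r) e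
  rw [hn, hs, D.damping_of_not_closed e hc, dualBraket_signElt_mul, faceElt]
  simp

/-! #### The spinor integral as a group integral -/

theorem integrable_prod_faceFactor (hr : ∀ e, r e ∈ Set.Ioo (0 : ℝ) 1) :
    Integrable (fun x : D.FaceSpinors × NodeElts K =>
      ∏ e : ↥K.edges, D.faceFactor ζ r e (D.linkElt x.2 e) (x.1 e))
      (D.faceMeasure.prod (nodeMeasure K)) := by
  choose B hB hle using fun e => D.exists_norm_faceFactor_le ζ hr e
  have hint : Integrable (fun y : D.FaceSpinors => ∏ e, B e (y e)) D.faceMeasure :=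
    Integrable.fintype_prod_dep hB
  refine (hint.comp_fst (nodeMeasure K)).mono' ?_ (Eventually.of_forall fun x => ?_)
  · have : OpensMeasurableSpace (D.FaceSpinors × NodeElts K) := Prod.opensMeasurableSpace
    refine Continuous.aestronglyMeasurable ?_
    refine continuous_finsetProd _ fun e _ => ?_
    exact D.continuous_faceFactor ζ e (A := fun x : D.FaceSpinors × NodeElts K => D.linkElt x.2 e)
      (fun i => (D.continuous_linkElt e i).comp continuous_snd)
      ((continuous_apply e).comp continuous_fst)
  · rw [norm_prod]
    exact Finset.prod_le_prod (fun _ _ => norm_nonneg _) fun e _ => hle e _ _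

instance : IsProbabilityMeasure D.faceMeasure := by unfold faceMeasure; infer_instance

theorem integrable_spinorIntegrand (hr : ∀ e, r e ∈ Set.Ioo (0 : ℝ) 1) :
    Integrable (D.spinorIntegrand ζ r) (Measure.pi fun _ : ↥K.bulkFlags => spinorMeasure) := by
  rw [← D.measurePreserving_flagSpinors.integrable_comp_emb D.flagSpinors.measurableEmbedding]
  refine (D.integrable_prod_faceFactor ζ hr).integral_prod_left.congr
    (Eventually.of_forall fun y => ?_)
  exact (D.spinorIntegrand_flagSpinors ζ r y).symm

/-- After Fubini's theorem, the spinor integral factorises over the dual faces inside the group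
integral. -/
theorem spinorIntegral_eq (hr : ∀ e, r e ∈ Set.Ioo (0 : ℝ) 1) :
    D.spinorIntegral ζ r = ∫ h, ∏ e : ↥K.edges,
      ∫ p, D.faceFactor ζ r e (D.linkElt h e) p ∂(Measure.pi fun _ => pairMeasure)
        ∂(nodeMeasure K) := by
  rw [spinorIntegral, ← D.measurePreserving_flagSpinors.integral_comp
    D.flagSpinors.measurableEmbedding]
  simp_rw [spinorIntegrand_flagSpinors]
  rw [integral_integral_swap (D.integrable_prod_faceFactor ζ hr)]
  refine integral_congr_ae (Eventually.of_forall fun h => ?_)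
  exact integral_fintype_prod_eq_prod (𝕜 := ℂ)
    (fun (e : ↥K.edges) p => D.faceFactor ζ r e (D.linkElt h e) p)

end Choices

end Triangulation

end PonzanoRegge

namespace PonzanoRegge

/-! ### The group integral -/

/-! #### Ordered products -/

/-- Regrouping of the factors of a telescoping product. -/
theorem mul_prod_ofFn_inv_mul {G : Type*} [Group G] (a b : ℕ → G) (n : ℕ) :
    a 0 * (List.ofFn fun i : Fin n => (a i)⁻¹ * b i).prod =
      (List.ofFn fun i : Fin n => b i * (a (i + 1))⁻¹).prod * a n := by
  induction n with
  | zero => simp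
  | succ n ih =>
    rw [List.ofFn_succ', List.ofFn_succ', List.prod_concat, List.prod_concat]
    simp only [Fin.val_castSucc, Fin.val_last]
    rw [← mul_assoc, ih]
    group

theorem prod_ofFn_signElt_mul (s : ℕ → ℤˣ) (g : ℕ → SU2) (n : ℕ) :
    (List.ofFn fun i : Fin n => signElt (s i) * g i).prod =
      signElt (∏ i ∈ Finset.range n, s i) * (List.ofFn fun i : Fin n => g i).prod := by
  induction n with
  | zero => simp
  | succ n ih =>
    rw [List.ofFn_succ', List.ofFn_succ', List.prod_concat, List.prod_concat,
      Finset.prod_range_succ, map_mul]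
    simp only [Fin.val_castSucc, Fin.val_last]
    rw [ih, mul_assoc, mul_assoc, ← mul_assoc _ (signElt (s n)), ← signElt_comm, mul_assoc]

namespace Triangulation

variable {V : Type*} [DecidableEq V] {K : Triangulation V}

theorem eq_of_bdTriangle_sub {t T T' : Finset V} (ht : t ∈ K.bdTriangles) (hT : T ∈ K.tets)
    (htT : t ⊆ T) (hT' : T' ∈ K.tets) (htT' : t ⊆ T') : T = T' := by
  rw [bdTriangles, Finset.mem_filter, Finset.card_eq_one] at ht
  obtain ⟨-, S, hS⟩ := ht
  have h : ∀ R, R ∈ K.tets → t ⊆ R → R = S := fun R hR htR => by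
    have : R ∈ K.tets.filter fun T => t ⊆ T := Finset.mem_filter.2 ⟨hR, htR⟩
    rwa [hS, Finset.mem_singleton] at this
  rw [h T hT htT, h T' hT' htT']

namespace Choices

variable (D : K.Choices) (ζ : Finset V → Finset V → Spinor)

/-! #### The integrand as a function of the holonomies -/

/-- The integrand of the group integral, before the integration over the group elements at the nodes of
the boundary graph. -/
noncomputable def holonomyIntegrand (q : ↥K.bulkEdges → ℝ) (u : ↥K.triangles → SU2) : ℂ :=
  (∏ e : ↥K.bulkEdges, deltaKernel (q e) (D.holonomy u (K.bulkEdge e))) *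
    Complex.exp (∑ e : ↥K.bdEdges, dualBraket (ζ (D.bdTgt e.1) e.1) (D.bdHolonomy u (K.bdEdge e))
      (ζ (D.bdSrc e.1) e.1))

theorem continuous_crossing (T t : Finset V) :
    Continuous fun u : ↥K.triangles → SU2 => D.crossing u T t := by
  have h : Continuous fun u : ↥K.triangles → SU2 => dualEdgeElt u t := by
    unfold dualEdgeElt
    split_ifs
    · exact continuous_apply _
    · exact continuous_const
  unfold crossing
  split_ifs
  · exact h
  · exact h.inv

theorem continuous_holonomy (e : ↥K.edges) :
    Continuous fun u : ↥K.triangles → SU2 => D.holonomy u e := by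
  unfold holonomy
  simp_rw [List.ofFn_eq_map]
  exact continuous_list_prod _ fun i _ => D.continuous_crossing _ _

theorem continuous_bdHolonomy (e : ↥K.edges) :
    Continuous fun u : ↥K.triangles → SU2 => D.bdHolonomy u e := by
  have h := (D.continuous_crossing ((D.fan e).tet 0) ((D.fan e).tri 0)).inv.mul
    (D.continuous_holonomy e)
  unfold bdHolonomy
  split_ifs
  · exact h
  · exact h.inv

theorem continuous_holonomyIntegrand {q : ↥K.bulkEdges → ℝ} (hq : ∀ e, q e ∈ Set.Ioo (0 : ℝ) 1) :
    Continuous (D.holonomyIntegrand ζ q) := by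
  refine Continuous.mul (continuous_finsetProd _ fun e _ => ?_)
    (Complex.continuous_exp.comp (continuous_finsetSum _ fun e _ => ?_))
  · refine (continuous_deltaKernel ?_).comp (D.continuous_holonomy _)
    rw [abs_of_pos (hq e).1]
    exact (hq e).2
  · exact Continuous.dualBraket continuous_const (D.continuous_bdHolonomy _) continuous_const

/-! #### Integration over the boundary nodes -/

/-- The group elements at the nodes of `Γ`, extended by `1` to all triangles. -/
def bdExtend (k : ↥K.bdTriangles → SU2) (t : ↥K.triangles) : SU2 :=
  if h : t.1 ∈ K.bdTriangles then k ⟨t, h⟩ else 1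

theorem continuous_bdExtend : Continuous (bdExtend (K := K)) := by
  refine continuous_pi fun t => ?_
  unfold bdExtend
  split_ifs
  · exact continuous_apply _
  · exact continuous_const

theorem crossing_mul_bdExtend_of_bulk (g : ↥K.triangles → SU2) (k : ↥K.bdTriangles → SU2)
    (T : Finset V) {t : Finset V} (ht : t ∈ K.bulkTriangles) :
    D.crossing (g * bdExtend k) T t = D.crossing g T t := by
  have h : dualEdgeElt (g * bdExtend k) t = dualEdgeElt g t := by
    rw [dualEdgeElt, dualEdgeElt, dif_pos (mem_triangles_of_bulk ht),
      dif_pos (mem_triangles_of_bulk ht), Pi.mul_apply, bdExtend,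
      dif_neg fun h => not_mem_bulk_of_mem_bd h ht, mul_one]
  rw [crossing, crossing, h]

theorem crossing_mul_bdExtend_of_bd (g : ↥K.triangles → SU2) (k : ↥K.bdTriangles → SU2)
    {T t : Finset V} (ht : t ∈ K.bdTriangles) (hT : T ∈ K.tets) (htT : t ⊆ T) :
    D.crossing (g * bdExtend k) T t = D.crossing g T t * k ⟨t, ht⟩ := by
  obtain ⟨hs, hts⟩ := D.src_mem t (mem_triangles_of_bd ht)
  rw [crossing, crossing, if_pos (eq_of_bdTriangle_sub ht hs hts hT htT),
    if_pos (eq_of_bdTriangle_sub ht hs hts hT htT), dualEdgeElt, dualEdgeElt,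
    dif_pos (mem_triangles_of_bd ht), dif_pos (mem_triangles_of_bd ht), Pi.mul_apply, bdExtend,
    dif_pos ht]

theorem holonomy_mul_bdExtend_of_closed (g : ↥K.triangles → SU2) (k : ↥K.bdTriangles → SU2)
    (e : ↥K.edges) (hc : (D.fan e).Closed) : D.holonomy (g * bdExtend k) e = D.holonomy g e := by
  have hn := (D.fan e).numBulk_of_closed hc
  rw [holonomy, holonomy]
  congr 1
  refine congrArg List.ofFn (funext fun i => ?_)
  exact D.crossing_mul_bdExtend_of_bulk g k _
    ((D.fan e).tri_succ_mem_bulkTriangles e.2 (by rw [hn]; exact i.2))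

theorem holonomy_mul_bdExtend_of_not_closed (g : ↥K.triangles → SU2) (k : ↥K.bdTriangles → SU2)
    (e : ↥K.edges) (hc : ¬ (D.fan e).Closed) : D.holonomy (g * bdExtend k) e =
      D.holonomy g e * k ⟨_, (D.fan e).tri_len_mem_bdTriangles e.2 hc⟩ := by
  have hn := (D.fan e).numBulk_of_not_closed e.2 hc
  obtain ⟨m, hm⟩ : ∃ m, (D.fan e).len = m + 1 := ⟨_, hn.symm⟩
  have hlast : D.crossing (g * bdExtend k) ((D.fan e).tet m) ((D.fan e).tri (m + 1)) =
      D.crossing g ((D.fan e).tet m) ((D.fan e).tri (m + 1)) *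
        k ⟨_, (D.fan e).tri_len_mem_bdTriangles e.2 hc⟩ := by
    have h1 := (D.fan e).tri_len_mem_bdTriangles e.2 hc
    rw [D.crossing_mul_bdExtend_of_bd g k (by rwa [← hm]) ((D.fan e).tet_mem (by omega))
      ((D.fan e).tri_succ_sub_tet m)]
    simp only [hm]
  have hlist : ∀ (f : ℕ → SU2) (n : ℕ), n = m + 1 → (List.ofFn fun i : Fin n => f i).prod =
      (List.ofFn fun i : Fin m => f i).prod * f m := by
    rintro f _ rfl
    rw [List.ofFn_succ', List.prod_concat]
    rfl
  rw [holonomy, holonomy,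
    hlist (fun i => D.crossing (g * bdExtend k) ((D.fan e).tet i) ((D.fan e).tri (i + 1))) _ hm,
    hlist (fun i => D.crossing g ((D.fan e).tet i) ((D.fan e).tri (i + 1))) _ hm, hlast, mul_assoc]
  congr 2
  refine congrArg List.ofFn (funext fun i => ?_)
  exact D.crossing_mul_bdExtend_of_bulk g k _
    ((D.fan e).tri_succ_mem_bulkTriangles e.2 (by omega))

/-- The two boundary triangles at a boundary edge are the first and the last triangle of the fan. -/
theorem bdSrc_bdTgt_cases (e : ↥K.edges) (hc : ¬ (D.fan e).Closed) :
    (D.bdTgt e.1 = (D.fan e).tri 0 ∧ D.bdSrc e.1 = (D.fan e).tri (D.fan e).len) ∨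
      (D.bdTgt e.1 = (D.fan e).tri (D.fan e).len ∧ D.bdSrc e.1 = (D.fan e).tri 0) := by
  have he := ((D.fan e).mem_bdEdges_iff e.2).2 hc
  obtain ⟨h1, h2, hne⟩ := D.bd_sub _ he
  rcases ((D.fan e).eq_of_mem_bdTriangles e.2 (D.bdSrc_mem _ he) h1).2 with hs | hs <;>
    rcases ((D.fan e).eq_of_mem_bdTriangles e.2 (D.bdTgt_mem _ he) h2).2 with ht | ht
  · exact (hne (hs.trans ht.symm)).elim
  · exact Or.inr ⟨ht, hs⟩
  · exact Or.inl ⟨ht, hs⟩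
  · exact (hne (hs.trans ht.symm)).elim

/-- The group elements at the nodes of `Γ` act on the boundary holonomies by gauge transformations, and
are thus absorbed by the dual edges of the boundary triangles. -/
theorem bdHolonomy_mul_bdExtend (g : ↥K.triangles → SU2) (k : ↥K.bdTriangles → SU2)
    (e : ↥K.bdEdges) : D.bdHolonomy (g * bdExtend k) (K.bdEdge e) =
      (k ⟨D.bdTgt e.1, D.bdTgt_mem e.1 e.2⟩)⁻¹ * D.bdHolonomy g (K.bdEdge e) *
        k ⟨D.bdSrc e.1, D.bdSrc_mem e.1 e.2⟩ := by
  have hc := ((D.fan (K.bdEdge e)).mem_bdEdges_iff (K.bdEdge e).2).1 e.2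
  have h0 := (D.fan (K.bdEdge e)).len_pos (K.bdEdge e).2
  have hzero := D.crossing_mul_bdExtend_of_bd g k
    ((D.fan (K.bdEdge e)).tri_zero_mem_bdTriangles (K.bdEdge e).2 hc)
    ((D.fan (K.bdEdge e)).tet_mem h0) ((D.fan (K.bdEdge e)).tri_sub_tet 0)
  have hne := (D.fan (K.bdEdge e)).tri_zero_ne_tri_len (K.bdEdge e).2 hc
  rw [bdHolonomy, bdHolonomy, hzero, D.holonomy_mul_bdExtend_of_not_closed g k _ hc]
  rcases D.bdSrc_bdTgt_cases (K.bdEdge e) hc with ⟨ht, hs⟩ | ⟨ht, hs⟩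
  · rw [if_pos ht, if_pos ht]
    change D.bdTgt e.1 = _ at ht
    change D.bdSrc e.1 = _ at hs
    simp only [ht, hs]
    group
  · rw [if_neg (by rw [ht]; exact hne.symm), if_neg (by rw [ht]; exact hne.symm)]
    change D.bdTgt e.1 = _ at ht
    change D.bdSrc e.1 = _ at hs
    simp only [ht, hs]
    group

theorem groupIntegrand_eq (q : ↥K.bulkEdges → ℝ) (g : ↥K.triangles → SU2) :
    D.groupIntegrand ζ q g =
      ∫ k : ↥K.bdTriangles → SU2, D.holonomyIntegrand ζ q (g * bdExtend k)
        ∂(Measure.pi fun _ => haar) := by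
  rw [groupIntegrand, boundaryState, cohSpinNetwork, ← integral_const_mul]
  refine integral_congr_ae (Eventually.of_forall fun k => ?_)
  refine congrArg₂ (· * ·) (Finset.prod_congr rfl fun e _ => ?_)
    (congrArg Complex.exp (Finset.sum_congr rfl fun e _ => ?_))
  · rw [D.holonomy_mul_bdExtend_of_closed g k _
      (((D.fan (K.bulkEdge e)).mem_bulkEdges_iff (K.bulkEdge e).2).1 e.2)]
  · rw [D.bdHolonomy_mul_bdExtend g k e]

theorem integrable_holonomyIntegrand_mul {q : ↥K.bulkEdges → ℝ} (hq : ∀ e, q e ∈ Set.Ioo (0 : ℝ) 1) :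
    Integrable (fun x : (↥K.triangles → SU2) × (↥K.bdTriangles → SU2) =>
      D.holonomyIntegrand ζ q (x.1 * bdExtend x.2))
      ((Measure.pi fun _ => haar).prod (Measure.pi fun _ => haar)) := by
  have hcont : Continuous fun x : (↥K.triangles → SU2) × (↥K.bdTriangles → SU2) =>
      D.holonomyIntegrand ζ q (x.1 * bdExtend x.2) :=
    (D.continuous_holonomyIntegrand ζ hq).comp
      (continuous_fst.mul (continuous_bdExtend.comp continuous_snd))
  exact hcont.integrable_of_hasCompactSupport (HasCompactSupport.of_compactSpace _)

theorem integrable_groupIntegrand {q : ↥K.bulkEdges → ℝ} (hq : ∀ e, q e ∈ Set.Ioo (0 : ℝ) 1) :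
    Integrable (D.groupIntegrand ζ q) (Measure.pi fun _ : ↥K.triangles => haar) :=
  (D.integrable_holonomyIntegrand_mul ζ hq).integral_prod_left.congr
    (Eventually.of_forall fun g => (D.groupIntegrand_eq ζ q g).symm)

/-- The integration over the group elements at the nodes of `Γ` is trivial, by right invariance. -/
theorem groupIntegral_eq {q : ↥K.bulkEdges → ℝ} (hq : ∀ e, q e ∈ Set.Ioo (0 : ℝ) 1) :
    D.groupIntegral ζ q = ∫ u, D.holonomyIntegrand ζ q u ∂(Measure.pi fun _ => haar) := by
  rw [groupIntegral]
  simp_rw [D.groupIntegrand_eq ζ q]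
  rw [integral_integral_swap (D.integrable_holonomyIntegrand_mul ζ hq)]
  have h : ∀ k : ↥K.bdTriangles → SU2,
      ∫ g, D.holonomyIntegrand ζ q (g * bdExtend k) ∂(Measure.pi fun _ : ↥K.triangles => haar) =
        ∫ u, D.holonomyIntegrand ζ q u ∂(Measure.pi fun _ => haar) :=
    fun k => integral_mul_right_eq_self _ _
  simp_rw [h]
  simp

end Choices

end Triangulation

end PonzanoRegge

namespace PonzanoRegge

namespace Triangulation

namespace Choices

variable {V : Type*} [DecidableEq V] {K : Triangulation V} (D : K.Choices)
  (ζ : Finset V → Finset V → Spinor)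

/-! ### Comparison of the two integrals -/

/-! #### From the group elements at the nodes to those of the dual edges -/

/-- The group elements of the dual edges which arise from those of the vertex amplitudes: the product of
the element at the triangle in its source tetrahedron and the inverse of that in its target
tetrahedron. -/
noncomputable def dualEdgeElts (h : NodeElts K) (t : ↥K.triangles) : SU2 :=
  nodeElt h (D.src t) t * if t.1 ∈ K.bulkTriangles then (nodeElt h (D.tgt t) t)⁻¹ else 1

theorem continuous_dualEdgeElts : Continuous D.dualEdgeElts := by
  refine continuous_pi fun t => (continuous_nodeElt _ _).mul ?_
  split_ifs
  · exact (continuous_nodeElt _ _).inv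
  · exact continuous_const

theorem dualEdgeElt_dualEdgeElts_of_bulk (h : NodeElts K) {t : Finset V} (ht : t ∈ K.bulkTriangles) :
    dualEdgeElt (D.dualEdgeElts h) t = nodeElt h (D.src t) t * (nodeElt h (D.tgt t) t)⁻¹ := by
  rw [dualEdgeElt, dif_pos (mem_triangles_of_bulk ht), dualEdgeElts, if_pos ht]

theorem crossing_dualEdgeElts_of_bd (h : NodeElts K) {T t : Finset V} (ht : t ∈ K.bdTriangles)
    (hT : T ∈ K.tets) (htT : t ⊆ T) : D.crossing (D.dualEdgeElts h) T t = nodeElt h T t := by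
  obtain ⟨hs, hts⟩ := D.src_mem t (mem_triangles_of_bd ht)
  have hsT := eq_of_bdTriangle_sub ht hs hts hT htT
  rw [crossing, if_pos hsT, dualEdgeElt, dif_pos (mem_triangles_of_bd ht), dualEdgeElts,
    if_neg (not_mem_bulk_of_mem_bd ht), mul_one, hsT]

open Classical in
/-- The group element at the triangle through which the dual face of `e` enters its `i`-th tetrahedron.
For `i = len` this is the first one again if the face is closed, and `1` otherwise. -/
noncomputable def entryElt (h : NodeElts K) (e : ↥K.edges) (i : ℕ) : SU2 :=
  if i = (D.fan e).len then
    if (D.fan e).Closed then nodeElt h ((D.fan e).tet 0) ((D.fan e).tri 0) else 1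
  else nodeElt h ((D.fan e).tet i) ((D.fan e).tri i)

theorem entryElt_of_lt (h : NodeElts K) (e : ↥K.edges) {i : ℕ} (hi : i < (D.fan e).len) :
    D.entryElt h e i = nodeElt h ((D.fan e).tet i) ((D.fan e).tri i) := if_neg hi.ne

theorem entryElt_succ (h : NodeElts K) (e : ↥K.edges) {j : ℕ} (hj : j < (D.fan e).numBulk) :
    D.entryElt h e (j + 1) =
      nodeElt h ((D.fan e).tet ((D.fan e).next j)) ((D.fan e).tri (j + 1)) := by
  have hl := (D.fan e).numBulk_le
  by_cases hjl : j + 1 = (D.fan e).len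
  · have hc : (D.fan e).Closed := by
      by_contra hc
      have := (D.fan e).numBulk_of_not_closed e.2 hc
      omega
    rw [entryElt, if_pos hjl, if_pos hc, Fan.next, if_pos hjl, hjl, (D.fan e).tri_zero_eq_tri_len hc]
  · rw [entryElt, if_neg hjl, Fan.next, if_neg hjl]

/-- Whatever the orientation of the dual edge, leaving the `i`-th tetrahedron picks up the element at the
triangle in this tetrahedron and the inverse of that in the next one. -/
theorem crossing_dualEdgeElts (h : NodeElts K) (e : ↥K.edges) {i : ℕ} (hi : i < (D.fan e).len) :
    D.crossing (D.dualEdgeElts h) ((D.fan e).tet i) ((D.fan e).tri (i + 1)) =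
      nodeElt h ((D.fan e).tet i) ((D.fan e).tri (i + 1)) * (D.entryElt h e (i + 1))⁻¹ := by
  by_cases hj : i < (D.fan e).numBulk
  · have hb := (D.fan e).tri_succ_mem_bulkTriangles e.2 hj
    rw [D.entryElt_succ h e hj, crossing, D.dualEdgeElt_dualEdgeElts_of_bulk h hb]
    rcases D.src_tgt_cases e hj with ⟨h1, h2⟩ | ⟨h1, h2, h3⟩
    · rw [if_pos h1, h1, h2]
    · rw [if_neg h3, h1, h2, mul_inv_rev, inv_inv]
  · have hc : ¬ (D.fan e).Closed := fun hc => hj (by rwa [(D.fan e).numBulk_of_closed hc])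
    have hn := (D.fan e).numBulk_of_not_closed e.2 hc
    have hl : i + 1 = (D.fan e).len := by omega
    have hb : (D.fan e).tri (i + 1) ∈ K.bdTriangles := by
      rw [hl]; exact (D.fan e).tri_len_mem_bdTriangles e.2 hc
    rw [D.crossing_dualEdgeElts_of_bd h hb ((D.fan e).tet_mem hi) ((D.fan e).tri_succ_sub_tet i),
      entryElt, if_pos hl, if_neg hc, inv_one, mul_one]

theorem holonomy_dualEdgeElts (h : NodeElts K) (e : ↥K.edges) :
    D.holonomy (D.dualEdgeElts h) e * D.entryElt h e (D.fan e).len =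
      nodeElt h ((D.fan e).tet 0) ((D.fan e).tri 0) * D.faceElt h e := by
  have key := mul_prod_ofFn_inv_mul (D.entryElt h e)
    (fun i => nodeElt h ((D.fan e).tet i) ((D.fan e).tri (i + 1))) (D.fan e).len
  rw [D.entryElt_of_lt h e ((D.fan e).len_pos e.2)] at key
  have h1 : D.faceElt h e = (List.ofFn fun i : Fin (D.fan e).len => (D.entryElt h e i)⁻¹ *
      nodeElt h ((D.fan e).tet i) ((D.fan e).tri (i + 1))).prod := by
    rw [faceElt]
    congr 1
    refine congrArg List.ofFn (funext fun i => ?_)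
    rw [linkElt, D.entryElt_of_lt h e i.2]
  have h2 : D.holonomy (D.dualEdgeElts h) e = (List.ofFn fun i : Fin (D.fan e).len =>
      nodeElt h ((D.fan e).tet i) ((D.fan e).tri (i + 1)) * (D.entryElt h e (i + 1))⁻¹).prod := by
    rw [holonomy]
    congr 1
    exact congrArg List.ofFn (funext fun i => D.crossing_dualEdgeElts h e i.2)
  rw [h1, h2, key]

theorem trace_holonomy_dualEdgeElts (h : NodeElts K) (e : ↥K.edges) (hc : (D.fan e).Closed) :
    (D.holonomy (D.dualEdgeElts h) e).1.trace = (D.faceElt h e).1.trace := by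
  have key := D.holonomy_dualEdgeElts h e
  rw [entryElt, if_pos rfl, if_pos hc, ← eq_mul_inv_iff_mul_eq] at key
  rw [key]
  change ((nodeElt h ((D.fan e).tet 0) ((D.fan e).tri 0)).1 * (D.faceElt h e).1 *
    (nodeElt h ((D.fan e).tet 0) ((D.fan e).tri 0))⁻¹.1).trace = _
  rw [Matrix.trace_mul_comm, ← mul_assoc]
  change (((nodeElt h ((D.fan e).tet 0) ((D.fan e).tri 0))⁻¹ *
    nodeElt h ((D.fan e).tet 0) ((D.fan e).tri 0)).1 * (D.faceElt h e).1).trace = _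
  rw [inv_mul_cancel]
  change ((1 : Matrix (Fin 2) (Fin 2) ℂ) * (D.faceElt h e).1).trace = _
  rw [one_mul]

theorem inv_crossing_mul_holonomy_dualEdgeElts (h : NodeElts K) (e : ↥K.edges)
    (hc : ¬ (D.fan e).Closed) :
    (D.crossing (D.dualEdgeElts h) ((D.fan e).tet 0) ((D.fan e).tri 0))⁻¹ *
      D.holonomy (D.dualEdgeElts h) e = D.faceElt h e := by
  have key := D.holonomy_dualEdgeElts h e
  rw [entryElt, if_pos rfl, if_neg hc, mul_one] at key
  rw [key, D.crossing_dualEdgeElts_of_bd h ((D.fan e).tri_zero_mem_bdTriangles e.2 hc)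
    ((D.fan e).tet_mem ((D.fan e).len_pos e.2)) ((D.fan e).tri_sub_tet 0), inv_mul_cancel_left]

/-! #### Orientation signs -/

theorem crossSign_last (e : ↥K.edges) (hc : ¬ (D.fan e).Closed) :
    D.crossSign e (D.fan e).numBulk = 1 := by
  have hn := (D.fan e).numBulk_of_not_closed e.2 hc
  have hb : (D.fan e).tri ((D.fan e).numBulk + 1) ∈ K.bdTriangles := by
    rw [hn]; exact (D.fan e).tri_len_mem_bdTriangles e.2 hc
  obtain ⟨hs, hts⟩ := D.src_mem _ (mem_triangles_of_bd hb)
  exact if_pos (eq_of_bdTriangle_sub hb hs hts ((D.fan e).tet_mem (by omega))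
    ((D.fan e).tri_succ_sub_tet _))

/-- The parity of the number of disagreements, in terms of the sign produced by the spinor integral. The
link of `Γ` contributes separately, because reversing it gives another sign in the boundary state. -/
theorem neg_one_pow_mismatch (e : ↥K.edges) : (-1 : ℤˣ) ^ D.mismatch e =
    D.faceSign e * if e.1 ∈ K.bdEdges ∧ D.bdSrc e.1 = (D.fan e).tri 0 then -1 else 1 := by
  have hcross : ∏ j ∈ Finset.range (D.fan e).len, D.crossSign e j =
      ∏ j ∈ Finset.range (D.fan e).numBulk, D.crossSign e j := by
    by_cases hc : (D.fan e).Closed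
    · rw [(D.fan e).numBulk_of_closed hc]
    · rw [← (D.fan e).numBulk_of_not_closed e.2 hc, Finset.prod_range_succ, D.crossSign_last e hc,
        mul_one]
  rw [faceSign, ← hcross, ← Finset.prod_mul_distrib, mismatch, pow_add, ← Finset.prod_pow_eq_pow_sum]
  congr 1
  · refine Finset.prod_congr rfl fun i _ => ?_
    rw [linkSign, crossSign]
    split_ifs <;> rfl
  · split_ifs <;> rfl

/-- Multiplication of the group elements of the dual edges by signs. -/
noncomputable def twist (η : Finset V → ℤˣ) (u : ↥K.triangles → SU2) : ↥K.triangles → SU2 :=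
  fun t => signElt (η t) * u t

theorem crossing_twist (η : Finset V → ℤˣ) (u : ↥K.triangles → SU2) (T : Finset V) {t : Finset V}
    (ht : t ∈ K.triangles) : D.crossing (twist η u) T t = signElt (η t) * D.crossing u T t := by
  rw [crossing, crossing, dualEdgeElt, dualEdgeElt, dif_pos ht, dif_pos ht, twist]
  split_ifs
  · rfl
  · rw [mul_inv_rev, signElt_inv, signElt_comm]

theorem holonomy_twist (η : Finset V → ℤˣ) (u : ↥K.triangles → SU2) (e : ↥K.edges) :
    D.holonomy (twist η u) e =
      signElt (∏ j ∈ Finset.range (D.fan e).len, η ((D.fan e).tri (j + 1))) * D.holonomy u e := by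
  rw [holonomy, holonomy, ← prod_ofFn_signElt_mul (fun j => η ((D.fan e).tri (j + 1)))
    (fun i => D.crossing u ((D.fan e).tet i) ((D.fan e).tri (i + 1)))]
  congr 1
  exact congrArg List.ofFn (funext fun i =>
    D.crossing_twist η u _ ((D.fan e).mem_triangles_tri e.2 i.2))

/-! #### The integrands agree -/

variable {r : ↥K.bulkEdges → ℝ} {η : Finset V → ℤˣ}

theorem deltaKernel_congr {q : ℝ} (hq : |q| < 1) {g g' : SU2} (h : g.1.trace = g'.1.trace) :
    deltaKernel q g = deltaKernel q g' := by
  rw [deltaKernel_eq hq, deltaKernel_eq hq, h]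

theorem deltaKernel_holonomy_twist (hη : ∀ e : ↥K.edges, (-1 : ℤˣ) ^ D.mismatch e =
      ∏ t ∈ K.triangles.filter (fun t => e.1 ⊆ t), η t) {q : ℝ} (hq : |q| < 1) (h : NodeElts K)
    (e : ↥K.edges) (hc : (D.fan e).Closed) :
    deltaKernel q (D.holonomy (twist η (D.dualEdgeElts h)) e) =
      deltaKernel q (signElt (D.faceSign e) * D.faceElt h e) := by
  have hs := D.neg_one_pow_mismatch e
  rw [hη e, if_neg fun h' => ((D.fan e).mem_bdEdges_iff e.2).1 h'.1 hc, mul_one,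
    prod_triangles_of_sub e.2 (D.fan e), if_pos hc, mul_one] at hs
  rw [D.holonomy_twist, hs]
  refine deltaKernel_congr hq ?_
  rw [coe_signElt_mul, coe_signElt_mul, Matrix.trace_smul, Matrix.trace_smul,
    D.trace_holonomy_dualEdgeElts h e hc]

/-- The exponents at a boundary edge agree. If the link of `Γ` runs against the fan, its reversal and the
additional disagreement both give a sign. -/
theorem dualBraket_bdHolonomy_twist (hη : ∀ e : ↥K.edges, (-1 : ℤˣ) ^ D.mismatch e =
      ∏ t ∈ K.triangles.filter (fun t => e.1 ⊆ t), η t) (h : NodeElts K)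
    (e : ↥K.edges) (hc : ¬ (D.fan e).Closed) :
    dualBraket (ζ (D.bdTgt e.1) e.1) (D.bdHolonomy (twist η (D.dualEdgeElts h)) e)
        (ζ (D.bdSrc e.1) e.1) =
      dualBraket (ζ ((D.fan e).tri 0) e) (signElt (D.faceSign e) * D.faceElt h e)
        (ζ ((D.fan e).tri (D.fan e).len) e) := by
  have hs := D.neg_one_pow_mismatch e
  rw [hη e, prod_triangles_of_sub e.2 (D.fan e), if_neg hc] at hs
  have hne := (D.fan e).tri_zero_ne_tri_len e.2 hc
  have hmem := ((D.fan e).mem_bdEdges_iff e.2).2 hc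
  have hX : (D.crossing (twist η (D.dualEdgeElts h)) ((D.fan e).tet 0) ((D.fan e).tri 0))⁻¹ *
      D.holonomy (twist η (D.dualEdgeElts h)) e =
      signElt (D.faceSign e * if e.1 ∈ K.bdEdges ∧ D.bdSrc e.1 = (D.fan e).tri 0 then -1 else 1) *
        D.faceElt h e := by
    rw [← hs, ← D.inv_crossing_mul_holonomy_dualEdgeElts h e hc, D.holonomy_twist,
      D.crossing_twist η _ _ (mem_triangles_of_bd ((D.fan e).tri_zero_mem_bdTriangles e.2 hc)),
      mul_inv_rev, signElt_inv, ← signElt_comm, mul_comm (∏ j ∈ _, _), map_mul, mul_assoc, mul_assoc,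
      ← mul_assoc _⁻¹ (signElt _), ← signElt_comm, mul_assoc]
  rw [bdHolonomy, hX]
  rcases D.bdSrc_bdTgt_cases e hc with ⟨ht, hs⟩ | ⟨ht, hs⟩
  · rw [if_pos ht, if_neg fun h' => hne (h'.2.symm.trans hs), mul_one, ht, hs]
  · rw [if_neg (by rw [ht]; exact hne.symm), if_pos ⟨hmem, hs⟩, ht, hs, dualBraket_swap, inv_inv,
      dualBraket_signElt_mul, dualBraket_signElt_mul]
    push_cast
    ring

theorem pow_len_mem_Ioo (hr : ∀ e, r e ∈ Set.Ioo (0 : ℝ) 1) (e : ↥K.bulkEdges) :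
    r e ^ (D.fan (K.bulkEdge e)).len ∈ Set.Ioo (0 : ℝ) 1 :=
  ⟨pow_pos (hr e).1 _,
    pow_lt_one₀ (hr e).1.le (hr e).2 ((D.fan (K.bulkEdge e)).len_pos (K.bulkEdge e).2).ne'⟩

/-- A product over the edges, split into the interior edges and the boundary edges. -/
theorem prod_edges_eq (f : ↥K.edges → ℂ) :
    ∏ e, f e = (∏ e : ↥K.bulkEdges, f (K.bulkEdge e)) * ∏ e : ↥K.bdEdges, f (K.bdEdge e) := by
  classical
  let F : Finset V → ℂ := fun e => if h : e ∈ K.edges then f ⟨e, h⟩ else 1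
  have hF : ∀ e : ↥K.edges, F e.1 = f e := fun e => by simp only [F]; rw [dif_pos e.2]
  have h0 : ∏ e, f e = ∏ e ∈ K.edges, F e := by
    rw [← Finset.prod_coe_sort K.edges F]
    exact Finset.prod_congr rfl fun e _ => (hF e).symm
  have h1 : ∏ e : ↥K.bulkEdges, f (K.bulkEdge e) = ∏ e ∈ K.bulkEdges, F e := by
    rw [← Finset.prod_coe_sort K.bulkEdges F]
    exact Finset.prod_congr rfl fun e _ => (hF (K.bulkEdge e)).symm
  have h2 : ∏ e : ↥K.bdEdges, f (K.bdEdge e) = ∏ e ∈ K.bdEdges, F e := by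
    rw [← Finset.prod_coe_sort K.bdEdges F]
    exact Finset.prod_congr rfl fun e _ => (hF (K.bdEdge e)).symm
  rw [h0, h1, h2, mul_comm, bdEdges, bulkEdges, Finset.prod_filter_mul_prod_filter_not]

/-- The integrands of the two sides agree, after multiplication of dual edges by the signs `η`. -/
theorem prod_integral_faceFactor (hη : ∀ e : ↥K.edges, (-1 : ℤˣ) ^ D.mismatch e =
      ∏ t ∈ K.triangles.filter (fun t => e.1 ⊆ t), η t) (hr : ∀ e, r e ∈ Set.Ioo (0 : ℝ) 1)
    (h : NodeElts K) :
    ∏ e : ↥K.edges, ∫ p, D.faceFactor ζ r e (D.linkElt h e) p ∂(Measure.pi fun _ => pairMeasure) =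
      D.holonomyIntegrand ζ (fun e => r e ^ (D.fan (K.bulkEdge e)).len)
        (twist η (D.dualEdgeElts h)) := by
  rw [prod_edges_eq, holonomyIntegrand, Complex.exp_sum]
  refine congrArg₂ (· * ·) (Finset.prod_congr rfl fun e _ => ?_) (Finset.prod_congr rfl fun e _ => ?_)
  · have hc := ((D.fan (K.bulkEdge e)).mem_bulkEdges_iff (K.bulkEdge e).2).1 e.2
    have hq := D.pow_len_mem_Ioo hr e
    rw [D.integral_faceFactor_of_closed ζ hr _ hc, D.damping_of_closed _ hc,
      D.deltaKernel_holonomy_twist hη (by rw [abs_of_pos hq.1]; exact hq.2) h _ hc]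
    rfl
  · have hc := ((D.fan (K.bdEdge e)).mem_bdEdges_iff (K.bdEdge e).2).1 e.2
    rw [D.integral_faceFactor_of_not_closed ζ _ hc, ← D.dualBraket_bdHolonomy_twist ζ hη h _ hc]
    rfl

/-! #### Averaging over the group -/

/-- Elements of `SU(2)` for the triangles, as elements at the nodes of the tetrahedra: each one sits at
its triangle in the source tetrahedron. -/
def srcElts (c : ↥K.triangles → SU2) : NodeElts K := fun T t =>
  if D.src t = T then dualEdgeElt c t else 1

theorem nodeElt_srcElts_mul (c : ↥K.triangles → SU2) (h : NodeElts K) (t : ↥K.triangles)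
    {T : Finset V} (hT : T ∈ K.tets) (htT : t.1 ⊆ T) :
    nodeElt (D.srcElts c * h) T t = (if D.src t = T then c t else 1) * nodeElt h T t := by
  have ht : t.1 ∈ T.powersetCard 3 := by
    obtain ⟨_, _, _, h3⟩ := mem_triangles_iff.1 t.2
    exact Finset.mem_powersetCard.2 ⟨htT, h3⟩
  rw [nodeElt, nodeElt, dif_pos hT, dif_pos hT, dif_pos ht, dif_pos ht, Pi.mul_apply, Pi.mul_apply,
    srcElts, dualEdgeElt, dif_pos t.2]

theorem dualEdgeElts_srcElts_mul (c : ↥K.triangles → SU2) (h : NodeElts K) :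
    D.dualEdgeElts (D.srcElts c * h) = c * D.dualEdgeElts h := by
  funext t
  obtain ⟨hs, hts⟩ := D.src_mem t.1 t.2
  rw [Pi.mul_apply, dualEdgeElts, dualEdgeElts, D.nodeElt_srcElts_mul c h t hs hts, if_pos rfl,
    mul_assoc]
  congr 2
  split_ifs with hb
  · obtain ⟨ht, htt, hne⟩ := D.tgt_mem t.1 hb
    rw [D.nodeElt_srcElts_mul c h t ht htt, if_neg hne.symm, one_mul]
  · rfl

theorem twist_mul (c u : ↥K.triangles → SU2) : twist η (c * u) = c * twist η u := by
  funext t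
  rw [twist, Pi.mul_apply, Pi.mul_apply, twist, ← mul_assoc, signElt_comm, mul_assoc]

theorem continuous_twist : Continuous (twist (K := K) η) :=
  continuous_pi fun t => continuous_const.mul (continuous_apply t)

instance : (nodeMeasure K).IsMulLeftInvariant := by unfold nodeMeasure; infer_instance

/-- The group elements of the dual edges are Haar distributed: multiplying the elements at the source
tetrahedra by `c` multiplies them by `c`, over which the average is taken. -/
theorem integral_comp_dualEdgeElts {f : (↥K.triangles → SU2) → ℂ} (hf : Continuous f) :
    ∫ h, f (twist η (D.dualEdgeElts h)) ∂(nodeMeasure K) =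
      ∫ u, f u ∂(Measure.pi fun _ => haar) := by
  have hcont : Continuous fun x : (↥K.triangles → SU2) × NodeElts K =>
      f (x.1 * twist η (D.dualEdgeElts x.2)) :=
    hf.comp (continuous_fst.mul (continuous_twist.comp (D.continuous_dualEdgeElts.comp continuous_snd)))
  have hint : Integrable (fun x : (↥K.triangles → SU2) × NodeElts K =>
      f (x.1 * twist η (D.dualEdgeElts x.2))) ((Measure.pi fun _ => haar).prod (nodeMeasure K)) :=
    hcont.integrable_of_hasCompactSupport (HasCompactSupport.of_compactSpace _)
  have h1 : ∀ c : ↥K.triangles → SU2,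
      ∫ h, f (c * twist η (D.dualEdgeElts h)) ∂(nodeMeasure K) =
        ∫ h, f (twist η (D.dualEdgeElts h)) ∂(nodeMeasure K) := by
    intro c
    rw [← integral_mul_left_eq_self (μ := nodeMeasure K)
      (fun h => f (twist η (D.dualEdgeElts h))) (D.srcElts c)]
    simp_rw [D.dualEdgeElts_srcElts_mul, twist_mul]
  have h2 : ∀ u : ↥K.triangles → SU2, ∫ c, f (c * u) ∂(Measure.pi fun _ => haar) =
      ∫ u, f u ∂(Measure.pi fun _ => haar) := fun u => integral_mul_right_eq_self _ _
  have h3 := integral_integral_swap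
    (f := fun c h => f (c * twist η (D.dualEdgeElts h))) hint
  simp_rw [h1, h2] at h3
  simpa using h3

theorem groupIntegral_eq_spinorIntegral (hD : D.Compatible)
    (hr : ∀ e, r e ∈ Set.Ioo (0 : ℝ) 1) :
    D.groupIntegral ζ (fun e => r e ^ (D.fan (K.bulkEdge e)).len) = D.spinorIntegral ζ r := by
  obtain ⟨η, hη⟩ := hD
  have hq := D.pow_len_mem_Ioo hr
  rw [D.spinorIntegral_eq ζ hr, D.groupIntegral_eq ζ hq]
  simp_rw [D.prod_integral_faceFactor ζ hη hr]
  exact (D.integral_comp_dualEdgeElts (D.continuous_holonomyIntegrand ζ hq)).symm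

/-! #### Removal of the damping -/

/-- A coordinatewise map fixing `1` and preserving `(0, 1)` preserves the limit without damping. -/
theorem tendsto_undamp {f : ↥K.bulkEdges → ℝ → ℝ} (hf : ∀ e, ContinuousAt (f e) 1)
    (h1 : ∀ e, f e 1 = 1) (hmem : ∀ e, ∀ x ∈ Set.Ioo (0 : ℝ) 1, f e x ∈ Set.Ioo (0 : ℝ) 1) :
    Tendsto (fun (r : ↥K.bulkEdges → ℝ) e => f e (r e)) (undamp K) (undamp K) := by
  refine tendsto_nhdsWithin_iff.2 ⟨Tendsto.mono_left ?_ nhdsWithin_le_nhds, ?_⟩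
  · refine tendsto_pi_nhds.2 fun e => ?_
    have h2 : Tendsto (f e) (𝓝 1) (𝓝 1) := by
      have := (hf e).tendsto
      rwa [h1] at this
    exact h2.comp ((continuous_apply e).tendsto (1 : ↥K.bulkEdges → ℝ))
  · exact eventually_nhdsWithin_of_forall fun r hr e => hmem e _ (hr e)

theorem hasPartitionFunction_iff (hD : D.Compatible) (A : ℂ) :
    D.HasPartitionFunction ζ A ↔ D.HasStateIntegral ζ A := by
  have hlen : ∀ e : ↥K.bulkEdges, (D.fan (K.bulkEdge e)).len ≠ 0 := fun e =>
    ((D.fan (K.bulkEdge e)).len_pos (K.bulkEdge e).2).ne'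
  constructor
  · intro h
    have ht := tendsto_undamp (K := K) (f := fun e x => x ^ (D.fan (K.bulkEdge e)).len)
      (fun e => (continuous_pow _).continuousAt) (fun e => one_pow _)
      fun e x hx => ⟨pow_pos hx.1 _, pow_lt_one₀ hx.1.le hx.2 (hlen e)⟩
    refine (h.comp ht).congr' ?_
    exact eventually_nhdsWithin_of_forall fun r hr => D.groupIntegral_eq_spinorIntegral ζ hD hr
  · intro h
    have hpos : ∀ e : ↥K.bulkEdges, (0 : ℝ) < ((D.fan (K.bulkEdge e)).len : ℝ)⁻¹ := fun e =>
      inv_pos.2 (Nat.cast_pos.2 (Nat.pos_of_ne_zero (hlen e)))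
    have hmem : ∀ (e : ↥K.bulkEdges), ∀ x ∈ Set.Ioo (0 : ℝ) 1,
        x ^ ((D.fan (K.bulkEdge e)).len : ℝ)⁻¹ ∈ Set.Ioo (0 : ℝ) 1 := fun e x hx =>
      ⟨Real.rpow_pos_of_pos hx.1 _, Real.rpow_lt_one hx.1.le hx.2 (hpos e)⟩
    have ht := tendsto_undamp (K := K)
      (f := fun e x => x ^ ((D.fan (K.bulkEdge e)).len : ℝ)⁻¹)
      (fun e => Real.continuousAt_rpow_const _ _ (Or.inl one_ne_zero)) (fun e => Real.one_rpow _) hmem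
    refine (h.comp ht).congr' (eventually_nhdsWithin_of_forall fun q hq => ?_)
    rw [Function.comp_apply, ← D.groupIntegral_eq_spinorIntegral ζ hD fun e => hmem e _ (hq e)]
    congr 1
    funext e
    exact Real.rpow_inv_natCast_pow (hq e).1.le (hlen e)

end Choices

end Triangulation

end PonzanoRegge

open PonzanoRegge in
theorem proposition1 {V : Type*} [DecidableEq V] (K : Triangulation V) (D : K.Choices)
    (hD : D.Compatible) (ζ : Finset V → Finset V → Spinor) :
    -- the damped kernels are well defined and converge to the delta distribution
    (∀ q ∈ Set.Ioo (0 : ℝ) 1, ∀ g : SU2,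
      Summable fun n : ℕ => (q : ℂ) ^ n * ((n : ℂ) + 1) * character n g) ∧
    (∀ F : SU2 → ℂ, Continuous F →
      Tendsto (fun q : ℝ => ∫ g, deltaKernel q g * F g ∂haar) (𝓝[<] 1) (𝓝 (F 1))) ∧
    -- damped on each interior dual face, the two integrals converge absolutely and agree
    (∀ r : ↥K.bulkEdges → ℝ, (∀ e, r e ∈ Set.Ioo (0 : ℝ) 1) →
      Integrable (D.spinorIntegrand ζ r) (Measure.pi fun _ : ↥K.bulkFlags => spinorMeasure) ∧
      Integrable (D.groupIntegrand ζ fun e => r e ^ (D.fan (K.bulkEdge e)).len)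
        (Measure.pi fun _ : ↥K.triangles => haar) ∧
      D.groupIntegral ζ (fun e => r e ^ (D.fan (K.bulkEdge e)).len) = D.spinorIntegral ζ r) ∧
    -- without damping, one of them exists if and only if the other does, with the same value
    ∀ A : ℂ, D.HasPartitionFunction ζ A ↔ D.HasStateIntegral ζ A := by
  refine ⟨fun q hq g => ?_, fun F hF => tendsto_integral_deltaKernel F hF, fun r hr => ?_,
    fun A => D.hasPartitionFunction_iff ζ hD A⟩
  · exact summable_damped (by rw [Complex.norm_real, Real.norm_eq_abs, abs_of_pos hq.1]; exact hq.2) g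
  · exact ⟨D.integrable_spinorIntegrand ζ hr,
      D.integrable_groupIntegrand ζ (D.pow_len_mem_Ioo hr),
      D.groupIntegral_eq_spinorIntegral ζ hD hr⟩
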